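/- **Setting.** Let $\mathcal L$ be a strict 2-category and $\mathcal S$ a class of its 1-cells. Let $\mathcal L_{\mathcal S}$ be the 2-category obtained from $\mathcal L$ by freely adjoining a right adjoint $\mu^\dagger$ of every $\mu\in\mathcal S$, and $\mathcal L_{\mathrm{all}}$ the one obtained by doing so for all 1-cells. A *natural model* on a category $\mathcal D$ is a map of presheaves $\tau:\mathrm{Tm}\to\mathrm{Ty}$ on $\mathcal D$ that is representable: for $A\in\mathrm{Ty}(\Gamma)$ there is $\mathsf p_A:\Gamma\triangleright A\to\Gamma$ representing the terms of type $A[\sigma]$, $\sigma:\Theta\to\Gamma$. A *natural pseudo-model* is a strictly natural transformation $\tau:\mathrm{Tm}\to\mathrm{Ty}$ of groupoid-valued pseudofunctors on $\mathcal D^{\mathrm{op}}$ that has discrete fibers and is representable in the same sense (terms taken up to isomorphism over $A[\sigma]$). An *adjoint modal pre-model* over $(\mathcal L,\mathcal S)$ consists of: 1. a strict 2-functor $\widehat{\mathscr C}:\mathcal L_{\mathrm{all}}^{\mathrm{coop}}\to\mathcal{C}at$ such that each category $\widehat{\mathscr C}_p$ has a terminal object and is locally cartesian closed; 2. a pseudofunctor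 $\mathscr C:\mathcal L_{\mathcal S}\to\mathcal{C}at$; 3. a pseudonatural transformation $\mathsf L:\widehat{\mathscr C}\to\mathscr C$ of pseudofunctors $\mathcal L\to\mathcal{C}at$, where a 1-cell $\mu$ of $\mathcal L$ acts on $\widehat{\mathscr C}$ by the functor $\widehat{\mathscr C}^{\mu^\dagger}$ and on $\mathscr C$ by $\mathscr C_\mu$, such that each $\mathsf L_p:\widehat{\mathscr C}_p\to\mathscr C_p$ preserves finite limits and has a fully faithful right adjoint $\mathsf R_p$; 4. a natural pseudo-model $\tau_p$ on each $\mathscr C_p$. The *left adjoint splitting* of $\tau_p$ is the natural model $\tau_p^!$ on $\mathscr C_p$ in which a type over $\Gamma$ is a triple $(V,E,n)$ with $V\in\mathscr C_p$, $E$ a type of $\tau_p$ over $V$, and $n:\Gamma\to V$; a term over $\Gamma$ is a triple $(V,E,a)$ with $a:\Gamma\to V\triangleright E$; and the type of $(V,E,a)$ is $(V,E,\mathsf p_E\circ a)$. Put $\widehat\tau_p^!=(\mathsf L_p)^*\tau_p^!$. It is a natural model on $\widehat{\mathscr C}_p$, in which $\Gamma\triangleright A$ is the pullback of $\mathsf R_p(\mathsf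 L_p\Gamma\triangleright A)\to\mathsf R_p\mathsf L_p\Gamma$ along the unit $\Gamma\to\mathsf R_p\mathsf L_p\Gamma$. The *type constructors* are: dependent products with the $\beta$-rule, or with the $\beta$- and $\eta$-rules; dependent sums with their dependent eliminator, or with an invertible pairing map; intensional identity types, or extensional ones (reflexivity invertible); the empty type; the unit type; binary sums; and $W$-types. A natural (pseudo-)model has *weakly stable* structure for a type constructor if all premises in a context $\Gamma$ admit a type over $\Gamma$ (for identity types of $A$, over $\Gamma\triangleright A\triangleright A$) with its structural maps (application for products; the introduction terms for the others) such that, after reindexing along any $\sigma:\Theta\to\Gamma$, the remaining terms required by the rules (abstraction, or the eliminator for every motive) exist and satisfy the computation rules (and uniqueness or invertibility for the stronger variants). It has *strictly stable* structure if all the operations (formation, introduction, elimination) can be chosen so that they satisfy the computation rules and commute strictly, up to equality, with substitution. **Theorem.** Let $(\widehat{\mathscr C},\mathscr C,\mathsf L,\tau)$ be an adjoint modal pre-model over $(\mathcal L,\mathcal S)$, and $p$ an object of $\mathcal L$. (i) $\mathsf R_p$ identifies $\mathscr C_p$ with a local exponential ideal in $\widehat{\mathscr C}_p$: if $f:A\to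 B$ and $g:B\to C$ are maps of $\widehat{\mathscr C}_p$ and $f$ is a pullback of a map in the image of $\mathsf R_p$, then so is the pushforward $g_*(f)$. (ii) For each of the type constructors listed above, if $(\mathscr C_p,\tau_p)$ has weakly stable structure for it, then $(\widehat{\mathscr C}_p,\widehat\tau_p^!)$ has strictly stable structure for it. -/

import Mathlib

open CategoryTheory Bicategory Opposite Limits

universe w₁ v₁ u₁ w₂ v₂ u₂ v u v₃ u₃ w

namespace MATT

/-! ## The 1- and 2-cell dual of a 2-category -/

/-- The 2-category `K^coop`, with both the 1-cells and the 2-cells of `K` reversed. -/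
structure Coop (K : Type u₁) where
  /-- the underlying object of `K` -/
  as : K

namespace Coop

variable {K : Type u₁} [Bicategory.{w₁, v₁} K]

/-- A 1-cell `a ⟶ b` of `K^coop` is a 1-cell `b ⟶ a` of `K`. -/
@[ext]
structure Hom (a b : Coop K) where
  /-- the underlying 1-cell -/
  un : b.as ⟶ a.as

instance : CategoryStruct.{v₁} (Coop K) where
  Hom := Hom
  id a := ⟨𝟙 a.as⟩
  comp f g := ⟨g.un ≫ f.un⟩

/-- A 2-cell `f ⟶ g` of `K^coop` is a 2-cell `g ⟶ f` of `K`. -/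
@[ext]
structure Hom₂ {a b : Coop K} (f g : a ⟶ b) where
  /-- the underlying 2-cell -/
  un : g.un ⟶ f.un

instance (a b : Coop K) : Category.{w₁} (a ⟶ b) where
  Hom := Hom₂
  id f := ⟨𝟙 f.un⟩
  comp η θ := ⟨θ.un ≫ η.un⟩

@[ext]
theorem hom₂_ext {a b : Coop K} {f g : a ⟶ b} {η θ : f ⟶ g} (h : η.un = θ.un) : η = θ :=
  Hom₂.ext h

@[simp] theorem id_un (a : Coop K) : Hom.un (𝟙 a) = 𝟙 a.as := rfl

@[simp] theorem comp_un {a b c : Coop K} (f : a ⟶ b) (g : b ⟶ c) :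
    (f ≫ g).un = g.un ≫ f.un := rfl

@[simp] theorem id₂_un {a b : Coop K} (f : a ⟶ b) : Hom₂.un (𝟙 f) = 𝟙 f.un := rfl

@[simp] theorem comp₂_un {a b : Coop K} {f g h : a ⟶ b} (η : f ⟶ g) (θ : g ⟶ h) :
    (η ≫ θ).un = θ.un ≫ η.un := rfl

/-- An invertible 2-cell of `K` as an invertible 2-cell of `K^coop`. -/
@[simps]
def isoMk {a b : Coop K} {f g : a ⟶ b} (e : g.un ≅ f.un) : f ≅ g where
  hom := ⟨e.hom⟩
  inv := ⟨e.inv⟩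

instance : Bicategory.{w₁, v₁} (Coop K) where
  homCategory _ _ := inferInstance
  whiskerLeft f _ _ η := ⟨η.un ▷ f.un⟩
  whiskerRight η h := ⟨h.un ◁ η.un⟩
  associator f g h := isoMk (α_ h.un g.un f.un)
  leftUnitor f := isoMk (ρ_ f.un).symm
  rightUnitor f := isoMk (λ_ f.un).symm
  whiskerLeft_id _ _ := hom₂_ext (by simp)
  whiskerLeft_comp _ _ _ _ _ _ := hom₂_ext (by simp)
  id_whiskerLeft _ := hom₂_ext (by simp)
  comp_whiskerLeft _ _ _ _ _ := hom₂_ext (by simp)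
  id_whiskerRight _ _ := hom₂_ext (by simp)
  comp_whiskerRight _ _ _ := hom₂_ext (by simp)
  whiskerRight_id _ := hom₂_ext (by simp)
  whiskerRight_comp _ _ _ := hom₂_ext (by simp)
  whisker_assoc _ _ _ _ _ := hom₂_ext (by simp)
  whisker_exchange _ _ := hom₂_ext (by simp [whisker_exchange])
  pentagon _ _ _ _ := hom₂_ext (by simp)
  triangle _ _ := hom₂_ext (by simp)

end Coop

/-! ## Right adjoints of a pseudofunctor valued in left adjoints -/

section RightAdjoints

variable {B : Type u₁} [Bicategory.{w₁, v₁} B] {K : Type u₂} [Bicategory.{w₂, v₂} K]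

/-- The pseudofunctor from adjunctions in `K` to `K^coop` that selects the right adjoints; on
2-cells it takes mates. -/
def rightAdjoint : Adj K ⥤ᵖ Coop K where
  obj a := ⟨a.obj⟩
  map f := ⟨f.r⟩
  map₂ η := ⟨η.τr⟩
  mapId _ := Iso.refl _
  mapComp _ _ := Iso.refl _
  map₂_whisker_left _ _ _ _ := Coop.hom₂_ext (by simp; rfl)
  map₂_whisker_right _ _ := Coop.hom₂_ext (by simp; rfl)
  map₂_associator f g h := Coop.hom₂_ext (by
    simp
    exact ((congrArg (· ≫ _) (id_whiskerRight (h.r ≫ g.r) f.r)).trans (Category.id_comp _)).symm)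
  map₂_left_unitor _ := Coop.hom₂_ext (by simp; rfl)
  map₂_right_unitor _ := Coop.hom₂_ext (by simp; rfl)

/-- A pseudofunctor together with a right adjoint of the image of every 1-cell, as a pseudofunctor
into the bicategory of adjunctions. -/
def toAdj (F : B ⥤ᵖ K) (r : ∀ {a b : B}, (a ⟶ b) → (F.obj b ⟶ F.obj a))
    (adj : ∀ {a b : B} (f : a ⟶ b), F.map f ⊣ r f) : B ⥤ᵖ Adj K where
  obj a := ⟨F.obj a⟩
  map f := .mk (adj f)
  map₂ {_ _ f g} η := { τl := F.map₂ η, τr := conjugateEquiv (adj g) (adj f) (F.map₂ η) }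
  mapId a := Adj.iso₂Mk (F.mapId a) (conjugateIsoEquiv (Adjunction.id _) (adj _) (F.mapId a))
  mapComp f g := Adj.iso₂Mk (F.mapComp f g)
    (conjugateIsoEquiv ((adj f).comp (adj g)) (adj _) (F.mapComp f g))

end RightAdjoints

/-! ## Freely adjoining right adjoints to a 2-category -/

section LAdj

variable {L : Type u₁} [Bicategory.{w₁, v₁} L]

/-- The 2-category obtained from the 2-category `L` by freely adjoining a right adjoint of every
1-cell in the class `S`. It has the objects of `L`. -/
structure LAdj (S : ∀ ⦃p q : L⦄, (p ⟶ q) → Prop) where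
  /-- the underlying object of `L` -/
  as : L

namespace LAdj

variable (S : ∀ ⦃p q : L⦄, (p ⟶ q) → Prop)

/-- Formal composites of 1-cells of `L` and of right adjoints `μ†` of the members of `S`. -/
inductive Word : L → L → Type max u₁ v₁
  | of {p q : L} (μ : p ⟶ q) : Word p q
  | dag {p q : L} (μ : p ⟶ q) (h : S μ) : Word q p
  | id (p : L) : Word p p
  | comp {p q r : L} (f : Word p q) (g : Word q r) : Word p r

variable {S}

/-- The relations between formal composites: the category axioms, and functoriality of the
inclusion of `L`. -/
inductive Word.Rel : ∀ {p q : L}, Word S p q → Word S p q → Prop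
  | id_comp {p q : L} (f : Word S p q) : Rel (.comp (.id p) f) f
  | comp_id {p q : L} (f : Word S p q) : Rel (.comp f (.id q)) f
  | assoc {p q r s : L} (f : Word S p q) (g : Word S q r) (h : Word S r s) :
      Rel (.comp (.comp f g) h) (.comp f (.comp g h))
  | of_id (p : L) : Rel (.of (𝟙 p)) (.id p)
  | of_comp {p q r : L} (μ : p ⟶ q) (ν : q ⟶ r) :
      Rel (.of (μ ≫ ν)) (.comp (.of μ) (.of ν))
  | comp_left {p q r : L} {f f' : Word S p q} (g : Word S q r) :
      Rel f f' → Rel (.comp f g) (.comp f' g)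
  | comp_right {p q r : L} (f : Word S p q) {g g' : Word S q r} :
      Rel g g' → Rel (.comp f g) (.comp f g')

instance : CategoryStruct (LAdj S) where
  Hom p q := Quot (Word.Rel (S := S) (p := p.as) (q := q.as))
  id p := Quot.mk _ (.id p.as)
  comp := Quot.map₂ .comp (fun f _ _ h => .comp_right f h) (fun _ _ g h => .comp_left g h)

protected theorem id_comp {p q : LAdj S} (f : p ⟶ q) : 𝟙 p ≫ f = f := by
  induction f using Quot.ind
  exact Quot.sound (.id_comp _)

protected theorem comp_id {p q : LAdj S} (f : p ⟶ q) : f ≫ 𝟙 q = f := by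
  induction f using Quot.ind
  exact Quot.sound (.comp_id _)

protected theorem assoc {p q r s : LAdj S} (f : p ⟶ q) (g : q ⟶ r) (h : r ⟶ s) :
    (f ≫ g) ≫ h = f ≫ g ≫ h := by
  induction f using Quot.ind
  induction g using Quot.ind
  induction h using Quot.ind
  exact Quot.sound (.assoc _ _ _)

/-- The 1-cell given by a 1-cell of `L`. -/
def of {p q : L} (μ : p ⟶ q) : (⟨p⟩ : LAdj S) ⟶ ⟨q⟩ := Quot.mk _ (.of μ)

/-- The adjoined right adjoint `μ†`. -/
def dag {p q : L} (μ : p ⟶ q) (h : S μ) : (⟨q⟩ : LAdj S) ⟶ ⟨p⟩ := Quot.mk _ (.dag μ h)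

theorem of_id (p : L) : of (S := S) (𝟙 p) = 𝟙 _ := Quot.sound (.of_id p)

theorem of_comp {p q r : L} (μ : p ⟶ q) (ν : q ⟶ r) :
    of (S := S) (μ ≫ ν) = of μ ≫ of ν := Quot.sound (.of_comp μ ν)

/-- Formal pastings of 2-cells of `L`, and of units and counits for the adjoined right adjoints.
The generators `eq` are the identity 2-cells of equal 1-cells. -/
inductive Cell : ∀ {p q : LAdj S}, (p ⟶ q) → (p ⟶ q) → Type max u₁ v₁ w₁
  | eq {p q : LAdj S} {f g : p ⟶ q} (h : f = g) : Cell f g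
  | of {p q : L} {μ ν : p ⟶ q} (α : μ ⟶ ν) : Cell (of μ) (of ν)
  | unit {p q : L} (μ : p ⟶ q) (h : S μ) : Cell (𝟙 (LAdj.mk p : LAdj S)) (LAdj.of μ ≫ dag μ h)
  | counit {p q : L} (μ : p ⟶ q) (h : S μ) : Cell (dag μ h ≫ LAdj.of μ) (𝟙 (LAdj.mk q : LAdj S))
  | comp {p q : LAdj S} {f g h : p ⟶ q} (η : Cell f g) (θ : Cell g h) : Cell f h
  | wl {p q r : LAdj S} (f : p ⟶ q) {g h : q ⟶ r} (η : Cell g h) : Cell (f ≫ g) (f ≫ h)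
  | wr {p q r : LAdj S} {f g : p ⟶ q} (η : Cell f g) (h : q ⟶ r) : Cell (f ≫ h) (g ≫ h)

/-- The relations between formal pastings: the axioms of a 2-category, 2-functoriality of the
inclusion of `L`, and the triangle identities. -/
inductive Cell.Rel : ∀ {p q : LAdj S} {f g : p ⟶ q}, Cell f g → Cell f g → Prop
  | id_comp {p q : LAdj S} {f g : p ⟶ q} (η : Cell f g) : Rel (.comp (.eq rfl) η) η
  | comp_id {p q : LAdj S} {f g : p ⟶ q} (η : Cell f g) : Rel (.comp η (.eq rfl)) η
  | assoc {p q : LAdj S} {f g h i : p ⟶ q} (η : Cell f g) (θ : Cell g h) (κ : Cell h i) :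
      Rel (.comp (.comp η θ) κ) (.comp η (.comp θ κ))
  | wl_id {p q r : LAdj S} (f : p ⟶ q) (g : q ⟶ r) :
      Rel (.wl f (.eq (rfl : g = g))) (.eq rfl)
  | wl_comp {p q r : LAdj S} (f : p ⟶ q) {g h i : q ⟶ r} (η : Cell g h) (θ : Cell h i) :
      Rel (.wl f (.comp η θ)) (.comp (.wl f η) (.wl f θ))
  | id_wl {p q : LAdj S} {f g : p ⟶ q} (η : Cell f g) :
      Rel (.wl (𝟙 p) η) (.comp (.eq (LAdj.id_comp f)) (.comp η (.eq (LAdj.id_comp g).symm)))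
  | comp_wl {p q r s : LAdj S} (f : p ⟶ q) (g : q ⟶ r) {h h' : r ⟶ s} (η : Cell h h') :
      Rel (.wl (f ≫ g) η) (.comp (.eq (LAdj.assoc f g h))
        (.comp (.wl f (.wl g η)) (.eq (LAdj.assoc f g h').symm)))
  | id_wr {p q r : LAdj S} (f : p ⟶ q) (g : q ⟶ r) :
      Rel (.wr (.eq (rfl : f = f)) g) (.eq rfl)
  | comp_wr {p q r : LAdj S} {f g h : p ⟶ q} (η : Cell f g) (θ : Cell g h) (i : q ⟶ r) :
      Rel (.wr (.comp η θ) i) (.comp (.wr η i) (.wr θ i))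
  | wr_id {p q : LAdj S} {f g : p ⟶ q} (η : Cell f g) :
      Rel (.wr η (𝟙 q)) (.comp (.eq (LAdj.comp_id f)) (.comp η (.eq (LAdj.comp_id g).symm)))
  | wr_comp {p q r s : LAdj S} {f f' : p ⟶ q} (η : Cell f f') (g : q ⟶ r) (h : r ⟶ s) :
      Rel (.wr η (g ≫ h)) (.comp (.eq (LAdj.assoc f g h).symm)
        (.comp (.wr (.wr η g) h) (.eq (LAdj.assoc f' g h))))
  | wl_wr {p q r s : LAdj S} (f : p ⟶ q) {g g' : q ⟶ r} (η : Cell g g') (h : r ⟶ s) :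
      Rel (.wr (.wl f η) h) (.comp (.eq (LAdj.assoc f g h))
        (.comp (.wl f (.wr η h)) (.eq (LAdj.assoc f g' h).symm)))
  | exchange {p q r : LAdj S} {f g : p ⟶ q} {h i : q ⟶ r} (η : Cell f g) (θ : Cell h i) :
      Rel (.comp (.wl f θ) (.wr η i)) (.comp (.wr η h) (.wl g θ))
  | of_id {p q : L} (μ : p ⟶ q) : Rel (.of (𝟙 μ)) (.eq rfl)
  | of_comp {p q : L} {μ ν ξ : p ⟶ q} (α : μ ⟶ ν) (β : ν ⟶ ξ) :
      Rel (.of (α ≫ β)) (.comp (.of α) (.of β))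
  | of_wl {p q r : L} (μ : p ⟶ q) {ν ξ : q ⟶ r} (α : ν ⟶ ξ) :
      Rel (.of (μ ◁ α)) (.comp (.eq (LAdj.of_comp μ ν))
        (.comp (.wl (LAdj.of μ) (.of α)) (.eq (LAdj.of_comp μ ξ).symm)))
  | of_wr {p q r : L} {μ ν : p ⟶ q} (α : μ ⟶ ν) (ξ : q ⟶ r) :
      Rel (.of (α ▷ ξ)) (.comp (.eq (LAdj.of_comp μ ξ))
        (.comp (.wr (.of α) (LAdj.of ξ)) (.eq (LAdj.of_comp ν ξ).symm)))
  | left_triangle {p q : L} (μ : p ⟶ q) (h : S μ) :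
      Rel (.comp (.wr (.unit μ h) (LAdj.of μ))
          (.comp (.eq (LAdj.assoc _ _ _)) (.wl (LAdj.of μ) (.counit μ h))))
        (.eq ((LAdj.id_comp _).trans (LAdj.comp_id _).symm))
  | right_triangle {p q : L} (μ : p ⟶ q) (h : S μ) :
      Rel (.comp (.wl (dag μ h) (.unit μ h))
          (.comp (.eq (LAdj.assoc _ _ _).symm) (.wr (.counit μ h) (dag μ h))))
        (.eq ((LAdj.comp_id _).trans (LAdj.id_comp _).symm))
  | comp_left {p q : LAdj S} {f g h : p ⟶ q} {η η' : Cell f g} (θ : Cell g h) :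
      Rel η η' → Rel (.comp η θ) (.comp η' θ)
  | comp_right {p q : LAdj S} {f g h : p ⟶ q} (η : Cell f g) {θ θ' : Cell g h} :
      Rel θ θ' → Rel (.comp η θ) (.comp η θ')
  | wl_congr {p q r : LAdj S} (f : p ⟶ q) {g h : q ⟶ r} {η η' : Cell g h} :
      Rel η η' → Rel (.wl f η) (.wl f η')
  | wr_congr {p q r : LAdj S} {f g : p ⟶ q} {η η' : Cell f g} (h : q ⟶ r) :
      Rel η η' → Rel (.wr η h) (.wr η' h)

instance (p q : LAdj S) : Category (p ⟶ q) where
  Hom f g := Quot (Cell.Rel (f := f) (g := g))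
  id f := Quot.mk _ (.eq rfl)
  comp := Quot.map₂ .comp (fun f _ _ h => .comp_right f h) (fun _ _ g h => .comp_left g h)
  id_comp := by rintro _ _ ⟨η⟩; exact Quot.sound (.id_comp η)
  comp_id := by rintro _ _ ⟨η⟩; exact Quot.sound (.comp_id η)
  assoc := by rintro _ _ _ _ ⟨η⟩ ⟨θ⟩ ⟨κ⟩; exact Quot.sound (.assoc η θ κ)

/-- The 2-cell given by a formal pasting. -/
def cell {p q : LAdj S} {f g : p ⟶ q} (η : Cell f g) : f ⟶ g := Quot.mk _ η

theorem cell_eq {p q : LAdj S} {f g : p ⟶ q} (h : f = g) : cell (.eq h) = eqToHom h := by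
  subst h; rfl

/-- Left whiskering of 2-cells. -/
def whiskerL {p q r : LAdj S} (f : p ⟶ q) {g h : q ⟶ r} (η : g ⟶ h) : f ≫ g ⟶ f ≫ h :=
  Quot.map (.wl f) (fun _ _ => .wl_congr f) η

/-- Right whiskering of 2-cells. -/
def whiskerR {p q r : LAdj S} {f g : p ⟶ q} (η : f ⟶ g) (h : q ⟶ r) : f ≫ h ⟶ g ≫ h :=
  Quot.map (.wr · h) (fun _ _ => .wr_congr h) η

theorem whiskerL_eqToHom {p q r : LAdj S} (f : p ⟶ q) {g h : q ⟶ r} (e : g = h) :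
    whiskerL f (eqToHom e) = eqToHom (e ▸ rfl) := by
  subst e; exact Quot.sound (.wl_id f g)

theorem whiskerR_eqToHom {p q r : LAdj S} {f g : p ⟶ q} (e : f = g) (h : q ⟶ r) :
    whiskerR (eqToHom e) h = eqToHom (e ▸ rfl) := by
  subst e; exact Quot.sound (.id_wr f h)

instance : Bicategory (LAdj S) where
  homCategory _ _ := inferInstance
  whiskerLeft f _ _ η := whiskerL f η
  whiskerRight η h := whiskerR η h
  associator f g h := eqToIso (LAdj.assoc f g h)
  leftUnitor f := eqToIso (LAdj.id_comp f)
  rightUnitor f := eqToIso (LAdj.comp_id f)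
  whiskerLeft_id f g := Quot.sound (.wl_id f g)
  whiskerLeft_comp := by rintro _ _ _ f _ _ _ ⟨η⟩ ⟨θ⟩; exact Quot.sound (.wl_comp f η θ)
  id_whiskerLeft := by
    rintro _ _ f g ⟨η⟩
    simp only [eqToIso.hom, eqToIso.inv, ← cell_eq]
    exact Quot.sound (.id_wl η)
  comp_whiskerLeft := by
    rintro _ _ _ _ f g h h' ⟨η⟩
    simp only [eqToIso.hom, eqToIso.inv, ← cell_eq]
    exact Quot.sound (.comp_wl f g η)
  id_whiskerRight f g := Quot.sound (.id_wr f g)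
  comp_whiskerRight := by rintro _ _ _ _ _ _ ⟨η⟩ ⟨θ⟩ i; exact Quot.sound (.comp_wr η θ i)
  whiskerRight_id := by
    rintro _ _ f g ⟨η⟩
    simp only [eqToIso.hom, eqToIso.inv, ← cell_eq]
    exact Quot.sound (.wr_id η)
  whiskerRight_comp := by
    rintro _ _ _ _ f f' ⟨η⟩ g h
    simp only [eqToIso.hom, eqToIso.inv, ← cell_eq]
    exact Quot.sound (.wr_comp η g h)
  whisker_assoc := by
    rintro _ _ _ _ f g g' ⟨η⟩ h
    simp only [eqToIso.hom, eqToIso.inv, ← cell_eq]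
    exact Quot.sound (.wl_wr f η h)
  whisker_exchange := by rintro _ _ _ _ _ _ _ ⟨η⟩ ⟨θ⟩; exact Quot.sound (.exchange η θ)
  pentagon f g h i := by simp [whiskerL_eqToHom, whiskerR_eqToHom]
  triangle f g := by simp [whiskerL_eqToHom, whiskerR_eqToHom]

instance : Bicategory.Strict (LAdj S) where
  id_comp := LAdj.id_comp
  comp_id := LAdj.comp_id
  assoc := LAdj.assoc

variable (S) in
/-- The inclusion of `L`, a strict 2-functor. -/
def incl [Bicategory.Strict L] : StrictPseudofunctor L (LAdj S) :=
  StrictPseudofunctor.mk''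
    { obj := fun p => ⟨p⟩
      map := fun μ => of μ
      map₂ := fun α => cell (.of α)
      map₂_id := fun μ => Quot.sound (.of_id μ)
      map₂_comp := fun α β => Quot.sound (.of_comp α β)
      map_id := of_id
      map_comp := of_comp
      map₂_whisker_left := fun μ _ _ α => by
        simp only [← cell_eq]
        exact Quot.sound (.of_wl μ α)
      map₂_whisker_right := fun α ξ => by
        simp only [← cell_eq]
        exact Quot.sound (.of_wr α ξ) }

/-- The adjunction `μ ⊣ μ†`. -/
def adj {p q : L} (μ : p ⟶ q) (h : S μ) :
    Bicategory.Adjunction (of (S := S) μ) (dag μ h) where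
  unit := cell (.unit μ h)
  counit := cell (.counit μ h)
  left_triangle := by
    have e := Quot.sound (Cell.Rel.left_triangle μ h)
    have e₁ : (α_ (of (S := S) μ) (dag μ h) (of μ)).hom = cell (.eq (LAdj.assoc _ _ _)) :=
      (cell_eq _).symm
    have e₂ : (λ_ (of (S := S) μ)).hom ≫ (ρ_ (of μ)).inv
        = cell (.eq ((LAdj.id_comp _).trans (LAdj.comp_id _).symm)) :=
      (eqToHom_trans (LAdj.id_comp (of μ)) (LAdj.comp_id (of μ)).symm).trans (cell_eq _).symm
    rw [e₂]
    refine Eq.trans ?_ e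
    simp only [leftZigzag, bicategoricalComp]
    simp [BicategoricalCoherence.iso]
    rw [e₁]
    rfl
  right_triangle := by
    have e := Quot.sound (Cell.Rel.right_triangle μ h)
    have e₁ : (α_ (dag μ h) (of (S := S) μ) (dag μ h)).inv = cell (.eq (LAdj.assoc _ _ _).symm) :=
      (cell_eq _).symm
    have e₂ : (ρ_ (dag (S := S) μ h)).hom ≫ (λ_ (dag μ h)).inv
        = cell (.eq ((LAdj.comp_id _).trans (LAdj.id_comp _).symm)) :=
      (eqToHom_trans (LAdj.comp_id (dag μ h)) (LAdj.id_comp (dag μ h)).symm).trans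
        (cell_eq _).symm
    rw [e₂]
    refine Eq.trans ?_ e
    simp only [rightZigzag, bicategoricalComp]
    simp [BicategoricalCoherence.iso]
    rw [e₁]
    rfl

end LAdj

end LAdj

/-! ## Comprehension and substitution -/

/-- The data of types and comprehension that natural models and natural pseudo-models share: types
`A` over `Γ`, their comprehension `p A : Γ ▷ A ⟶ Γ`, and substitution of types along `σ : Θ ⟶ Γ`,
with chosen pullback squares. Substitution is not assumed to be functorial. -/
structure TypeCat (D : Type u) [Category.{v} D] where
  /-- types in context `Γ` -/
  Ty : D → Type w
  /-- context extension `Γ ▷ A` -/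
  ext : ∀ {Γ : D}, Ty Γ → D
  /-- type projection -/
  p : ∀ {Γ : D} (A : Ty Γ), ext A ⟶ Γ
  /-- substitution `A[σ]` -/
  sub : ∀ {Θ Γ : D} (_ : Θ ⟶ Γ), Ty Γ → Ty Θ
  /-- the map `Θ ▷ A[σ] ⟶ Γ ▷ A` -/
  up : ∀ {Θ Γ : D} (σ : Θ ⟶ Γ) (A : Ty Γ), ext (sub σ A) ⟶ ext A
  isPullback : ∀ {Θ Γ : D} (σ : Θ ⟶ Γ) (A : Ty Γ),
    IsPullback (up σ A) (p (sub σ A)) (p A) σ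

namespace TypeCat

variable {D : Type u} [Category.{v} D] (M : TypeCat.{v, u, w} D)

theorem up_p {Θ Γ : D} (σ : Θ ⟶ Γ) (A : M.Ty Γ) : M.up σ A ≫ M.p A = M.p (M.sub σ A) ≫ σ :=
  (M.isPullback σ A).w

/-- The map into `Θ ▷ A[σ]` with the given components in `Θ` and `Γ ▷ A`. -/
noncomputable def pair {X Θ Γ : D} (σ : Θ ⟶ Γ) (A : M.Ty Γ) (f : X ⟶ Θ) (g : X ⟶ M.ext A)
    (h : g ≫ M.p A = f ≫ σ) : X ⟶ M.ext (M.sub σ A) :=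
  (M.isPullback σ A).lift g f h

@[simp]
theorem pair_p {X Θ Γ : D} (σ : Θ ⟶ Γ) (A : M.Ty Γ) (f : X ⟶ Θ) (g : X ⟶ M.ext A)
    (h : g ≫ M.p A = f ≫ σ) : M.pair σ A f g h ≫ M.p (M.sub σ A) = f :=
  (M.isPullback σ A).lift_snd _ _ _

@[simp]
theorem pair_up {X Θ Γ : D} (σ : Θ ⟶ Γ) (A : M.Ty Γ) (f : X ⟶ Θ) (g : X ⟶ M.ext A)
    (h : g ≫ M.p A = f ≫ σ) : M.pair σ A f g h ≫ M.up σ A = g :=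
  (M.isPullback σ A).lift_fst _ _ _

theorem hom_ext {X Θ Γ : D} {σ : Θ ⟶ Γ} {A : M.Ty Γ} {f g : X ⟶ M.ext (M.sub σ A)}
    (h₁ : f ≫ M.p (M.sub σ A) = g ≫ M.p (M.sub σ A)) (h₂ : f ≫ M.up σ A = g ≫ M.up σ A) : f = g :=
  (M.isPullback σ A).hom_ext h₂ h₁

@[simp]
theorem pair_p_assoc {X Θ Γ Y : D} (σ : Θ ⟶ Γ) (A : M.Ty Γ) (f : X ⟶ Θ) (g : X ⟶ M.ext A)
    (h : g ≫ M.p A = f ≫ σ) (k : Θ ⟶ Y) :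
    M.pair σ A f g h ≫ M.p (M.sub σ A) ≫ k = f ≫ k := by
  rw [← Category.assoc, pair_p]

@[simp]
theorem pair_up_assoc {X Θ Γ Y : D} (σ : Θ ⟶ Γ) (A : M.Ty Γ) (f : X ⟶ Θ) (g : X ⟶ M.ext A)
    (h : g ≫ M.p A = f ≫ σ) (k : M.ext A ⟶ Y) :
    M.pair σ A f g h ≫ M.up σ A ≫ k = g ≫ k := by
  rw [← Category.assoc, pair_up]

/-- A lift of `f : X ⟶ Γ` along the type projection `Γ ▷ A ⟶ Γ`, that is, a term of type `A[f]`. -/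
@[ext]
structure Lift {X Γ : D} (f : X ⟶ Γ) (A : M.Ty Γ) where
  /-- the underlying map -/
  hom : X ⟶ M.ext A
  w : hom ≫ M.p A = f

/-- A section of the type projection `Γ ▷ A ⟶ Γ`, that is, a term of type `A`. -/
abbrev Sec {Γ : D} (A : M.Ty Γ) := M.Lift (𝟙 Γ) A

variable {M}

/-- Reindexing of a lift along a commutative square. -/
noncomputable def Lift.reindex {X Γ X' Θ : D} {f : X ⟶ Γ} {A : M.Ty Γ} (d : M.Lift f A)
    (σ : Θ ⟶ Γ) (t : X' ⟶ X) (f' : X' ⟶ Θ) (h : t ≫ f = f' ≫ σ) : M.Lift f' (M.sub σ A) where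
  hom := M.pair σ A f' (t ≫ d.hom) (by rw [Category.assoc, d.w, h])
  w := by simp

/-- Substitution `a[σ]` in a term. -/
noncomputable def Sec.sub {Θ Γ : D} {A : M.Ty Γ} (a : M.Sec A) (σ : Θ ⟶ Γ) :
    M.Sec (M.sub σ A) :=
  Lift.reindex a σ σ (𝟙 Θ) (by simp)

variable (M)

/-- The map `Θ ▷ A[σ][p] ⟶ Γ ▷ A[p]` over `t`, for a commutative square `t ≫ f = f' ≫ σ`. -/
noncomputable def up₂ {X Γ X' Θ : D} (f : X ⟶ Γ) (A : M.Ty Γ) (σ : Θ ⟶ Γ) (t : X' ⟶ X)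
    (f' : X' ⟶ Θ) (h : t ≫ f = f' ≫ σ) :
    M.ext (M.sub f' (M.sub σ A)) ⟶ M.ext (M.sub f A) :=
  M.pair f A (M.p _ ≫ t) (M.up f' (M.sub σ A) ≫ M.up σ A) (by
    rw [Category.assoc, up_p, ← Category.assoc, up_p, Category.assoc, Category.assoc, h])

/-! ### Dependent products -/

/-- Data for a dependent product of `B` over `A`: a type with an application map
`Γ ▷ Π ▷ A ⟶ Γ ▷ A ▷ B` over `Γ ▷ A`. -/
@[ext]
structure PiData {Γ : D} (A : M.Ty Γ) (B : M.Ty (M.ext A)) where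
  /-- the type -/
  ty : M.Ty Γ
  /-- application -/
  app : M.Lift (M.up (M.p ty) A) B

namespace PiData

variable {M} {Γ : D} {A : M.Ty Γ} {B : M.Ty (M.ext A)}

/-- Reindexing along `σ`. -/
noncomputable def reindex (X : M.PiData A B) {Θ : D} (σ : Θ ⟶ Γ) :
    M.PiData (M.sub σ A) (M.sub (M.up σ A) B) where
  ty := M.sub σ X.ty
  app := X.app.reindex (M.up σ A) (M.up₂ (M.p X.ty) A σ (M.up σ X.ty) (M.p _) (M.up_p σ X.ty))
    (M.up (M.p (M.sub σ X.ty)) (M.sub σ A)) (by simp [up₂])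

/-- The section of `B` obtained by applying a section of the dependent product to the variable
of type `A`. -/
noncomputable def ap (X : M.PiData A B) (f : M.Sec X.ty) : M.Sec B where
  hom := M.pair (M.p X.ty) A (M.p A ≫ f.hom) (𝟙 _) (by simp [f.w]) ≫ X.app.hom
  w := by rw [Category.assoc, X.app.w, pair_up]

/-- Every section of `B` has an abstraction that satisfies the β-rule. -/
def IsPi (X : M.PiData A B) : Prop := ∀ b : M.Sec B, ∃ f : M.Sec X.ty, X.ap f = b

/-- Every section of `B` has a unique abstraction that satisfies the β-rule. -/
def IsPiEta (X : M.PiData A B) : Prop := ∀ b : M.Sec B, ∃! f : M.Sec X.ty, X.ap f = b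

end PiData

/-- Weakly stable dependent products (with the β-rule). -/
def WeakPi : Prop :=
  ∀ {Γ : D} (A : M.Ty Γ) (B : M.Ty (M.ext A)), ∃ X : M.PiData A B,
    ∀ {Θ : D} (σ : Θ ⟶ Γ), (X.reindex σ).IsPi

/-- Weakly stable dependent products with the η-rule. -/
def WeakPiEta : Prop :=
  ∀ {Γ : D} (A : M.Ty Γ) (B : M.Ty (M.ext A)), ∃ X : M.PiData A B,
    ∀ {Θ : D} (σ : Θ ⟶ Γ), (X.reindex σ).IsPiEta

/-- Strictly stable dependent products (with the β-rule). -/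
structure StrictPi where
  /-- formation and application -/
  form : ∀ {Γ : D} (A : M.Ty Γ) (B : M.Ty (M.ext A)), M.PiData A B
  form_sub : ∀ {Θ Γ : D} (σ : Θ ⟶ Γ) (A : M.Ty Γ) (B : M.Ty (M.ext A)),
    form (M.sub σ A) (M.sub (M.up σ A) B) = (form A B).reindex σ
  /-- abstraction -/
  lam : ∀ {Γ : D} {A : M.Ty Γ} {B : M.Ty (M.ext A)} (X : M.PiData A B) (_ : X = form A B)
    (_ : M.Sec B), M.Sec X.ty
  beta : ∀ {Γ : D} {A : M.Ty Γ} {B : M.Ty (M.ext A)} (X : M.PiData A B) (hX : X = form A B)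
    (b : M.Sec B), X.ap (lam X hX b) = b
  lam_sub : ∀ {Θ Γ : D} (σ : Θ ⟶ Γ) {A : M.Ty Γ} {B : M.Ty (M.ext A)} (X : M.PiData A B)
    (hX : X = form A B) (hX' : X.reindex σ = form _ _) (b : M.Sec B),
    lam (X.reindex σ) hX' (b.sub (M.up σ A)) = (lam X hX b).sub σ

/-- Strictly stable dependent products with the η-rule. -/
structure StrictPiEta extends StrictPi M where
  eta : ∀ {Γ : D} {A : M.Ty Γ} {B : M.Ty (M.ext A)} (X : M.PiData A B) (hX : X = form A B)
    (f : M.Sec X.ty), lam X hX (X.ap f) = f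

/-! ### Dependent sums -/

/-- Data for a dependent sum: a type with a pairing map `Γ ▷ A ▷ B ⟶ Γ ▷ Σ` over `Γ`. -/
@[ext]
structure SigmaData {Γ : D} (A : M.Ty Γ) (B : M.Ty (M.ext A)) where
  /-- the type -/
  ty : M.Ty Γ
  /-- pairing -/
  tm : M.Lift (M.p B ≫ M.p A) ty

namespace SigmaData

variable {M} {Γ : D} {A : M.Ty Γ} {B : M.Ty (M.ext A)}

/-- Reindexing along `σ`. -/
noncomputable def reindex (X : M.SigmaData A B) {Θ : D} (σ : Θ ⟶ Γ) :
    M.SigmaData (M.sub σ A) (M.sub (M.up σ A) B) where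
  ty := M.sub σ X.ty
  tm := X.tm.reindex σ (M.up (M.up σ A) B) (M.p _ ≫ M.p _) (by
    rw [← Category.assoc, up_p, Category.assoc, up_p, Category.assoc])

/-- The elimination rule, with its computation rule. -/
def IsSigma (X : M.SigmaData A B) : Prop :=
  ∀ (C : M.Ty (M.ext X.ty)) (d : M.Lift X.tm.hom C), ∃ s : M.Sec C, X.tm.hom ≫ s.hom = d.hom

end SigmaData

/-- Weakly stable dependent sums. -/
def WeakSigma : Prop :=
  ∀ {Γ : D} (A : M.Ty Γ) (B : M.Ty (M.ext A)), ∃ X : M.SigmaData A B,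
    ∀ {Θ : D} (σ : Θ ⟶ Γ), (X.reindex σ).IsSigma

/-- Weakly stable strong dependent sums, whose pairing map is invertible. -/
def WeakSigmaEta : Prop :=
  ∀ {Γ : D} (A : M.Ty Γ) (B : M.Ty (M.ext A)), ∃ X : M.SigmaData A B,
    ∀ {Θ : D} (σ : Θ ⟶ Γ), IsIso (X.reindex σ).tm.hom

/-- Strictly stable dependent sums. -/
structure StrictSigma where
  /-- formation and pairing -/
  form : ∀ {Γ : D} (A : M.Ty Γ) (B : M.Ty (M.ext A)), M.SigmaData A B
  form_sub : ∀ {Θ Γ : D} (σ : Θ ⟶ Γ) (A : M.Ty Γ) (B : M.Ty (M.ext A)),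
    form (M.sub σ A) (M.sub (M.up σ A) B) = (form A B).reindex σ
  /-- elimination -/
  elim : ∀ {Γ : D} {A : M.Ty Γ} {B : M.Ty (M.ext A)} (X : M.SigmaData A B) (_ : X = form A B)
    (C : M.Ty (M.ext X.ty)) (_ : M.Lift X.tm.hom C), M.Sec C
  comp : ∀ {Γ : D} {A : M.Ty Γ} {B : M.Ty (M.ext A)} (X : M.SigmaData A B) (hX : X = form A B)
    (C : M.Ty (M.ext X.ty)) (d : M.Lift X.tm.hom C), X.tm.hom ≫ (elim X hX C d).hom = d.hom
  elim_sub : ∀ {Θ Γ : D} (σ : Θ ⟶ Γ) {A : M.Ty Γ} {B : M.Ty (M.ext A)} (X : M.SigmaData A B)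
    (hX : X = form A B) (hX' : X.reindex σ = form _ _) (C : M.Ty (M.ext X.ty))
    (d : M.Lift X.tm.hom C),
    elim (X.reindex σ) hX' (M.sub (M.up σ X.ty) C)
      (d.reindex (M.up σ X.ty) (M.up (M.up σ A) B) _ (by
        simp [SigmaData.reindex, Lift.reindex])) = (elim X hX C d).sub (M.up σ X.ty)

/-- Strictly stable strong dependent sums. -/
structure StrictSigmaEta where
  /-- formation and pairing -/
  form : ∀ {Γ : D} (A : M.Ty Γ) (B : M.Ty (M.ext A)), M.SigmaData A B
  form_sub : ∀ {Θ Γ : D} (σ : Θ ⟶ Γ) (A : M.Ty Γ) (B : M.Ty (M.ext A)),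
    form (M.sub σ A) (M.sub (M.up σ A) B) = (form A B).reindex σ
  isIso : ∀ {Γ : D} (A : M.Ty Γ) (B : M.Ty (M.ext A)), IsIso (form A B).tm.hom

/-! ### Identity types -/

/-- The diagonal `Γ ▷ A ⟶ Γ ▷ A ▷ A`. -/
noncomputable def diag {Γ : D} (A : M.Ty Γ) : M.ext A ⟶ M.ext (M.sub (M.p A) A) :=
  M.pair (M.p A) A (𝟙 _) (𝟙 _) rfl

/-- The map `Θ ▷ A[σ] ▷ A[σ] ⟶ Γ ▷ A ▷ A`. -/
noncomputable def upDiag {Θ Γ : D} (σ : Θ ⟶ Γ) (A : M.Ty Γ) :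
    M.ext (M.sub (M.p (M.sub σ A)) (M.sub σ A)) ⟶ M.ext (M.sub (M.p A) A) :=
  M.up₂ (M.p A) A σ (M.up σ A) (M.p _) (M.up_p σ A)

/-- Data for an identity type of `A`: a type over `Γ ▷ A ▷ A` with a reflexivity term over the
diagonal. -/
@[ext]
structure IdData {Γ : D} (A : M.Ty Γ) where
  /-- the type -/
  ty : M.Ty (M.ext (M.sub (M.p A) A))
  /-- reflexivity -/
  refl : M.Lift (M.diag A) ty

namespace IdData

variable {M} {Γ : D} {A : M.Ty Γ}

/-- Reindexing along `σ`. -/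
noncomputable def reindex (X : M.IdData A) {Θ : D} (σ : Θ ⟶ Γ) : M.IdData (M.sub σ A) where
  ty := M.sub (M.upDiag σ A) X.ty
  refl := X.refl.reindex (M.upDiag σ A) (M.up σ A) (M.diag _) (by
    apply M.hom_ext
    · simp [diag, upDiag, up₂]
    · simp [diag, upDiag, up₂])

/-- The elimination rule, with its computation rule. -/
def IsId (X : M.IdData A) : Prop :=
  ∀ (C : M.Ty (M.ext X.ty)) (d : M.Lift X.refl.hom C), ∃ s : M.Sec C, X.refl.hom ≫ s.hom = d.hom

end IdData

/-- Weakly stable (intensional) identity types. -/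
def WeakId : Prop :=
  ∀ {Γ : D} (A : M.Ty Γ), ∃ X : M.IdData A, ∀ {Θ : D} (σ : Θ ⟶ Γ), (X.reindex σ).IsId

/-- Weakly stable extensional identity types, for which reflexivity is invertible. -/
def WeakIdExt : Prop :=
  ∀ {Γ : D} (A : M.Ty Γ), ∃ X : M.IdData A, ∀ {Θ : D} (σ : Θ ⟶ Γ), IsIso (X.reindex σ).refl.hom

/-- Strictly stable (intensional) identity types. -/
structure StrictId where
  /-- formation and reflexivity -/
  form : ∀ {Γ : D} (A : M.Ty Γ), M.IdData A
  form_sub : ∀ {Θ Γ : D} (σ : Θ ⟶ Γ) (A : M.Ty Γ), form (M.sub σ A) = (form A).reindex σ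
  /-- elimination -/
  elim : ∀ {Γ : D} {A : M.Ty Γ} (X : M.IdData A) (_ : X = form A)
    (C : M.Ty (M.ext X.ty)) (_ : M.Lift X.refl.hom C), M.Sec C
  comp : ∀ {Γ : D} {A : M.Ty Γ} (X : M.IdData A) (hX : X = form A)
    (C : M.Ty (M.ext X.ty)) (d : M.Lift X.refl.hom C), X.refl.hom ≫ (elim X hX C d).hom = d.hom
  elim_sub : ∀ {Θ Γ : D} (σ : Θ ⟶ Γ) {A : M.Ty Γ} (X : M.IdData A)
    (hX : X = form A) (hX' : X.reindex σ = form _) (C : M.Ty (M.ext X.ty))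
    (d : M.Lift X.refl.hom C),
    elim (X.reindex σ) hX' (M.sub (M.up (M.upDiag σ A) X.ty) C)
      (d.reindex (M.up (M.upDiag σ A) X.ty) (M.up σ A) _ (by
        simp [IdData.reindex, Lift.reindex])) = (elim X hX C d).sub (M.up (M.upDiag σ A) X.ty)

/-- Strictly stable extensional identity types. -/
structure StrictIdExt where
  /-- formation and reflexivity -/
  form : ∀ {Γ : D} (A : M.Ty Γ), M.IdData A
  form_sub : ∀ {Θ Γ : D} (σ : Θ ⟶ Γ) (A : M.Ty Γ), form (M.sub σ A) = (form A).reindex σ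
  isIso : ∀ {Γ : D} (A : M.Ty Γ), IsIso (form A).refl.hom

/-! ### Empty types -/

/-- Weakly stable empty types. -/
def WeakZero : Prop :=
  ∀ Γ : D, ∃ Z : M.Ty Γ, ∀ {Θ : D} (σ : Θ ⟶ Γ) (C : M.Ty (M.ext (M.sub σ Z))), Nonempty (M.Sec C)

/-- Strictly stable empty types. -/
structure StrictZero where
  /-- formation -/
  form : ∀ Γ : D, M.Ty Γ
  form_sub : ∀ {Θ Γ : D} (σ : Θ ⟶ Γ), form Θ = M.sub σ (form Γ)
  /-- elimination -/
  elim : ∀ {Γ : D} (Z : M.Ty Γ) (_ : Z = form Γ) (C : M.Ty (M.ext Z)), M.Sec C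
  elim_sub : ∀ {Θ Γ : D} (σ : Θ ⟶ Γ) (Z : M.Ty Γ) (hZ : Z = form Γ) (hZ' : M.sub σ Z = form Θ)
    (C : M.Ty (M.ext Z)), elim (M.sub σ Z) hZ' (M.sub (M.up σ Z) C) = (elim Z hZ C).sub (M.up σ Z)

/-! ### Unit types -/

/-- Data for a unit type: a type with a term. -/
@[ext]
structure UnitData (Γ : D) where
  /-- the type -/
  ty : M.Ty Γ
  /-- the canonical term -/
  star : M.Sec ty

namespace UnitData

variable {M} {Γ : D}

/-- Reindexing along `σ`. -/
noncomputable def reindex (X : M.UnitData Γ) {Θ : D} (σ : Θ ⟶ Γ) : M.UnitData Θ where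
  ty := M.sub σ X.ty
  star := X.star.sub σ

/-- The elimination rule, with its computation rule. -/
def IsUnit (X : M.UnitData Γ) : Prop :=
  ∀ (C : M.Ty (M.ext X.ty)) (d : M.Lift X.star.hom C), ∃ s : M.Sec C, X.star.hom ≫ s.hom = d.hom

end UnitData

/-- Weakly stable unit types. -/
def WeakUnit : Prop :=
  ∀ Γ : D, ∃ X : M.UnitData Γ, ∀ {Θ : D} (σ : Θ ⟶ Γ), (X.reindex σ).IsUnit

/-- Strictly stable unit types. -/
structure StrictUnit where
  /-- formation and introduction -/
  form : ∀ Γ : D, M.UnitData Γ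
  form_sub : ∀ {Θ Γ : D} (σ : Θ ⟶ Γ), form Θ = (form Γ).reindex σ
  /-- elimination -/
  elim : ∀ {Γ : D} (X : M.UnitData Γ) (_ : X = form Γ)
    (C : M.Ty (M.ext X.ty)) (_ : M.Lift X.star.hom C), M.Sec C
  comp : ∀ {Γ : D} (X : M.UnitData Γ) (hX : X = form Γ)
    (C : M.Ty (M.ext X.ty)) (d : M.Lift X.star.hom C), X.star.hom ≫ (elim X hX C d).hom = d.hom
  elim_sub : ∀ {Θ Γ : D} (σ : Θ ⟶ Γ) (X : M.UnitData Γ) (hX : X = form Γ)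
    (hX' : X.reindex σ = form Θ) (C : M.Ty (M.ext X.ty)) (d : M.Lift X.star.hom C),
    elim (X.reindex σ) hX' (M.sub (M.up σ X.ty) C)
      (d.reindex (M.up σ X.ty) σ _ (by
        simp [UnitData.reindex, Sec.sub, Lift.reindex])) = (elim X hX C d).sub (M.up σ X.ty)

/-! ### Binary sums -/

/-- Data for a binary sum: a type with two injections over `Γ`. -/
@[ext]
structure SumData {Γ : D} (A B : M.Ty Γ) where
  /-- the type -/
  ty : M.Ty Γ
  /-- first injection -/
  inl : M.Lift (M.p A) ty
  /-- second injection -/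
  inr : M.Lift (M.p B) ty

namespace SumData

variable {M} {Γ : D} {A B : M.Ty Γ}

/-- Reindexing along `σ`. -/
noncomputable def reindex (X : M.SumData A B) {Θ : D} (σ : Θ ⟶ Γ) :
    M.SumData (M.sub σ A) (M.sub σ B) where
  ty := M.sub σ X.ty
  inl := X.inl.reindex σ (M.up σ A) (M.p _) (M.up_p σ A)
  inr := X.inr.reindex σ (M.up σ B) (M.p _) (M.up_p σ B)

/-- The elimination rule, with its computation rules. -/
def IsSum (X : M.SumData A B) : Prop :=
  ∀ (C : M.Ty (M.ext X.ty)) (d : M.Lift X.inl.hom C) (e : M.Lift X.inr.hom C),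
    ∃ s : M.Sec C, X.inl.hom ≫ s.hom = d.hom ∧ X.inr.hom ≫ s.hom = e.hom

end SumData

/-- Weakly stable binary sums. -/
def WeakSum : Prop :=
  ∀ {Γ : D} (A B : M.Ty Γ), ∃ X : M.SumData A B, ∀ {Θ : D} (σ : Θ ⟶ Γ), (X.reindex σ).IsSum

/-- Strictly stable binary sums. -/
structure StrictSum where
  /-- formation and injections -/
  form : ∀ {Γ : D} (A B : M.Ty Γ), M.SumData A B
  form_sub : ∀ {Θ Γ : D} (σ : Θ ⟶ Γ) (A B : M.Ty Γ),
    form (M.sub σ A) (M.sub σ B) = (form A B).reindex σ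
  /-- elimination -/
  elim : ∀ {Γ : D} {A B : M.Ty Γ} (X : M.SumData A B) (_ : X = form A B)
    (C : M.Ty (M.ext X.ty)) (_ : M.Lift X.inl.hom C) (_ : M.Lift X.inr.hom C), M.Sec C
  comp_inl : ∀ {Γ : D} {A B : M.Ty Γ} (X : M.SumData A B) (hX : X = form A B)
    (C : M.Ty (M.ext X.ty)) (d : M.Lift X.inl.hom C) (e : M.Lift X.inr.hom C),
    X.inl.hom ≫ (elim X hX C d e).hom = d.hom
  comp_inr : ∀ {Γ : D} {A B : M.Ty Γ} (X : M.SumData A B) (hX : X = form A B)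
    (C : M.Ty (M.ext X.ty)) (d : M.Lift X.inl.hom C) (e : M.Lift X.inr.hom C),
    X.inr.hom ≫ (elim X hX C d e).hom = e.hom
  elim_sub : ∀ {Θ Γ : D} (σ : Θ ⟶ Γ) {A B : M.Ty Γ} (X : M.SumData A B)
    (hX : X = form A B) (hX' : X.reindex σ = form _ _) (C : M.Ty (M.ext X.ty))
    (d : M.Lift X.inl.hom C) (e : M.Lift X.inr.hom C),
    elim (X.reindex σ) hX' (M.sub (M.up σ X.ty) C)
      (d.reindex (M.up σ X.ty) (M.up σ A) _ (by simp [SumData.reindex, Lift.reindex]))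
      (e.reindex (M.up σ X.ty) (M.up σ B) _ (by simp [SumData.reindex, Lift.reindex]))
    = (elim X hX C d e).sub (M.up σ X.ty)

/-! ### W-types -/

/-- The map `Ξ ▷ B[t ≫ a] ⟶ Θ ▷ B[a]` over `t : Ξ ⟶ Θ`. -/
noncomputable def slide {Ξ Θ Γ : D} (t : Ξ ⟶ Θ) (a : Θ ⟶ Γ) (B : M.Ty Γ) :
    M.ext (M.sub (t ≫ a) B) ⟶ M.ext (M.sub a B) :=
  M.pair a B (M.p _ ≫ t) (M.up (t ≫ a) B) (by rw [up_p, Category.assoc])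

@[simp]
theorem slide_p {Ξ Θ Γ : D} (t : Ξ ⟶ Θ) (a : Θ ⟶ Γ) (B : M.Ty Γ) :
    M.slide t a B ≫ M.p (M.sub a B) = M.p _ ≫ t := by simp [slide]

@[simp]
theorem slide_up {Ξ Θ Γ : D} (t : Ξ ⟶ Θ) (a : Θ ⟶ Γ) (B : M.Ty Γ) :
    M.slide t a B ≫ M.up a B = M.up (t ≫ a) B := by simp [slide]

@[simp]
theorem slide_p_assoc {Ξ Θ Γ Y : D} (t : Ξ ⟶ Θ) (a : Θ ⟶ Γ) (B : M.Ty Γ) (k : Θ ⟶ Y) :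
    M.slide t a B ≫ M.p (M.sub a B) ≫ k = M.p _ ≫ t ≫ k := by
  rw [← Category.assoc, slide_p, Category.assoc]

@[simp]
theorem slide_up_assoc {Ξ Θ Γ Y : D} (t : Ξ ⟶ Θ) (a : Θ ⟶ Γ) (B : M.Ty Γ) (k : M.ext B ⟶ Y) :
    M.slide t a B ≫ M.up a B ≫ k = M.up (t ≫ a) B ≫ k := by
  rw [← Category.assoc, slide_up]

variable {M} in
/-- Precomposition of a lift. -/
def Lift.precomp {X Y Γ : D} {f : X ⟶ Γ} {A : M.Ty Γ} (d : M.Lift f A) (t : Y ⟶ X)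
    (f' : Y ⟶ Γ) (h : t ≫ f = f') : M.Lift f' A := ⟨t ≫ d.hom, by rw [Category.assoc, d.w, h]⟩

variable {M} in
/-- A term of type `A[σ]` over `f`, as a term of type `A` over `f ≫ σ`. -/
def Lift.transpose {X Θ Γ : D} {σ : Θ ⟶ Γ} {A : M.Ty Γ} {f : X ⟶ Θ} (d : M.Lift f (M.sub σ A)) :
    M.Lift (f ≫ σ) A := ⟨d.hom ≫ M.up σ A, by rw [Category.assoc, up_p, ← Category.assoc, d.w]⟩

/-- Data for a W-type: a type `W` with an operation that sends, in every context `Θ` over `Γ`, a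
term `a` of type `A` and a term `f` of type `W` depending on a variable of type `B[a]` to a term
`sup a f` of type `W`, naturally in `Θ`. -/
@[ext]
structure WData {Γ : D} (A : M.Ty Γ) (B : M.Ty (M.ext A)) where
  /-- the type -/
  ty : M.Ty Γ
  /-- introduction -/
  sup : ∀ {Θ : D} (a : Θ ⟶ M.ext A) (_ : M.Lift (M.p (M.sub a B) ≫ a ≫ M.p A) ty),
    M.Lift (a ≫ M.p A) ty
  sup_natural : ∀ {Ξ Θ : D} (t : Ξ ⟶ Θ) (a : Θ ⟶ M.ext A)
    (f : M.Lift (M.p (M.sub a B) ≫ a ≫ M.p A) ty),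
    (sup (t ≫ a) (f.precomp (M.slide t a B) _ (by simp))).hom = t ≫ (sup a f).hom

namespace WData

variable {M} {Γ : D} {A : M.Ty Γ} {B : M.Ty (M.ext A)}

/-- The map `Θ ▷ B[a ≫ σ.A] ⟶ Θ ▷ B[σ.A][a]` over `Θ`. -/
noncomputable def resub {Ξ Θ : D} (σ : Θ ⟶ Γ) (a : Ξ ⟶ M.ext (M.sub σ A)) :
    M.ext (M.sub (a ≫ M.up σ A) B) ⟶ M.ext (M.sub a (M.sub (M.up σ A) B)) :=
  M.pair a (M.sub (M.up σ A) B) (M.p _)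
    (M.pair (M.up σ A) B (M.p _ ≫ a) (M.up (a ≫ M.up σ A) B) (by
      rw [up_p, Category.assoc])) (by simp)

@[simp]
theorem resub_p {Ξ Θ : D} (σ : Θ ⟶ Γ) (a : Ξ ⟶ M.ext (M.sub σ A)) :
    resub (B := B) σ a ≫ M.p (M.sub a (M.sub (M.up σ A) B)) = M.p _ := by simp [resub]

@[simp]
theorem resub_p_assoc {Ξ Θ Y : D} (σ : Θ ⟶ Γ) (a : Ξ ⟶ M.ext (M.sub σ A)) (k : Ξ ⟶ Y) :
    resub (B := B) σ a ≫ M.p (M.sub a (M.sub (M.up σ A) B)) ≫ k = M.p _ ≫ k := by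
  rw [← Category.assoc, resub_p]

/-- The identification of the comprehensions of the substitutions along equal maps. -/
def cast {Θ Γ' : D} {a a' : Θ ⟶ Γ'} (e : a = a') (B : M.Ty Γ') :
    M.ext (M.sub a B) ⟶ M.ext (M.sub a' B) := eqToHom (by rw [e])

@[simp]
theorem cast_p {Θ Γ' : D} {a a' : Θ ⟶ Γ'} (e : a = a') (B : M.Ty Γ') :
    cast e B ≫ M.p (M.sub a' B) = M.p _ := by
  subst e; exact Category.id_comp _

@[simp]
theorem cast_up {Θ Γ' : D} {a a' : Θ ⟶ Γ'} (e : a = a') (B : M.Ty Γ') :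
    cast e B ≫ M.up a' B = M.up a B := by
  subst e; exact Category.id_comp _

@[simp]
theorem cast_p_assoc {Θ Γ' Y : D} {a a' : Θ ⟶ Γ'} (e : a = a') (B : M.Ty Γ') (k : Θ ⟶ Y) :
    cast e B ≫ M.p (M.sub a' B) ≫ k = M.p _ ≫ k := by
  rw [← Category.assoc, cast_p]

@[simp]
theorem cast_up_assoc {Θ Γ' Y : D} {a a' : Θ ⟶ Γ'} (e : a = a') (B : M.Ty Γ')
    (k : M.ext B ⟶ Y) : cast e B ≫ M.up a' B ≫ k = M.up a B ≫ k := by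
  rw [← Category.assoc, cast_up]

theorem slide_resub {Ξ Ψ Θ : D} (σ : Θ ⟶ Γ) (t : Ψ ⟶ Ξ) (a : Ξ ⟶ M.ext (M.sub σ A)) :
    resub σ (t ≫ a) ≫ M.slide t a (M.sub (M.up σ A) B)
      = cast (Category.assoc t a (M.up σ A)) B ≫ M.slide t (a ≫ M.up σ A) B ≫ resub σ a := by
  apply M.hom_ext
  · simp only [Category.assoc, slide_p, resub_p, resub_p_assoc]
    rw [← Category.assoc, cast_p]
  · apply M.hom_ext
    · simp only [Category.assoc, slide_up_assoc, resub, pair_up, pair_p]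
      rw [pair_up_assoc, pair_p]
      simp
    · simp only [Category.assoc, slide_up_assoc, resub, pair_up]
      rw [pair_up_assoc, pair_up]
      simp

theorem sup_congr (X : M.WData A B) {Θ : D} {a a' : Θ ⟶ M.ext A} (e : a = a')
    (f : M.Lift (M.p (M.sub a B) ≫ a ≫ M.p A) X.ty)
    (f' : M.Lift (M.p (M.sub a' B) ≫ a' ≫ M.p A) X.ty) (h : f.hom = cast e B ≫ f'.hom) :
    (X.sup a f).hom = (X.sup a' f').hom := by
  subst e
  have : f = f' := Lift.ext (h.trans (Category.id_comp _))
  rw [this]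

/-- Over a reindexed type, the arguments of the introduction rule, transposed along `σ`. -/
noncomputable def arg {T : M.Ty Γ} {Ξ Θ : D} (σ : Θ ⟶ Γ) (a : Ξ ⟶ M.ext (M.sub σ A))
    (f : M.Lift (M.p (M.sub a (M.sub (M.up σ A) B)) ≫ a ≫ M.p (M.sub σ A)) (M.sub σ T)) :
    M.Lift (M.p (M.sub (a ≫ M.up σ A) B) ≫ (a ≫ M.up σ A) ≫ M.p A) T :=
  f.transpose.precomp (resub σ a) _ (by simp [up_p])

/-- Over a reindexed type, the last argument of the premise of the elimination rule, transposed
along `σ`. -/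
noncomputable def argStep {T : M.Ty Γ} {C : M.Ty (M.ext T)} {Ξ Θ : D} (σ : Θ ⟶ Γ)
    (a : Ξ ⟶ M.ext (M.sub σ A))
    (f : M.Lift (M.p (M.sub a (M.sub (M.up σ A) B)) ≫ a ≫ M.p (M.sub σ A)) (M.sub σ T))
    (h : M.Lift f.hom (M.sub (M.up σ T) C)) : M.Lift (arg σ a f).hom C :=
  h.transpose.precomp (resub σ a) _ rfl

theorem arg_precomp {T : M.Ty Γ} {Ψ Ξ Θ : D} (σ : Θ ⟶ Γ) (t : Ψ ⟶ Ξ)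
    (a : Ξ ⟶ M.ext (M.sub σ A))
    (f : M.Lift (M.p (M.sub a (M.sub (M.up σ A) B)) ≫ a ≫ M.p (M.sub σ A)) (M.sub σ T)) :
    (arg σ (t ≫ a) (f.precomp (M.slide t a _) _ (by simp))).hom
      = cast (Category.assoc t a (M.up σ A)) B ≫ M.slide t (a ≫ M.up σ A) B ≫ (arg σ a f).hom := by
  have e := slide_resub (B := B) σ t a
  simp only [arg, Lift.precomp, Lift.transpose]
  simp only [← Category.assoc] at e ⊢
  rw [e]

theorem argStep_precomp {T : M.Ty Γ} {C : M.Ty (M.ext T)} {Ψ Ξ Θ : D} (σ : Θ ⟶ Γ) (t : Ψ ⟶ Ξ)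
    (a : Ξ ⟶ M.ext (M.sub σ A))
    (f : M.Lift (M.p (M.sub a (M.sub (M.up σ A) B)) ≫ a ≫ M.p (M.sub σ A)) (M.sub σ T))
    (h : M.Lift f.hom (M.sub (M.up σ T) C)) :
    (argStep σ (t ≫ a) (f.precomp (M.slide t a _) _ (by simp)) (h.precomp (M.slide t a _) _ rfl)).hom
      = cast (Category.assoc t a (M.up σ A)) B ≫ M.slide t (a ≫ M.up σ A) B ≫
        (argStep σ a f h).hom := by
  have e := slide_resub (B := B) σ t a
  simp only [argStep, Lift.precomp, Lift.transpose]
  simp only [← Category.assoc] at e ⊢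
  rw [e]

/-- Reindexing along `σ`. -/
noncomputable def reindex (X : M.WData A B) {Θ : D} (σ : Θ ⟶ Γ) :
    M.WData (M.sub σ A) (M.sub (M.up σ A) B) where
  ty := M.sub σ X.ty
  sup a f := (X.sup (a ≫ M.up σ A) (arg σ a f)).reindex σ (𝟙 _) (a ≫ M.p _) (by
    simp [up_p])
  sup_natural t a f := by
    apply M.hom_ext
    · simp [Lift.reindex]
    · have := (X.sup_congr (Category.assoc t a (M.up σ A)) _
        ((arg σ a f).precomp (M.slide t (a ≫ M.up σ A) B) _ (by simp))
        (arg_precomp σ t a f)).trans (X.sup_natural t (a ≫ M.up σ A) (arg σ a f))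
      simpa [Lift.reindex] using this

/-- The premise of the elimination rule: an operation that sends, in every context `Θ` over `Γ`,
a term `a` of type `A`, a term `f` of type `W` depending on a variable of type `B[a]`, and a term
`h` of type `C[f]` depending on the same variable to a term of type `C[sup a f]`, naturally in
`Θ`. -/
@[ext]
structure Step (X : M.WData A B) (C : M.Ty (M.ext X.ty)) where
  /-- the operation -/
  op : ∀ {Θ : D} (a : Θ ⟶ M.ext A) (f : M.Lift (M.p (M.sub a B) ≫ a ≫ M.p A) X.ty)
    (_ : M.Lift f.hom C), M.Lift (X.sup a f).hom C
  natural : ∀ {Ξ Θ : D} (t : Ξ ⟶ Θ) (a : Θ ⟶ M.ext A)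
    (f : M.Lift (M.p (M.sub a B) ≫ a ≫ M.p A) X.ty) (h : M.Lift f.hom C),
    (op (t ≫ a) (f.precomp (M.slide t a B) _ (by simp)) (h.precomp (M.slide t a B) _ rfl)).hom
      = t ≫ (op a f h).hom

/-- The computation rule: `s` takes the value prescribed by `d` at every `sup a f`. -/
def Computes (X : M.WData A B) {C : M.Ty (M.ext X.ty)} (d : X.Step C) (s : M.Sec C) : Prop :=
  ∀ {Θ : D} (a : Θ ⟶ M.ext A) (f : M.Lift (M.p (M.sub a B) ≫ a ≫ M.p A) X.ty),
    (X.sup a f).hom ≫ s.hom = (d.op a f (s.precomp f.hom _ (Category.comp_id _))).hom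

/-- The elimination rule, with its computation rule. -/
def IsW (X : M.WData A B) : Prop :=
  ∀ (C : M.Ty (M.ext X.ty)) (d : X.Step C), ∃ s : M.Sec C, X.Computes d s

theorem Step.op_congr {X : M.WData A B} {C : M.Ty (M.ext X.ty)} (d : X.Step C) {Θ : D}
    {a a' : Θ ⟶ M.ext A} (e : a = a')
    (f : M.Lift (M.p (M.sub a B) ≫ a ≫ M.p A) X.ty)
    (f' : M.Lift (M.p (M.sub a' B) ≫ a' ≫ M.p A) X.ty) (hf : f.hom = cast e B ≫ f'.hom)
    (h : M.Lift f.hom C) (h' : M.Lift f'.hom C) (hh : h.hom = cast e B ≫ h'.hom) :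
    (d.op a f h).hom = (d.op a' f' h').hom := by
  subst e
  obtain rfl : f = f' := Lift.ext (hf.trans (Category.id_comp _))
  obtain rfl : h = h' := Lift.ext (hh.trans (Category.id_comp _))
  rfl

/-- Reindexing of the premise of the elimination rule. -/
noncomputable def Step.reindex {X : M.WData A B} {C : M.Ty (M.ext X.ty)} (d : X.Step C) {Θ : D}
    (σ : Θ ⟶ Γ) : (X.reindex σ).Step (M.sub (M.up σ X.ty) C) where
  op a f h := (d.op (a ≫ M.up σ A) (arg σ a f) (argStep σ a f h)).reindex (M.up σ X.ty) (𝟙 _) _ (by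
    simp [WData.reindex, Lift.reindex])
  natural t a f h := by
    apply M.hom_ext
    · exact (M.pair_p _ _ _ _ _).trans (((X.reindex σ).sup_natural t a f).trans
        ((congrArg (t ≫ ·) (M.pair_p _ _ _ _ _)).symm.trans (Category.assoc _ _ _).symm))
    · have := (d.op_congr (Category.assoc t a (M.up σ A)) _
        ((arg σ a f).precomp (M.slide t (a ≫ M.up σ A) B) _ (by simp))
        (arg_precomp σ t a f) (argStep σ (t ≫ a) (f.precomp (M.slide t a _) _ (by simp))
          (h.precomp (M.slide t a _) _ rfl))
        ((argStep σ a f h).precomp (M.slide t (a ≫ M.up σ A) B) _ rfl)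
        (argStep_precomp σ t a f h)).trans
          (d.natural t (a ≫ M.up σ A) (arg σ a f) (argStep σ a f h))
      refine (M.pair_up _ _ _ _ _).trans ?_
      refine Eq.trans ?_ (Category.assoc _ _ _).symm
      refine Eq.trans ?_ (congrArg (t ≫ ·) (M.pair_up _ _ _ _ _)).symm
      refine (Category.id_comp _).trans (this.trans ?_)
      exact congrArg (t ≫ ·) (Category.id_comp _).symm

end WData

/-- Weakly stable W-types. -/
def WeakW : Prop :=
  ∀ {Γ : D} (A : M.Ty Γ) (B : M.Ty (M.ext A)), ∃ X : M.WData A B,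
    ∀ {Θ : D} (σ : Θ ⟶ Γ), (X.reindex σ).IsW

/-- Strictly stable W-types. -/
structure StrictW where
  /-- formation and introduction -/
  form : ∀ {Γ : D} (A : M.Ty Γ) (B : M.Ty (M.ext A)), M.WData A B
  form_sub : ∀ {Θ Γ : D} (σ : Θ ⟶ Γ) (A : M.Ty Γ) (B : M.Ty (M.ext A)),
    form (M.sub σ A) (M.sub (M.up σ A) B) = (form A B).reindex σ
  /-- elimination -/
  elim : ∀ {Γ : D} {A : M.Ty Γ} {B : M.Ty (M.ext A)} (X : M.WData A B) (_ : X = form A B)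
    (C : M.Ty (M.ext X.ty)) (_ : X.Step C), M.Sec C
  comp : ∀ {Γ : D} {A : M.Ty Γ} {B : M.Ty (M.ext A)} (X : M.WData A B) (hX : X = form A B)
    (C : M.Ty (M.ext X.ty)) (d : X.Step C), X.Computes d (elim X hX C d)
  elim_sub : ∀ {Θ Γ : D} (σ : Θ ⟶ Γ) {A : M.Ty Γ} {B : M.Ty (M.ext A)} (X : M.WData A B)
    (hX : X = form A B) (hX' : X.reindex σ = form _ _) (C : M.Ty (M.ext X.ty))
    (d : X.Step C),
    elim (X.reindex σ) hX' (M.sub (M.up σ X.ty) C) (d.reindex σ)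
      = (elim X hX C d).sub (M.up σ X.ty)

end TypeCat

/-! ## Natural pseudo-models -/

set_option linter.checkUnivs false in
/-- A pseudonatural transformation `τ : Tm ⟶ Ty` of category-valued pseudofunctors. -/
structure PseudoTypes (D : Type u) [Category.{v} D] where
  /-- the types -/
  Ty : LocallyDiscrete Dᵒᵖ ⥤ᵖ Cat.{v₃, u₃}
  /-- the terms -/
  Tm : LocallyDiscrete Dᵒᵖ ⥤ᵖ Cat.{v₃, u₃}
  /-- the type of a term -/
  τ : Pseudofunctor.StrongTrans Tm Ty

namespace PseudoTypes

variable {D : Type u} [Category.{v} D] (X : PseudoTypes.{v, u, v₃, u₃} D)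

/-- The category of types in context `Γ`. -/
abbrev TyAt (Γ : D) : Type u₃ := X.Ty.obj ⟨op Γ⟩

/-- The category of terms in context `Γ`. -/
abbrev TmAt (Γ : D) : Type u₃ := X.Tm.obj ⟨op Γ⟩

/-- The functor that sends a term to its type. -/
abbrev typeOf (Γ : D) : X.TmAt Γ ⥤ X.TyAt Γ := (X.τ.app ⟨op Γ⟩).toFunctor

/-- Substitution in types. -/
abbrev tySub {Θ Γ : D} (σ : Θ ⟶ Γ) : X.TyAt Γ ⥤ X.TyAt Θ := (X.Ty.map σ.op.toLoc).toFunctor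

/-- Substitution in terms. -/
abbrev tmSub {Θ Γ : D} (σ : Θ ⟶ Γ) : X.TmAt Γ ⥤ X.TmAt Θ := (X.Tm.map σ.op.toLoc).toFunctor

theorem toLoc_comp {Ξ Θ Γ : D} {t : Ξ ⟶ Θ} {σ : Θ ⟶ Γ} {σ' : Ξ ⟶ Γ} (h : t ≫ σ = σ') :
    σ.op.toLoc ≫ t.op.toLoc = σ'.op.toLoc := by
  subst h; rfl

/-- The isomorphism `A[t ≫ σ] ≅ A[σ][t]`. -/
def tyComp {Ξ Θ Γ : D} (t : Ξ ⟶ Θ) (σ : Θ ⟶ Γ) (σ' : Ξ ⟶ Γ) (h : t ≫ σ = σ')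
    (A : X.TyAt Γ) : (X.tySub σ').obj A ≅ (X.tySub t).obj ((X.tySub σ).obj A) :=
  (Cat.Hom.toNatIso (X.Ty.mapComp' σ.op.toLoc t.op.toLoc σ'.op.toLoc (toLoc_comp h))).app A

/-- The isomorphism `a[t ≫ σ] ≅ a[σ][t]`. -/
def tmComp {Ξ Θ Γ : D} (t : Ξ ⟶ Θ) (σ : Θ ⟶ Γ) (σ' : Ξ ⟶ Γ) (h : t ≫ σ = σ')
    (a : X.TmAt Γ) : (X.tmSub σ').obj a ≅ (X.tmSub t).obj ((X.tmSub σ).obj a) :=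
  (Cat.Hom.toNatIso (X.Tm.mapComp' σ.op.toLoc t.op.toLoc σ'.op.toLoc (toLoc_comp h))).app a

/-- The isomorphism `τ (a[t]) ≅ (τ a)[t]`. -/
def typeOfSub {Θ Γ : D} (t : Θ ⟶ Γ) (a : X.TmAt Γ) :
    (X.typeOf Θ).obj ((X.tmSub t).obj a) ≅ (X.tySub t).obj ((X.typeOf Γ).obj a) :=
  (Cat.Hom.toNatIso (X.τ.naturality t.op.toLoc)).app a

theorem typeOfSub_naturality {Θ Γ : D} (t : Θ ⟶ Γ) {a b : X.TmAt Γ} (f : a ⟶ b) :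
    (X.typeOf Θ).map ((X.tmSub t).map f) ≫ (X.typeOfSub t b).hom
      = (X.typeOfSub t a).hom ≫ (X.tySub t).map ((X.typeOf Γ).map f) :=
  (X.τ.naturality t.op.toLoc).hom.toNatTrans.naturality f

theorem tyComp_naturality {Ξ Θ Γ : D} (t : Ξ ⟶ Θ) (σ : Θ ⟶ Γ) (σ' : Ξ ⟶ Γ) (h : t ≫ σ = σ')
    {A B : X.TyAt Γ} (f : A ⟶ B) :
    (X.tySub σ').map f ≫ (X.tyComp t σ σ' h B).hom
      = (X.tyComp t σ σ' h A).hom ≫ (X.tySub t).map ((X.tySub σ).map f) :=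
  (X.Ty.mapComp' σ.op.toLoc t.op.toLoc σ'.op.toLoc (toLoc_comp h)).hom.toNatTrans.naturality f

theorem tyComp_assoc {Ψ Ξ Θ Γ : D} (s : Ψ ⟶ Ξ) (t : Ξ ⟶ Θ) (σ : Θ ⟶ Γ) (st : Ψ ⟶ Θ)
    (tσ : Ξ ⟶ Γ) (stσ : Ψ ⟶ Γ) (h₁ : s ≫ t = st) (h₂ : t ≫ σ = tσ) (h₃ : st ≫ σ = stσ)
    (h₄ : s ≫ tσ = stσ) (A : X.TyAt Γ) :
    (X.tyComp st σ stσ h₃ A).hom ≫ (X.tyComp s t st h₁ ((X.tySub σ).obj A)).hom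
      = (X.tyComp s tσ stσ h₄ A).hom ≫ (X.tySub s).map (X.tyComp t σ tσ h₂ A).hom := by
  have := X.Ty.mapComp'₀₁₃_hom_comp_whiskerLeft_mapComp'_hom_app σ.op.toLoc t.op.toLoc s.op.toLoc
    tσ.op.toLoc st.op.toLoc stσ.op.toLoc (toLoc_comp h₂) (toLoc_comp h₁) (toLoc_comp h₃) A
  simpa [tyComp] using this

theorem typeOfSub_comp {Ξ Θ Γ : D} (t : Ξ ⟶ Θ) (σ : Θ ⟶ Γ) (σ' : Ξ ⟶ Γ) (h : t ≫ σ = σ')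
    (a : X.TmAt Γ) :
    (X.typeOf Ξ).map (X.tmComp t σ σ' h a).hom ≫ (X.typeOfSub t _).hom ≫
        (X.tySub t).map (X.typeOfSub σ a).hom
      = (X.typeOfSub σ' a).hom ≫ (X.tyComp t σ σ' h _).hom := by
  subst h
  have := congrArg (fun k => k.toNatTrans.app a) (X.τ.naturality_comp σ.op.toLoc t.op.toLoc)
  simp [-Pseudofunctor.StrongTrans.naturality_comp] at this
  have e₁ : (X.tyComp t σ _ rfl ((X.typeOf Γ).obj a)).hom
      = (X.Ty.mapComp σ.op.toLoc t.op.toLoc).hom.toNatTrans.app ((X.typeOf Γ).obj a) := by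
    rw [← Pseudofunctor.mapComp'_eq_mapComp]; rfl
  have e₂ : (X.tmComp t σ _ rfl a).hom
      = (X.Tm.mapComp σ.op.toLoc t.op.toLoc).hom.toNatTrans.app a := by
    rw [← Pseudofunctor.mapComp'_eq_mapComp]; rfl
  rw [e₁, e₂]
  exact this.symm

/-- A term of type `A[σ]`, up to a specified isomorphism of types. -/
structure Elt {Θ Γ : D} (A : X.TyAt Γ) (σ : Θ ⟶ Γ) where
  /-- the term -/
  tm : X.TmAt Θ
  /-- its type -/
  iso : (X.typeOf Θ).obj tm ≅ (X.tySub σ).obj A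

namespace Elt

variable {X}

/-- Isomorphism of terms of type `A[σ]`, over the identity of `A[σ]`. -/
def Equiv {Θ Γ : D} {A : X.TyAt Γ} {σ : Θ ⟶ Γ} (x y : X.Elt A σ) : Prop :=
  ∃ ψ : x.tm ≅ y.tm, (X.typeOf Θ).map ψ.hom ≫ y.iso.hom = x.iso.hom

theorem Equiv.refl {Θ Γ : D} {A : X.TyAt Γ} {σ : Θ ⟶ Γ} (x : X.Elt A σ) : x.Equiv x :=
  ⟨Iso.refl _, by simp⟩

theorem Equiv.symm {Θ Γ : D} {A : X.TyAt Γ} {σ : Θ ⟶ Γ} {x y : X.Elt A σ} (h : x.Equiv y) :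
    y.Equiv x := by
  obtain ⟨ψ, h⟩ := h
  exact ⟨ψ.symm, by rw [← h, ← Category.assoc, ← Functor.map_comp]; simp⟩

theorem Equiv.trans {Θ Γ : D} {A : X.TyAt Γ} {σ : Θ ⟶ Γ} {x y z : X.Elt A σ} (h : x.Equiv y)
    (k : y.Equiv z) : x.Equiv z := by
  obtain ⟨ψ, h⟩ := h
  obtain ⟨φ, k⟩ := k
  exact ⟨ψ ≪≫ φ, by simp [h, k]⟩

/-- Substitution of `t` in a term of type `A[σ]`. -/
def reindex {Ξ Θ Γ : D} {A : X.TyAt Γ} {σ : Θ ⟶ Γ} (x : X.Elt A σ) (t : Ξ ⟶ Θ) (σ' : Ξ ⟶ Γ)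
    (h : t ≫ σ = σ') : X.Elt A σ' where
  tm := (X.tmSub t).obj x.tm
  iso := X.typeOfSub t x.tm ≪≫ (X.tySub t).mapIso x.iso ≪≫ (X.tyComp t σ σ' h A).symm

theorem Equiv.reindex {Ξ Θ Γ : D} {A : X.TyAt Γ} {σ : Θ ⟶ Γ} {x y : X.Elt A σ} (e : x.Equiv y)
    (t : Ξ ⟶ Θ) (σ' : Ξ ⟶ Γ) (h : t ≫ σ = σ') : (x.reindex t σ' h).Equiv (y.reindex t σ' h) := by
  obtain ⟨ψ, e⟩ := e
  refine ⟨(X.tmSub t).mapIso ψ, ?_⟩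
  simp only [Elt.reindex, Iso.trans_hom, Functor.mapIso_hom, ← e, Functor.map_comp, Category.assoc]
  rw [← Category.assoc, X.typeOfSub_naturality, Category.assoc]

theorem reindex_reindex {Ψ Ξ Θ Γ : D} {A : X.TyAt Γ} {σ : Θ ⟶ Γ} (x : X.Elt A σ) (t : Ξ ⟶ Θ)
    (s : Ψ ⟶ Ξ) (st : Ψ ⟶ Θ) (tσ : Ξ ⟶ Γ) (stσ : Ψ ⟶ Γ) (h₁ : s ≫ t = st) (h₂ : t ≫ σ = tσ)
    (h₃ : st ≫ σ = stσ) (h₄ : s ≫ tσ = stσ) :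
    (x.reindex st stσ h₃).Equiv ((x.reindex t tσ h₂).reindex s stσ h₄) := by
  refine ⟨X.tmComp s t st h₁ x.tm, ?_⟩
  have e₁ := X.typeOfSub_comp s t st h₁ x.tm
  have e₂ := X.tyComp_naturality s t st h₁ x.iso.hom
  have e₃ := X.tyComp_assoc s t σ st tσ stσ h₁ h₂ h₃ h₄ A
  simp only [Elt.reindex, Iso.trans_hom, Functor.mapIso_hom, Functor.map_comp, Category.assoc,
    Iso.symm_hom]
  rw [reassoc_of% e₁, ← reassoc_of% e₂]
  congr 2
  rw [← cancel_mono (X.tyComp s tσ stσ h₄ A).hom, ← cancel_mono ((X.tySub s).map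
    (X.tyComp t σ tσ h₂ A).hom)]
  simp only [Category.assoc, ← e₃, Iso.inv_hom_id_assoc, Iso.inv_hom_id]
  simp

/-- A term of type `A[σ][f]`, as a term of type `A[f ≫ σ]`. -/
def push {Ξ Θ Γ : D} {A : X.TyAt Γ} {σ : Θ ⟶ Γ} {f : Ξ ⟶ Θ} (x : X.Elt ((X.tySub σ).obj A) f)
    (σ' : Ξ ⟶ Γ) (h : f ≫ σ = σ') : X.Elt A σ' where
  tm := x.tm
  iso := x.iso ≪≫ (X.tyComp f σ σ' h A).symm

/-- A term of type `A[f ≫ σ]`, as a term of type `A[σ][f]`. -/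
def pull {Ξ Θ Γ : D} {A : X.TyAt Γ} {σ' : Ξ ⟶ Γ} (x : X.Elt A σ') (σ : Θ ⟶ Γ) (f : Ξ ⟶ Θ)
    (h : f ≫ σ = σ') : X.Elt ((X.tySub σ).obj A) f where
  tm := x.tm
  iso := x.iso ≪≫ X.tyComp f σ σ' h A

theorem push_pull {Ξ Θ Γ : D} {A : X.TyAt Γ} {σ' : Ξ ⟶ Γ} (x : X.Elt A σ') (σ : Θ ⟶ Γ)
    (f : Ξ ⟶ Θ) (h : f ≫ σ = σ') : (x.pull σ f h).push σ' h = x := by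
  simp [push, pull]

theorem Equiv.push {Ξ Θ Γ : D} {A : X.TyAt Γ} {σ : Θ ⟶ Γ} {f : Ξ ⟶ Θ}
    {x y : X.Elt ((X.tySub σ).obj A) f} (e : x.Equiv y) (σ' : Ξ ⟶ Γ) (h : f ≫ σ = σ') :
    (x.push σ' h).Equiv (y.push σ' h) := by
  obtain ⟨ψ, e⟩ := e
  exact ⟨ψ, by simp [Elt.push, ← e]⟩

theorem Equiv.of_push {Ξ Θ Γ : D} {A : X.TyAt Γ} {σ : Θ ⟶ Γ} {f : Ξ ⟶ Θ}
    {x y : X.Elt ((X.tySub σ).obj A) f} {σ' : Ξ ⟶ Γ} {h : f ≫ σ = σ'}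
    (e : (x.push σ' h).Equiv (y.push σ' h)) : x.Equiv y := by
  obtain ⟨ψ, e⟩ := e
  refine ⟨ψ, ?_⟩
  simpa [Elt.push, ← Category.assoc] using e

theorem push_reindex {Ψ Ξ Θ Γ : D} {A : X.TyAt Γ} {σ : Θ ⟶ Γ} {t : Ξ ⟶ Θ}
    (x : X.Elt ((X.tySub σ).obj A) t) (s : Ψ ⟶ Ξ) (st : Ψ ⟶ Θ) (tσ : Ξ ⟶ Γ) (stσ : Ψ ⟶ Γ)
    (h₁ : s ≫ t = st) (h₂ : t ≫ σ = tσ) (h₃ : st ≫ σ = stσ) (h₄ : s ≫ tσ = stσ) :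
    ((x.reindex s st h₁).push stσ h₃).Equiv ((x.push tσ h₂).reindex s stσ h₄) := by
  refine ⟨Iso.refl _, ?_⟩
  have e₃ := X.tyComp_assoc s t σ st tσ stσ h₁ h₂ h₃ h₄ A
  simp only [Elt.reindex, Elt.push, Iso.trans_hom, Functor.mapIso_hom, Functor.map_comp,
    Category.assoc, Iso.symm_hom, Iso.refl_hom]
  rw [← cancel_mono (X.tyComp s tσ stσ h₄ A).hom, ← cancel_mono ((X.tySub s).map
    (X.tyComp t σ tσ h₂ A).hom)]
  simp only [Category.assoc, ← e₃, Iso.inv_hom_id_assoc, Iso.inv_hom_id]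
  simp

end Elt

end PseudoTypes

set_option linter.checkUnivs false in
/-- A natural pseudo-model: a strictly natural transformation `τ : Tm ⟶ Ty` of groupoid-valued
pseudofunctors on `Dᵒᵖ`, whose fibers are discrete, and which is representable: for every type `A`
over `Γ`, the terms of type `A[σ]` for varying `σ : Θ ⟶ Γ`, up to isomorphism, are represented by
an object `Γ ▷ A`. -/
structure NaturalPseudoModel (D : Type u) [Category.{v} D] extends
    PseudoTypes.{v, u, v₃, u₃} D where
  ty_groupoid : ∀ Γ : D, IsGroupoid (toPseudoTypes.TyAt Γ)
  tm_groupoid : ∀ Γ : D, IsGroupoid (toPseudoTypes.TmAt Γ)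
  strict : ∀ {Γ Θ : LocallyDiscrete Dᵒᵖ} (f : Γ ⟶ Θ),
    ∃ h : Tm.map f ≫ τ.app Θ = τ.app Γ ≫ Ty.map f, τ.naturality f = eqToIso h
  discrete : ∀ {Γ : D} {a b : toPseudoTypes.TmAt Γ} (f : a ⟶ b)
    (h : (toPseudoTypes.typeOf Γ).obj a = (toPseudoTypes.typeOf Γ).obj b),
    (toPseudoTypes.typeOf Γ).map f = eqToHom h → ∃ e : a = b, f = eqToHom e
  /-- context extension -/
  ext : ∀ {Γ : D}, toPseudoTypes.TyAt Γ → D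
  /-- type projection -/
  p : ∀ {Γ : D} (A : toPseudoTypes.TyAt Γ), ext A ⟶ Γ
  /-- the generic term -/
  q : ∀ {Γ : D} (A : toPseudoTypes.TyAt Γ), toPseudoTypes.Elt A (p A)
  existsUnique : ∀ {Θ Γ : D} (A : toPseudoTypes.TyAt Γ) (σ : Θ ⟶ Γ)
    (x : toPseudoTypes.Elt A σ),
    ∃! h : Θ ⟶ ext A, ∃ e : h ≫ p A = σ, x.Equiv ((q A).reindex h σ e)

namespace NaturalPseudoModel

open PseudoTypes

variable {D : Type u} [Category.{v} D] (X : NaturalPseudoModel.{v, u, v₃, u₃} D)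

/-- The map into `Γ ▷ A` classifying a term. -/
noncomputable def desc {Θ Γ : D} {A : X.TyAt Γ} {σ : Θ ⟶ Γ} (x : X.Elt A σ) : Θ ⟶ X.ext A :=
  (X.existsUnique A σ x).choose

theorem desc_p {Θ Γ : D} {A : X.TyAt Γ} {σ : Θ ⟶ Γ} (x : X.Elt A σ) : X.desc x ≫ X.p A = σ :=
  (X.existsUnique A σ x).choose_spec.1.1

theorem desc_equiv {Θ Γ : D} {A : X.TyAt Γ} {σ : Θ ⟶ Γ} (x : X.Elt A σ) :
    x.Equiv ((X.q A).reindex (X.desc x) σ (X.desc_p x)) :=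
  (X.existsUnique A σ x).choose_spec.1.2

theorem hom_ext {Θ Γ : D} {A : X.TyAt Γ} {h k : Θ ⟶ X.ext A} (σ : Θ ⟶ Γ) (eh : h ≫ X.p A = σ)
    (ek : k ≫ X.p A = σ)
    (e : ((X.q A).reindex h σ eh).Equiv ((X.q A).reindex k σ ek)) : h = k :=
  (X.existsUnique A σ _).unique ⟨eh, .refl _⟩ ⟨ek, e⟩

/-- The map `Θ ▷ A[σ] ⟶ Γ ▷ A`. -/
noncomputable def up {Θ Γ : D} (σ : Θ ⟶ Γ) (A : X.TyAt Γ) :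
    X.ext ((X.tySub σ).obj A) ⟶ X.ext A :=
  X.desc ((X.q ((X.tySub σ).obj A)).push (X.p _ ≫ σ) rfl)

theorem isPullback {Θ Γ : D} (σ : Θ ⟶ Γ) (A : X.TyAt Γ) :
    IsPullback (X.up σ A) (X.p ((X.tySub σ).obj A)) (X.p A) σ := by
  have w := X.desc_p ((X.q ((X.tySub σ).obj A)).push (X.p _ ≫ σ) rfl)
  have key : ∀ {Y : D} (l : Y ⟶ X.ext ((X.tySub σ).obj A)) (f : Y ⟶ Θ)
      (e : l ≫ X.p ((X.tySub σ).obj A) = f) (e' : (l ≫ X.up σ A) ≫ X.p A = f ≫ σ),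
      (((X.q ((X.tySub σ).obj A)).reindex l f e).push (f ≫ σ) rfl).Equiv
        ((X.q A).reindex (l ≫ X.up σ A) (f ≫ σ) e') := by
    intro Y l f e e'
    have e₄ : l ≫ X.p ((X.tySub σ).obj A) ≫ σ = f ≫ σ := by rw [← e, Category.assoc]
    refine ((X.q ((X.tySub σ).obj A)).push_reindex l f _ _ e rfl rfl e₄).trans ?_
    refine ((X.desc_equiv _).reindex l _ e₄).trans ?_
    exact ((X.q A).reindex_reindex _ l _ _ _ rfl w e' e₄).symm
  refine ⟨⟨w⟩, ⟨PullbackCone.IsLimit.mk w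
    (fun s => X.desc (((X.q A).reindex s.fst (s.snd ≫ σ) s.condition).pull σ s.snd rfl))
    (fun s => ?_) (fun s => X.desc_p _) (fun s m h₁ h₂ => ?_)⟩⟩
  · refine X.hom_ext (s.snd ≫ σ) (by rw [Category.assoc, w, ← Category.assoc, X.desc_p])
      s.condition ?_
    refine (key _ s.snd (X.desc_p _) _).symm.trans ?_
    refine ((X.desc_equiv _).symm.push (s.snd ≫ σ) rfl).trans ?_
    rw [Elt.push_pull]
    exact .refl _
  · refine X.hom_ext s.snd h₂ (X.desc_p _) (.trans ?_ (X.desc_equiv _))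
    refine Elt.Equiv.of_push (σ' := s.snd ≫ σ) (h := rfl) ?_
    rw [Elt.push_pull]
    have k := key m s.snd h₂ (by rw [Category.assoc, up, w, ← Category.assoc, h₂])
    simpa only [up, h₁] using k

/-- The types and comprehension of a natural pseudo-model. -/
noncomputable def typeCat : TypeCat.{v, u, u₃} D where
  Ty := X.TyAt
  ext := X.ext
  p := X.p
  sub σ := (X.tySub σ).obj
  up := X.up
  isPullback := X.isPullback

end NaturalPseudoModel

/-! ## Natural models -/

/-- A natural model: a map `τ : Tm ⟶ Ty` of presheaves on `D` that is representable: for every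
type `A` over `Γ`, the terms of type `A[σ]` for varying `σ : Θ ⟶ Γ` are represented by an object
`Γ ▷ A` over `Γ`. -/
structure NaturalModel (D : Type u) [Category.{v} D] where
  /-- the types -/
  Ty : Dᵒᵖ ⥤ Type w
  /-- the terms -/
  Tm : Dᵒᵖ ⥤ Type w
  /-- the type of a term -/
  τ : Tm ⟶ Ty
  /-- context extension -/
  ext : ∀ {Γ : D}, Ty.obj (op Γ) → D
  /-- type projection -/
  p : ∀ {Γ : D} (A : Ty.obj (op Γ)), ext A ⟶ Γ
  /-- the generic term -/
  q : ∀ {Γ : D} (A : Ty.obj (op Γ)), Tm.obj (op (ext A))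
  τ_q : ∀ {Γ : D} (A : Ty.obj (op Γ)), τ.app _ (q A) = Ty.map (p A).op A
  existsUnique : ∀ {Θ Γ : D} (A : Ty.obj (op Γ)) (σ : Θ ⟶ Γ) (a : Tm.obj (op Θ)),
    τ.app _ a = Ty.map σ.op A → ∃! h : Θ ⟶ ext A, h ≫ p A = σ ∧ Tm.map h.op (q A) = a

namespace NaturalModel

variable {D : Type u} [Category.{v} D] (X : NaturalModel.{v, u, w} D)

theorem existsUnique_up {Θ Γ : D} (σ : Θ ⟶ Γ) (A : X.Ty.obj (op Γ)) :
    ∃! h : X.ext (X.Ty.map σ.op A) ⟶ X.ext A,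
      h ≫ X.p A = X.p (X.Ty.map σ.op A) ≫ σ ∧ X.Tm.map h.op (X.q A) = X.q (X.Ty.map σ.op A) :=
  X.existsUnique A _ _ (by rw [X.τ_q, op_comp, Functor.map_comp_apply])

/-- The map `Θ ▷ A[σ] ⟶ Γ ▷ A`. -/
noncomputable def up {Θ Γ : D} (σ : Θ ⟶ Γ) (A : X.Ty.obj (op Γ)) :
    X.ext (X.Ty.map σ.op A) ⟶ X.ext A :=
  (X.existsUnique_up σ A).choose

theorem up_p {Θ Γ : D} (σ : Θ ⟶ Γ) (A : X.Ty.obj (op Γ)) :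
    X.up σ A ≫ X.p A = X.p (X.Ty.map σ.op A) ≫ σ :=
  (X.existsUnique_up σ A).choose_spec.1.1

theorem up_q {Θ Γ : D} (σ : Θ ⟶ Γ) (A : X.Ty.obj (op Γ)) :
    X.Tm.map (X.up σ A).op (X.q A) = X.q (X.Ty.map σ.op A) :=
  (X.existsUnique_up σ A).choose_spec.1.2

theorem τ_map_q {Θ Γ : D} (A : X.Ty.obj (op Γ)) (h : Θ ⟶ X.ext A) :
    X.τ.app _ (X.Tm.map h.op (X.q A)) = X.Ty.map (h ≫ X.p A).op A := by
  rw [NatTrans.naturality_apply, X.τ_q, op_comp, Functor.map_comp_apply]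

theorem hom_ext {Θ Γ : D} {A : X.Ty.obj (op Γ)} {h k : Θ ⟶ X.ext A} (e : h ≫ X.p A = k ≫ X.p A)
    (e' : X.Tm.map h.op (X.q A) = X.Tm.map k.op (X.q A)) : h = k :=
  (X.existsUnique A _ _ (X.τ_map_q A k)).unique ⟨e, e'⟩ ⟨rfl, rfl⟩

theorem isPullback {Θ Γ : D} (σ : Θ ⟶ Γ) (A : X.Ty.obj (op Γ)) :
    IsPullback (X.up σ A) (X.p (X.Ty.map σ.op A)) (X.p A) σ := by
  have ex : ∀ s : PullbackCone (X.p A) σ, ∃! h : s.pt ⟶ X.ext (X.Ty.map σ.op A),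
      h ≫ X.p (X.Ty.map σ.op A) = s.snd ∧
      X.Tm.map h.op (X.q (X.Ty.map σ.op A)) = X.Tm.map s.fst.op (X.q A) := fun s =>
    X.existsUnique _ _ _ (by
      rw [X.τ_map_q, s.condition, op_comp, Functor.map_comp_apply])
  refine ⟨⟨X.up_p σ A⟩, ⟨PullbackCone.IsLimit.mk (X.up_p σ A) (fun s => (ex s).choose)
    (fun s => ?_) (fun s => (ex s).choose_spec.1.1) (fun s m h₁ h₂ => ?_)⟩⟩
  · have h := (ex s).choose_spec.1
    refine X.hom_ext ?_ ?_
    · rw [Category.assoc, X.up_p, ← Category.assoc, h.1, s.condition]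
    · rw [op_comp, Functor.map_comp_apply, X.up_q, h.2]
  · refine (ex s).unique ⟨h₂, ?_⟩ (ex s).choose_spec.1
    rw [← h₁, op_comp, Functor.map_comp_apply, X.up_q]

/-- The types and comprehension of a natural model. -/
noncomputable def typeCat : TypeCat.{v, u, w} D where
  Ty Γ := X.Ty.obj (op Γ)
  ext := X.ext
  p := X.p
  sub σ := X.Ty.map σ.op
  up := X.up
  isPullback := X.isPullback

/-- The restriction `F^* τ` of a natural model along a functor `F` that has a right adjoint `G`:
the comprehension of `A` over `Γ` is the pullback of `G (F Γ ▷ A) ⟶ G F Γ` along the unit. -/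
noncomputable def restrict {E : Type u} [Category.{v} E] [HasPullbacks E] {F : E ⥤ D} {G : D ⥤ E}
    (adj : F ⊣ G) : NaturalModel.{v, u, w} E where
  Ty := F.op ⋙ X.Ty
  Tm := F.op ⋙ X.Tm
  τ := Functor.whiskerLeft F.op X.τ
  ext {Γ} A := pullback (G.map (X.p (Γ := F.obj Γ) A)) (adj.unit.app Γ)
  p {Γ} A := pullback.snd (G.map (X.p (Γ := F.obj Γ) A)) (adj.unit.app Γ)
  q {Γ} A := X.Tm.map ((adj.homEquiv _ _).symm
    (pullback.fst (G.map (X.p (Γ := F.obj Γ) A)) (adj.unit.app Γ))).op (X.q A)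
  τ_q {Γ} A := by
    refine (X.τ_map_q (Γ := F.obj Γ) A _).trans ?_
    rw [← Adjunction.homEquiv_naturality_right_symm, pullback.condition]
    simp [Adjunction.homEquiv_counit]
  existsUnique {Θ Γ} A σ a ha := by
    obtain ⟨h, ⟨h₁, h₂⟩, h₃⟩ := X.existsUnique (Γ := F.obj Γ) A (F.map σ) a ha
    refine ⟨pullback.lift (adj.homEquiv _ _ h) σ ?_, ⟨?_, ?_⟩, ?_⟩
    · rw [← Adjunction.homEquiv_naturality_right, h₁]
      simp [Adjunction.homEquiv_unit]
    · exact pullback.lift_snd _ _ _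
    · dsimp
      rw [← Functor.map_comp_apply, ← op_comp,
        ← Adjunction.homEquiv_naturality_left_symm]
      refine (congrArg (fun k => X.Tm.map ((adj.homEquiv _ _).symm k).op (X.q A))
        (pullback.lift_fst _ _ _)).trans ?_
      simpa using h₂
    · rintro k ⟨k₁, k₂⟩
      apply pullback.hom_ext
      · rw [pullback.lift_fst, ← Equiv.symm_apply_eq]
        apply h₃
        constructor
        · rw [← Adjunction.homEquiv_naturality_right_symm, Category.assoc, pullback.condition,
            ← Category.assoc, k₁]
          simp [Adjunction.homEquiv_counit]
        · rw [← k₂]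
          dsimp
          rw [← Functor.map_comp_apply, ← op_comp,
            ← Adjunction.homEquiv_naturality_left_symm]
      · rw [pullback.lift_snd, k₁]

end NaturalModel

/-! ## The left adjoint splitting -/

namespace TypeCat

variable {D : Type u} [Category.{v} D] (M : TypeCat.{v, u, w} D)

/-- A type over `Γ` of the left adjoint splitting: a local universe `V`, a type `E` over `V`, and
a map `Γ ⟶ V`. -/
@[ext]
structure SplitTy (Γ : D) where
  /-- the local universe -/
  base : D
  /-- the type over the local universe -/
  top : M.Ty base
  /-- the name of the type -/
  name : Γ ⟶ base

/-- A term over `Γ` of the left adjoint splitting: a local universe `V`, a type `E` over `V`, and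
a map `Γ ⟶ V ▷ E`. -/
@[ext]
structure SplitTm (Γ : D) where
  /-- the local universe -/
  base : D
  /-- the type over the local universe -/
  top : M.Ty base
  /-- the name of the term -/
  name : Γ ⟶ M.ext top

/-- The left adjoint splitting. -/
noncomputable def leftAdjointSplitting : NaturalModel.{v, u, max u v w} D where
  Ty :=
    { obj Γ := M.SplitTy Γ.unop
      map σ := ↾fun A => ⟨A.base, A.top, σ.unop ≫ A.name⟩
      map_id _ := by ext <;> simp
      map_comp _ _ := by ext <;> simp }
  Tm :=
    { obj Γ := M.SplitTm Γ.unop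
      map σ := ↾fun A => ⟨A.base, A.top, σ.unop ≫ A.name⟩ }
  τ := { app _ := ↾fun a => ⟨a.base, a.top, a.name ≫ M.p a.top⟩ }
  ext A := M.ext (M.sub A.name A.top)
  p A := M.p (M.sub A.name A.top)
  q A := ⟨A.base, A.top, M.up A.name A.top⟩
  τ_q A := SplitTy.ext rfl HEq.rfl (heq_of_eq (M.up_p A.name A.top))
  existsUnique {Θ Γ} A σ a h := by
    obtain ⟨V, E, n⟩ := A
    obtain ⟨V', E', a⟩ := a
    obtain ⟨rfl, h⟩ := SplitTy.mk.inj h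
    obtain ⟨rfl, h⟩ := h
    replace h : a ≫ M.p E' = σ ≫ n := eq_of_heq h
    refine ⟨M.pair n E' σ a h, ⟨M.pair_p n E' σ a h, ?_⟩, ?_⟩
    · exact SplitTm.ext rfl HEq.rfl (heq_of_eq (M.pair_up n E' σ a h))
    · rintro k ⟨k₁, k₂⟩
      refine M.hom_ext (k₁.trans (M.pair_p n E' σ a h).symm)
        (Eq.trans ?_ (M.pair_up n E' σ a h).symm)
      have k₃ := (SplitTm.mk.inj k₂).2.2
      exact eq_of_heq k₃

end TypeCat

/-! ## Type constructors -/

/-- The type constructors. Those marked with `Eta` satisfy also the uniqueness rule, and `idExt` is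
the extensional identity type. -/
inductive TypeConstructor
  | pi | piEta | sigma | sigmaEta | id | idExt | zero | unit | sum | w

namespace TypeCat

variable {D : Type u} [Category.{v} D] (M : TypeCat.{v, u, w} D)

/-- Weakly stable structure for a type constructor. -/
def HasWeaklyStable : TypeConstructor → Prop
  | .pi => M.WeakPi
  | .piEta => M.WeakPiEta
  | .sigma => M.WeakSigma
  | .sigmaEta => M.WeakSigmaEta
  | .id => M.WeakId
  | .idExt => M.WeakIdExt
  | .zero => M.WeakZero
  | .unit => M.WeakUnit
  | .sum => M.WeakSum
  | .w => M.WeakW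

/-- Existence of strictly stable structure for a type constructor. -/
def HasStrictlyStable : TypeConstructor → Prop
  | .pi => Nonempty M.StrictPi
  | .piEta => Nonempty M.StrictPiEta
  | .sigma => Nonempty M.StrictSigma
  | .sigmaEta => Nonempty M.StrictSigmaEta
  | .id => Nonempty M.StrictId
  | .idExt => Nonempty M.StrictIdExt
  | .zero => Nonempty M.StrictZero
  | .unit => Nonempty M.StrictUnit
  | .sum => Nonempty M.StrictSum
  | .w => Nonempty M.StrictW

end TypeCat

/-! ## Adjoint modal pre-models -/

/-- A category with pullbacks is locally cartesian closed if every pullback functor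
`D / Y ⥤ D / X` has a right adjoint (the pushforward). -/
class LocallyCartesianClosed (D : Type u) [Category.{v} D] : Prop extends HasPullbacks D where
  isLeftAdjoint : ∀ {X Y : D} (f : X ⟶ Y), (Over.pullback f).IsLeftAdjoint

/-- The maps that are a pullback of a map in the image of `R`. -/
def IsPullbackOfImage {C : Type u₁} [Category.{v₁} C] {D : Type u} [Category.{v} D] (R : C ⥤ D)
    {A B : D} (f : A ⟶ B) : Prop :=
  ∃ (X Y : C) (k : X ⟶ Y) (a : A ⟶ R.obj X) (b : B ⟶ R.obj Y), IsPullback a f (R.map k) b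

/-- The functor `R` identifies its domain with a local exponential ideal: the pushforward along any
map of a pullback of a map in the image of `R` is again such a pullback. -/
def IsLocalExponentialIdeal {C : Type u₁} [Category.{v₁} C] {D : Type u} [Category.{v} D]
    [HasPullbacks D] (R : C ⥤ D) : Prop :=
  ∀ {X Y : D} (g : X ⟶ Y) (G : Over X ⥤ Over Y), (Over.pullback g ⊣ G) →
    ∀ f : Over X, IsPullbackOfImage R f.hom → IsPullbackOfImage R (G.obj f).hom

set_option linter.checkUnivs false in
/-- A modal context structure over the 2-category `K`: a strict 2-functor `K^coop ⥤ Cat` whose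
values have terminal objects. -/
structure ModalContextStructure (K : Type u₁) [Bicategory.{w₁, v₁} K] where
  /-- the 2-functor -/
  functor : StrictPseudofunctor (Coop K) Cat.{v, u}
  hasTerminal : ∀ a : Coop K, HasTerminal (functor.obj a)

section

variable (L : Type u₁) [Bicategory.{w₁, v₁} L] [Bicategory.Strict L]

/-- The class of all 1-cells of `L`. -/
abbrev allCells : ∀ ⦃p q : L⦄, (p ⟶ q) → Prop := fun _ _ _ => True

/-- The pseudofunctor from `L` to the `coop` of the 2-category with all right adjoints adjoined,
that sends a 1-cell `μ` to its right adjoint `μ†`. -/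
def dagger : L ⥤ᵖ Coop (LAdj (allCells L)) :=
  (toAdj (LAdj.incl (allCells L)).toPseudofunctor (fun μ => LAdj.dag μ trivial)
    (fun μ => LAdj.adj μ trivial)).comp rightAdjoint

variable {L}

set_option linter.checkUnivs false in
/-- An adjoint modal pre-model over a 2-category `L` with a class `S` of 1-cells. -/
structure AdjointModalPreModel (S : ∀ ⦃p q : L⦄, (p ⟶ q) → Prop) where
  /-- the modal context structure `Ĉ` over `L` with all right adjoints adjoined -/
  Chat : ModalContextStructure.{max u₁ v₁ w₁, max u₁ v₁, u₁, v, u}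
    (LAdj (allCells L))
  lcc : ∀ a, LocallyCartesianClosed (Chat.functor.obj a)
  /-- the pseudofunctor `C` on `L` with right adjoints of the members of `S` adjoined -/
  C : LAdj S ⥤ᵖ Cat.{v, u}
  /-- the functors `L_p : Ĉ_p ⥤ C_p`, pseudonatural in `p`, where a 1-cell `μ` of `L` acts on the
  left by `Ĉ^{μ†}` and on the right by `C_μ` -/
  reflect : Pseudofunctor.StrongTrans ((dagger L).comp Chat.functor.toPseudofunctor)
    ((LAdj.incl S).toPseudofunctor.comp C)
  preservesFiniteLimits : ∀ p : L, PreservesFiniteLimits (reflect.app p).toFunctor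
  /-- the right adjoint `R_p` of `L_p` -/
  R : ∀ p : L, C.obj ⟨p⟩ ⥤ Chat.functor.obj ⟨⟨p⟩⟩
  /-- the adjunction `L_p ⊣ R_p` -/
  adj : ∀ p : L, (reflect.app p).toFunctor ⊣ R p
  full : ∀ p : L, (R p).Full
  faithful : ∀ p : L, (R p).Faithful
  /-- the natural pseudo-model `τ_p` on `C_p` -/
  τ : ∀ p : L, NaturalPseudoModel.{v, u, v₃, u₃} (C.obj ⟨p⟩)

namespace AdjointModalPreModel

variable {S : ∀ ⦃p q : L⦄, (p ⟶ q) → Prop}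
  (M : AdjointModalPreModel.{w₁, v₁, u₁, v, u, v₃, u₃} S)

instance (p : L) : HasPullbacks (M.Chat.functor.obj ⟨⟨p⟩⟩) := (M.lcc ⟨⟨p⟩⟩).toHasLimitsOfShape

set_option linter.checkUnivs false in
/-- The natural model on `Ĉ_p` obtained by restriction along `L_p` of the left adjoint splitting
of `τ_p`. -/
noncomputable def splitModel (p : L) :
    NaturalModel.{v, u, max u v u₃} (M.Chat.functor.obj ⟨⟨p⟩⟩) :=
  (M.τ p).typeCat.leftAdjointSplitting.restrict (M.adj p)

end AdjointModalPreModel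

end

end MATT

namespace MATT

/-! ## Local maps of a left exact localization -/

section Local

variable {C : Type u₁} [Category.{v₁} C] {E : Type u} [Category.{v} E] {F : E ⥤ C} {R : C ⥤ E}
  (adj : F ⊣ R)

/-! Fix `p` and write `F ⊣ R` for the localization, with `F` left exact and `R` fully faithful. The
proof has two ingredients: local maps, which `F` sees faithfully, and the local universe method,
carried out in the base of the localization.

Local maps. A map is a pullback of one in the image of `R` exactly when its unit square is a
pullback (`IsPullbackOfImage.isLocalMap` and its converse), and it is then right orthogonal to every
map that `F` inverts (`IsLocalMap.existsUnique_lift`). Compare a pushforward of a local `f` along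
`g` with its local reflection. `F` inverts the comparison map, and also its pullback along `g`
because `F` is left exact. By orthogonality the evaluation map extends along that pullback; the
transpose is a retraction of the comparison map, which is therefore invertible. This is
`IsLocalMap.pushforward`, hence (i). Applied to maps in the image of `R`, it also shows that `C` has
pushforwards (`hasPushes_of_localization`).

Names. A type of the splitting over `Γ` is a map from `F Γ` to a local universe, and its projection
is local. So terms of a type in `E` are the same as maps of `C` into the comprehension of the
classifying type (`Cls.lift_ext`, `Cls.exists_lift`). Rules in `E` become statements in `C`, and
substitution becomes precomposition with `F σ`, which is strictly functorial.

Formation. The premises of a rule have names in a universe built with finite limits and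
pushforwards: the universe of families (`famU`), a product, a single local universe, or the terminal
object. Weakly stable structure is chosen once for the generic premises and every instance is named
by the classifying map. The universe does not change under substitution and the classifying map is
unique, so formation and introduction are strictly stable (`famName_sub`).

Elimination. Weak stability gives solutions separately after each base change. The instances of a
rule, with its motive and premises, have a universal one, again built with pushforwards. Solving it
once and restricting the solution gives choices that commute with substitution
(`StableLLP.exists_fill`, `exists_lam`, `exists_natural_solution`). For W-types the premise is a
natural operation; by a Yoneda argument it is encoded by its value at generic arguments, which exist
in `C` by `Arg.exists_generic` and are realised in `E` by `nonempty_generic`.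

The invertibility variants follow since `F` turns the constructor into a base change of an
invertible map, and a map between local maps is invertible once `F` inverts it (`IsLocalMap.isIso`).
Uniqueness of abstraction descends from `C` by comparing names. -/

/-- A map is local for the adjunction `F ⊣ R` if its naturality square for the unit is a
pullback. -/
def IsLocalMap {A B : E} (f : A ⟶ B) : Prop :=
  IsPullback (adj.unit.app A) f (R.map (F.map f)) (adj.unit.app B)

variable {adj}

theorem IsLocalMap.isPullbackOfImage {A B : E} {f : A ⟶ B} (h : IsLocalMap adj f) :
    IsPullbackOfImage R f :=
  ⟨_, _, _, _, _, h⟩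

-- The counit is invertible, so applying `F` shows that `F f` is a pullback of `k`, and then `R (F
-- f)` is a pullback of `R k`. The given square is the unit square of `f` followed by this one, so
-- cancellation leaves a pullback. The condition no longer mentions the choice of `k`.
variable (adj) in
theorem IsPullbackOfImage.isLocalMap [HasPullbacks E] [PreservesFiniteLimits F] [R.Full]
    [R.Faithful] {A B : E} {f : A ⟶ B} (h : IsPullbackOfImage R f) : IsLocalMap adj f := by
  obtain ⟨X, Y, k, a, b, sq⟩ := h
  have e : ∀ {T : E} {Z : C} (c : T ⟶ R.obj Z),
      c = adj.unit.app T ≫ R.map (F.map c ≫ adj.counit.app Z) := by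
    intro T Z c
    simp
  have sq₁ : IsPullback (F.map a ≫ adj.counit.app X) (F.map f) k (F.map b ≫ adj.counit.app Y) :=
    (sq.map F).paste_horiz (IsPullback.of_horiz_isIso ⟨by simp⟩)
  have : PreservesLimitsOfSize.{0, 0} R := adj.rightAdjoint_preservesLimits
  have sq₂ := sq₁.map R
  have sq₃ : IsPullback (adj.unit.app A ≫ R.map (F.map a ≫ adj.counit.app X)) f (R.map k)
      (adj.unit.app B ≫ R.map (F.map b ≫ adj.counit.app Y)) := by
    rwa [← e, ← e]
  exact IsPullback.of_right sq₃ (adj.unit.naturality f).symm sq₂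

/-- Local maps are right orthogonal to the maps inverted by the left adjoint. -/
theorem IsLocalMap.existsUnique_lift {A B : E} {f : A ⟶ B} (h : IsLocalMap adj f) {T T' : E}
    (s : T ⟶ T') [IsIso (F.map s)] (x : T ⟶ A) (y : T' ⟶ B) (w : x ≫ f = s ≫ y) :
    ∃! z : T' ⟶ A, s ≫ z = x ∧ z ≫ f = y := by
  have w' : R.map (F.map x) ≫ R.map (F.map f) = R.map (F.map s) ≫ R.map (F.map y) := by
    simp only [← Functor.map_comp, w]
  -- After `F` the map `s` is invertible, so the lift is already known there; the unit square of `f`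
  -- brings it back to `E`.
  have key : (adj.unit.app T' ≫ R.map (inv (F.map s) ≫ F.map x)) ≫ R.map (F.map f)
      = y ≫ adj.unit.app B := by
    rw [Category.assoc, ← Functor.map_comp, Category.assoc, ← F.map_comp, w,
      F.map_comp, IsIso.inv_hom_id_assoc]
    exact (adj.unit.naturality y).symm
  have e₁ : s ≫ adj.unit.app T' ≫ R.map (inv (F.map s) ≫ F.map x) = x ≫ adj.unit.app A := by
    have := adj.unit.naturality s
    dsimp at this
    rw [reassoc_of% this, ← Functor.map_comp, IsIso.hom_inv_id_assoc]
    exact (adj.unit.naturality x).symm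
  refine ⟨IsPullback.lift h _ _ key, ⟨?_, h.lift_snd _ _ _⟩, ?_⟩
  · apply IsPullback.hom_ext h
    · rw [Category.assoc, h.lift_fst, e₁]
    · rw [Category.assoc, h.lift_snd, w]
  · rintro z ⟨rfl, rfl⟩
    apply IsPullback.hom_ext h
    · rw [h.lift_fst]
      refine (adj.unit.naturality z).trans ?_
      dsimp
      simp
    · rw [h.lift_snd]

/-- The unit square presents `A` as a pullback, and by naturality the component of `x` in `R (F A)`
depends only on `F x`. -/
theorem IsLocalMap.hom_ext {A B : E} {f : A ⟶ B} (h : IsLocalMap adj f) {X : E} {x y : X ⟶ A}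
    (e₁ : x ≫ f = y ≫ f) (e₂ : F.map x = F.map y) : x = y := by
  apply IsPullback.hom_ext h _ e₁
  refine (adj.unit.naturality x).trans (Eq.trans ?_ (adj.unit.naturality y).symm)
  dsimp
  rw [e₂]

/-- Maps into a local map `A ⟶ B` are given over `C`. -/
theorem IsLocalMap.exists_map {A B : E} {f : A ⟶ B} (h : IsLocalMap adj f) {X : E} (y : X ⟶ B)
    (k : F.obj X ⟶ F.obj A) (w : k ≫ F.map f = F.map y) : ∃ x : X ⟶ A, x ≫ f = y ∧ F.map x = k := by
  have key : (adj.unit.app X ≫ R.map k) ≫ R.map (F.map f) = y ≫ adj.unit.app B := by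
    rw [Category.assoc, ← Functor.map_comp, w]
    exact (adj.unit.naturality y).symm
  refine ⟨IsPullback.lift h _ _ key, h.lift_snd _ _ _, ?_⟩
  have := congrArg F.map (h.lift_fst _ _ key)
  rw [Functor.map_comp] at this
  have := congrArg (· ≫ adj.counit.app _) this
  simpa using this

theorem IsLocalMap.comp {A B B' : E} {f : A ⟶ B} {g : B ⟶ B'} (hf : IsLocalMap adj f)
    (hg : IsLocalMap adj g) : IsLocalMap adj (f ≫ g) := by
  have := IsPullback.paste_vert hf hg
  rwa [← R.map_comp, ← F.map_comp] at this

/-- Orthogonality of `f` gives a candidate inverse, a lift of the identity along `s`; the other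
composite is the identity by uniqueness of lifts against `g`. Invertibility of pairing and
reflexivity maps is reflected from `C` in this way. -/
theorem IsLocalMap.isIso {A B T : E} {f : A ⟶ T} {g : B ⟶ T} (hf : IsLocalMap adj f)
    (hg : IsLocalMap adj g) (s : A ⟶ B) (w : s ≫ g = f) [IsIso (F.map s)] : IsIso s := by
  subst w
  obtain ⟨z, ⟨hz₁, hz₂⟩, -⟩ := hf.existsUnique_lift s (𝟙 A) g (by rw [Category.id_comp])
  refine ⟨z, hz₁, ?_⟩
  obtain ⟨_, -, hu⟩ := hg.existsUnique_lift s s g rfl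
  rw [hu (z ≫ s) ⟨by rw [reassoc_of% hz₁], by rw [Category.assoc, hz₂]⟩, ← hu (𝟙 B) ⟨by simp, by simp⟩]

/-- The pushforward of a local map along an arbitrary map is local. -/
theorem IsLocalMap.pushforward [HasPullbacks E] [PreservesFiniteLimits F] [R.Full]
    [R.Faithful] {X Y : E} (g : X ⟶ Y) (P : Over X ⥤ Over Y) (a : Over.pullback g ⊣ P)
    (f : Over X) (hf : IsLocalMap adj f.hom) : IsLocalMap adj (P.obj f).hom := by
  let p := (P.obj f).hom
  -- `q` is the local reflection of `p` over `Y`, with comparison map `s`. The goal becomes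
  -- invertibility of `s`.
  let q := pullback.snd (R.map (F.map p)) (adj.unit.app Y)
  have hq : IsLocalMap adj q :=
    IsPullbackOfImage.isLocalMap adj ⟨_, _, _, _, _, IsPullback.of_hasPullback _ _⟩
  let s : (P.obj f).left ⟶ pullback (R.map (F.map p)) (adj.unit.app Y) :=
    pullback.lift (adj.unit.app _) p (adj.unit.naturality p).symm
  have hs : s ≫ q = p := pullback.lift_snd _ _ _
  -- `F` inverts the unit at `Y`, hence its base change, the first projection; `s` followed by that
  -- projection is a unit, which `F` also inverts.
  have : IsIso (F.map s) := by
    have h₁ : IsPullback (F.map (pullback.fst (R.map (F.map p)) (adj.unit.app Y))) (F.map q)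
      (F.map (R.map (F.map p))) (F.map (adj.unit.app Y)) := (IsPullback.of_hasPullback _ _).map F
    have := h₁.isIso_fst_of_isIso
    have h₂ : F.map s ≫ F.map (pullback.fst (R.map (F.map p)) (adj.unit.app Y))
        = F.map (adj.unit.app _) := by
      rw [← F.map_comp, pullback.lift_fst]
    exact IsIso.of_isIso_fac_right h₂
  let Q : Over Y := Over.mk q
  let S : P.obj f ⟶ Q := Over.homMk s hs
  let S' := (Over.pullback g).map S
  have hS' : S'.left ≫ pullback.fst Q.hom g = pullback.fst (P.obj f).hom g ≫ s :=
    pullback.lift_fst _ _ _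
  -- `S'` is a base change of `s`, and `F` preserves pullbacks.
  have : IsIso (F.map S'.left) := by
    have sq₁ : IsPullback (pullback.fst Q.hom g) (pullback.snd Q.hom g) Q.hom g :=
      IsPullback.of_hasPullback _ _
    have sq₂ : IsPullback (pullback.fst (P.obj f).hom g) (pullback.snd (P.obj f).hom g)
      (P.obj f).hom g := IsPullback.of_hasPullback _ _
    have sq₃ : IsPullback (pullback.fst (P.obj f).hom g) S'.left s (pullback.fst Q.hom g) := by
      refine IsPullback.of_bot ?_ hS'.symm sq₁
      have e : S'.left ≫ pullback.snd Q.hom g = pullback.snd (P.obj f).hom g :=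
        pullback.lift_snd _ _ _
      rw [e]
      have : s ≫ Q.hom = (P.obj f).hom := hs
      rw [this]
      exact sq₂
    have := sq₃.map F
    exact this.isIso_snd_of_isIso
  -- The transpose of the identity is evaluation. Locality of `f` extends it along `S'`, and the
  -- transpose of the extension is a retraction of `S`.
  obtain ⟨z, ⟨hz₁, hz₂⟩, -⟩ := hf.existsUnique_lift S'.left ((a.homEquiv _ _).symm (𝟙 _)).left
    ((Over.pullback g).obj Q).hom (by
      rw [Over.w, Over.w])
  let Z : (Over.pullback g).obj Q ⟶ f := Over.homMk z hz₂
  have hZ : S' ≫ Z = (a.homEquiv _ _).symm (𝟙 _) := by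
    ext
    exact hz₁
  have hr : S ≫ a.homEquiv _ _ Z = 𝟙 _ := by
    rw [← Adjunction.homEquiv_naturality_left, hZ, Equiv.apply_symm_apply]
  have hr' : s ≫ (a.homEquiv _ _ Z).left = 𝟙 _ := congrArg CommaMorphism.left hr
  -- The retraction followed by `s`, like the identity, lifts `s` against the local map `q`, and
  -- such a lift is unique.
  have : IsIso s := by
    refine ⟨_, hr', ?_⟩
    obtain ⟨_, -, hu⟩ := hq.existsUnique_lift s s q rfl
    rw [hu ((a.homEquiv _ _ Z).left ≫ s) ⟨by rw [reassoc_of% hr'], by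
      rw [Category.assoc, hs]; exact Over.w (a.homEquiv _ _ Z)⟩, ← hu (𝟙 _) ⟨by simp, by simp⟩]
  have sq : IsPullback (pullback.fst (R.map (F.map p)) (adj.unit.app Y)) q _ _ :=
    IsPullback.of_hasPullback _ _
  have hs' : s ≫ pullback.fst _ _ = adj.unit.app _ := pullback.lift_fst _ _ _
  exact sq.of_iso (asIso s).symm (Iso.refl _) (Iso.refl _) (Iso.refl _)
    (by simp [← hs']) (by simp [← hs, p]) (by simp [p]) (by simp)

end Local

/-! ## Pushforwards -/

section Push

variable {C : Type u} [Category.{v} C]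

/-- `π : W ⟶ Y` is the pushforward of `q : X' ⟶ X` along `h : X ⟶ Y`, with evaluation map `ev` on
the pullback `P` of `X` and `W` over `Y`. -/
structure IsPush {X' X Y W P : C} (q : X' ⟶ X) (h : X ⟶ Y) (π : W ⟶ Y) (a : P ⟶ X) (b : P ⟶ W)
    (ev : P ⟶ X') : Prop where
  isPullback : IsPullback a b h π
  ev_q : ev ≫ q = a
  existsUnique : ∀ {Z Q : C} {t : Z ⟶ Y} {a' : Q ⟶ X} {b' : Q ⟶ Z} (_ : IsPullback a' b' h t)
    (k : Q ⟶ X') (_ : k ≫ q = a'),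
    ∃! w : Z ⟶ W, w ≫ π = t ∧ ∃ l : Q ⟶ P, l ≫ a = a' ∧ l ≫ b = b' ≫ w ∧ l ≫ ev = k

/-- The universal property does not see which pullback carries the evaluation map. This allows a
pushforward to be moved into the image of `R`, or its evaluation onto a chosen comprehension square.
-/
theorem IsPush.of_iso {X' X Y W W₂ P P₂ : C} {q : X' ⟶ X} {h : X ⟶ Y} {π : W ⟶ Y} {a : P ⟶ X}
    {b : P ⟶ W} {ev : P ⟶ X'} (hp : IsPush q h π a b ev) (i : W ≅ W₂) {π₂ : W₂ ⟶ Y}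
    (hi : i.hom ≫ π₂ = π) {a₂ : P₂ ⟶ X} {b₂ : P₂ ⟶ W₂}
    (h₂ : IsPullback a₂ b₂ h π₂) : ∃ ev₂ : P₂ ⟶ X', IsPush q h π₂ a₂ b₂ ev₂ := by
  have hp' : IsPullback a (b ≫ i.hom) h π₂ :=
    hp.isPullback.of_iso (Iso.refl _) (Iso.refl _) i (Iso.refl _) (by simp) (by simp) (by simp)
      (by simp [hi])
  let e := h₂.isoIsPullback _ _ hp'
  have e₁ : e.hom ≫ a = a₂ := h₂.isoIsPullback_hom_fst _ _ hp'
  have e₂ : e.hom ≫ b ≫ i.hom = b₂ := h₂.isoIsPullback_hom_snd _ _ hp'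
  have e₃ : e.inv ≫ a₂ = a := h₂.isoIsPullback_inv_fst _ _ hp'
  have e₄ : e.inv ≫ b₂ = b ≫ i.hom := h₂.isoIsPullback_inv_snd _ _ hp'
  refine ⟨e.hom ≫ ev, h₂, by rw [Category.assoc, hp.ev_q, e₁], ?_⟩
  intro Z Q t a' b' hQ k hk
  obtain ⟨w, ⟨hw, l, hl₁, hl₂, hl₃⟩, hu⟩ := hp.existsUnique hQ k hk
  refine ⟨w ≫ i.hom, ⟨by simp [hi, hw], l ≫ e.inv, by simp [e₃, hl₁],
    by simp [e₄, reassoc_of% hl₂], by simp [hl₃]⟩, ?_⟩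
  rintro w' ⟨hw', l', hl'₁, hl'₂, hl'₃⟩
  rw [← Iso.comp_inv_eq]
  refine hu _ ⟨by rw [← hw', ← hi]; simp, l' ≫ e.hom, by simp [e₁, hl'₁], ?_, by simpa using hl'₃⟩
  rw [← cancel_mono i.hom]
  simp [e₂, hl'₂]

theorem IsPush.of_isPullback {X' X Y W P P₂ : C} {q : X' ⟶ X} {h : X ⟶ Y} {π : W ⟶ Y} {a : P ⟶ X}
    {b : P ⟶ W} {ev : P ⟶ X'} (hp : IsPush q h π a b ev) {a₂ : P₂ ⟶ X} {b₂ : P₂ ⟶ W}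
    (h₂ : IsPullback a₂ b₂ h π) : ∃ ev₂ : P₂ ⟶ X', IsPush q h π a₂ b₂ ev₂ :=
  hp.of_iso (Iso.refl W) (Category.id_comp π) h₂

/-- Test squares are carried along `R`, which preserves pullbacks; the solutions found there come
back by fullness, and their equations and uniqueness by faithfulness. -/
theorem IsPush.of_map {D : Type u₁} [Category.{v₁} D] {R : C ⥤ D} [R.Full] [R.Faithful]
    [PreservesLimitsOfShape WalkingCospan R]
    {X' X Y W P : C} {q : X' ⟶ X} {h : X ⟶ Y} {π : W ⟶ Y} {a : P ⟶ X} {b : P ⟶ W} {ev : P ⟶ X'}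
    (hp : IsPush (R.map q) (R.map h) (R.map π) (R.map a) (R.map b) (R.map ev))
    (hP : IsPullback a b h π) : IsPush q h π a b ev := by
  refine ⟨hP, R.map_injective (by rw [R.map_comp, hp.ev_q]), ?_⟩
  intro Z Q t a' b' hQ k hk
  obtain ⟨w, ⟨hw, l, hl₁, hl₂, hl₃⟩, hu⟩ := hp.existsUnique (hQ.map R) (R.map k) (by
    rw [← R.map_comp, hk])
  obtain ⟨w, rfl⟩ := R.map_surjective w
  obtain ⟨l, rfl⟩ := R.map_surjective l
  simp only [← R.map_comp] at hw hl₁ hl₂ hl₃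
  refine ⟨w, ⟨R.map_injective hw, l, R.map_injective hl₁, R.map_injective hl₂,
    R.map_injective hl₃⟩, ?_⟩
  rintro w' ⟨hw', l', rfl, hl'₂, rfl⟩
  exact R.map_injective (hu _ ⟨by rw [← R.map_comp, hw'], R.map l', by simp, by
    rw [← R.map_comp, hl'₂, R.map_comp], by simp⟩)

/-- Two maps into a pushforward agree if they have the same evaluations. -/
theorem IsPush.hom_ext {X' X Y W P : C} {q : X' ⟶ X} {h : X ⟶ Y} {π : W ⟶ Y} {a : P ⟶ X}
    {b : P ⟶ W} {ev : P ⟶ X'} (hp : IsPush q h π a b ev) {Z Q : C} {t : Z ⟶ Y} {a' : Q ⟶ X}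
    {b' : Q ⟶ Z} (hQ : IsPullback a' b' h t) {w w' : Z ⟶ W} (hw : w ≫ π = t) (hw' : w' ≫ π = t)
    (l l' : Q ⟶ P) (h₁ : l ≫ a = a') (h₂ : l ≫ b = b' ≫ w) (h₁' : l' ≫ a = a')
    (h₂' : l' ≫ b = b' ≫ w') (e : l ≫ ev = l' ≫ ev) : w = w' := by
  refine (hp.existsUnique hQ (l ≫ ev) (by rw [Category.assoc, hp.ev_q, h₁])).unique
    ⟨hw, l, h₁, h₂, rfl⟩ ⟨hw', l', h₁', h₂', e.symm⟩

variable (C) in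
/-- All pushforwards exist. -/
class HasPushes : Prop where
  exists_isPush : ∀ {X' X Y : C} (q : X' ⟶ X) (h : X ⟶ Y), ∃ (W P : C) (π : W ⟶ Y) (a : P ⟶ X)
    (b : P ⟶ W) (ev : P ⟶ X'), IsPush q h π a b ev

/-- The counit is the evaluation. The adjunction speaks of the chosen pullback only, whereas the
universal property is tested on arbitrary squares; the isomorphism `e` passes between the two. -/
theorem isPush_of_adjunction [HasPullbacks C] {X' X Y : C} (q : X' ⟶ X) (h : X ⟶ Y)
    (G : Over X ⥤ Over Y) (adj : Over.pullback h ⊣ G) :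
    IsPush q h (G.obj (Over.mk q)).hom (pullback.snd (G.obj (Over.mk q)).hom h)
      (pullback.fst (G.obj (Over.mk q)).hom h) (adj.counit.app (Over.mk q)).left := by
  refine ⟨(IsPullback.of_hasPullback _ _).flip, Over.w (adj.counit.app (Over.mk q)), ?_⟩
  intro Z Q t a' b' hQ k hk
  let e := (IsPullback.of_hasPullback t h).flip.isoIsPullback _ _ hQ
  have e₁ : e.hom ≫ a' = pullback.snd t h :=
    (IsPullback.of_hasPullback t h).flip.isoIsPullback_hom_fst _ _ hQ
  have e₂ : e.hom ≫ b' = pullback.fst t h :=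
    (IsPullback.of_hasPullback t h).flip.isoIsPullback_hom_snd _ _ hQ
  let T : Over Y := Over.mk t
  let K : (Over.pullback h).obj T ⟶ Over.mk q := Over.homMk (e.hom ≫ k) (by
    simp only [Category.assoc, Over.mk_hom, hk, e₁]; rfl)
  have m₁ : ∀ w : T ⟶ G.obj (Over.mk q), ((Over.pullback h).map w).left ≫
      pullback.fst (G.obj (Over.mk q)).hom h = pullback.fst t h ≫ w.left := fun w =>
    pullback.lift_fst _ _ _
  have m₂ : ∀ w : T ⟶ G.obj (Over.mk q), ((Over.pullback h).map w).left ≫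
      pullback.snd (G.obj (Over.mk q)).hom h = pullback.snd t h := fun w =>
    pullback.lift_snd _ _ _
  have key : ∀ (w : T ⟶ G.obj (Over.mk q)) (l : Q ⟶ pullback (G.obj (Over.mk q)).hom h),
      l ≫ pullback.snd (G.obj (Over.mk q)).hom h = a' →
      l ≫ pullback.fst (G.obj (Over.mk q)).hom h = b' ≫ w.left →
      l = e.inv ≫ ((Over.pullback h).map w).left := by
    intro w l h₁ h₂
    apply pullback.hom_ext
    · rw [h₂, Category.assoc, m₁, ← e₂]
      simp
    · rw [h₁, Category.assoc, m₂, ← e₁]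
      simp
  refine ⟨(adj.homEquiv _ _ K).left, ⟨Over.w (adj.homEquiv _ _ K),
    e.inv ≫ ((Over.pullback h).map (adj.homEquiv _ _ K)).left, ?_, ?_, ?_⟩, ?_⟩
  · rw [Category.assoc, m₂, ← e₁]
    simp
  · rw [Category.assoc, m₁, ← e₂]
    simp
  · have : (Over.pullback h).map (adj.homEquiv T (Over.mk q) K) ≫ adj.counit.app (Over.mk q) = K :=
      (Adjunction.homEquiv_counit adj _ _ _).symm.trans (Equiv.symm_apply_apply _ _)
    rw [Category.assoc, ← Over.comp_left, this]
    simp [K]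
  · rintro w ⟨hw, l, h₁, h₂, h₃⟩
    let ω : T ⟶ G.obj (Over.mk q) := Over.homMk w hw
    suffices ω = adj.homEquiv _ _ K from congrArg CommaMorphism.left this
    rw [← Equiv.symm_apply_eq, Adjunction.homEquiv_counit]
    ext
    rw [key ω l h₁ h₂] at h₃
    have hK : K.left = e.hom ≫ k := rfl
    rw [Over.comp_left, hK, ← h₃]
    simp

/-- A left exact localization of a locally cartesian closed category has pushforwards. -/
theorem hasPushes_of_localization {E : Type u₁} [Category.{v₁} E] [LocallyCartesianClosed E]
    {F : E ⥤ C} {R : C ⥤ E} (adj : F ⊣ R) [HasPullbacks C] [PreservesFiniteLimits F] [R.Full]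
    [R.Faithful] : HasPushes C := by
  refine ⟨fun {X' X Y} q h => ?_⟩
  have : PreservesLimitsOfSize.{0, 0} R := adj.rightAdjoint_preservesLimits
  have := LocallyCartesianClosed.isLeftAdjoint (R.map h)
  let G := (Over.pullback (R.map h)).rightAdjoint
  let a : Over.pullback (R.map h) ⊣ G := Adjunction.ofIsLeftAdjoint _
  have hp := isPush_of_adjunction (R.map q) (R.map h) G a
  -- `R q` is local, so its pushforward is too. The unit is invertible at `R Y`, hence at the total
  -- space of a local map to it, which thus lies in the image of `R` up to isomorphism.
  have hl : IsLocalMap adj (G.obj (Over.mk (R.map q))).hom :=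
    IsLocalMap.pushforward (adj := adj) (R.map h) G a _
      (IsPullbackOfImage.isLocalMap adj ⟨X', X, q, 𝟙 _, 𝟙 _, IsPullback.of_horiz_isIso ⟨by simp⟩⟩)
  have : IsIso (adj.unit.app (G.obj (Over.mk (R.map q))).left) :=
    IsPullback.isIso_fst_of_isIso hl
  let i := asIso (adj.unit.app (G.obj (Over.mk (R.map q))).left)
  let π := F.map (G.obj (Over.mk (R.map q))).hom ≫ adj.counit.app Y
  obtain ⟨ev, hev⟩ := hp.of_iso i (π₂ := R.map π) (by simp [i, π])
    ((IsPullback.of_hasPullback h π).map R)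
  obtain ⟨ev, rfl⟩ := R.map_surjective ev
  exact ⟨_, _, _, _, _, _, hev.of_map (IsPullback.of_hasPullback h π)⟩

end Push

/-! ## Natural choice of fillers -/

section Fill

variable {C : Type u} [Category.{v} C] {Y P V V' : C} {ι : Type} {K : ι → C}

/-- A lifting problem, over `t : Z ⟶ Y`, of the pullback of the family `m` of maps over `Y` against
the map `q`. -/
structure FillProblem (π : P ⟶ Y) (m : ∀ k, K k ⟶ P) (q : V' ⟶ V) where
  {Z P' : C}
  {K' : ι → C}
  t : Z ⟶ Y
  u : P' ⟶ P
  v : P' ⟶ Z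
  hP : IsPullback u v π t
  e : ∀ k, K' k ⟶ K k
  m' : ∀ k, K' k ⟶ P'
  hK : ∀ k, IsPullback (e k) (m' k) (m k) u
  c : P' ⟶ V
  d : ∀ k, K' k ⟶ V'
  hd : ∀ k, d k ≫ q = m' k ≫ c

namespace FillProblem

variable {π : P ⟶ Y} {m : ∀ k, K k ⟶ P} {q : V' ⟶ V}

/-- A solution of a lifting problem. -/
def IsSolution (x : FillProblem π m q) (s : x.P' ⟶ V') : Prop :=
  s ≫ q = x.c ∧ ∀ k, x.m' k ≫ s = x.d k

/-- The lifting problem `x` is the restriction of `y` along `r`. -/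
structure Restr (x y : FillProblem π m q) (r : x.Z ⟶ y.Z) (ρ : x.P' ⟶ y.P')
    (κ : ∀ k, x.K' k ⟶ y.K' k) : Prop where
  t : r ≫ y.t = x.t
  u : ρ ≫ y.u = x.u
  v : ρ ≫ y.v = x.v ≫ r
  e : ∀ k, κ k ≫ y.e k = x.e k
  m' : ∀ k, κ k ≫ y.m' k = x.m' k ≫ ρ
  c : x.c = ρ ≫ y.c
  d : ∀ k, x.d k = κ k ≫ y.d k

theorem Restr.trans {x y z : FillProblem π m q} {r : x.Z ⟶ y.Z} {ρ : x.P' ⟶ y.P'}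
    {κ : ∀ k, x.K' k ⟶ y.K' k} {r' : y.Z ⟶ z.Z} {ρ' : y.P' ⟶ z.P'} {κ' : ∀ k, y.K' k ⟶ z.K' k}
    (h : Restr x y r ρ κ) (h' : Restr y z r' ρ' κ') :
    Restr x z (r ≫ r') (ρ ≫ ρ') (fun k => κ k ≫ κ' k) where
  t := by rw [Category.assoc, h'.t, h.t]
  u := by rw [Category.assoc, h'.u, h.u]
  v := by rw [Category.assoc, h'.v, reassoc_of% h.v]
  e k := by rw [Category.assoc, h'.e, h.e]
  m' k := by rw [Category.assoc, h'.m', reassoc_of% h.m']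
  c := by rw [Category.assoc, ← h'.c, h.c]
  d k := by rw [Category.assoc, ← h'.d, h.d]

variable (π m q) in
/-- A universal lifting problem: every other one is a restriction of it in a unique way. -/
theorem exists_universal [HasFiniteLimits C] [HasPushes C] [Finite ι] :
    ∃ g : FillProblem π m q, ∀ x : FillProblem π m q,
      (∃ r ρ κ, Restr x g r ρ κ) ∧ ∀ r r' ρ ρ' κ κ', Restr x g r ρ κ → Restr x g r' ρ' κ' →
        r = r' := by
  -- A map into `W₁` is a `t : Z ⟶ Y` with a map `c` to `V` from the pullback of `P`: the
  -- pushforward along `π` of the constant family `V`.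
  obtain ⟨W₁, P₁, π₁, a₁, b₁, ev₁, h₁⟩ := HasPushes.exists_isPush (prod.fst : P ⨯ V ⟶ P) π
  let c₁ := ev₁ ≫ prod.snd
  let j : ∀ k, pullback (m k) a₁ ⟶ P₁ := fun k => pullback.snd (m k) a₁
  -- Over `W₁`, the object `Wk k` classifies the remaining datum `d k`, a lift of the restriction of
  -- `c` along `q`.
  choose Wk Pk πk ak bk evk hk using fun k => HasPushes.exists_isPush (pullback.snd q (j k ≫ c₁)) (j k ≫ b₁)
  -- All the `d k` over a common `c`; a finite limit because `ι` is finite.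
  let W₂ := widePullback W₁ Wk πk
  let β : W₂ ⟶ W₁ := WidePullback.base πk
  let pr : ∀ k, W₂ ⟶ Wk k := WidePullback.π πk
  have hpr : ∀ k, pr k ≫ πk k = β := WidePullback.π_arrow πk
  let ρ₂ := pullback.fst b₁ β
  let v₂ := pullback.snd b₁ β
  have hP₂ : IsPullback ρ₂ v₂ b₁ β := IsPullback.of_hasPullback _ _
  have hj : ∀ k, IsPullback (pullback.fst (m k) a₁) (j k) (m k) a₁ := fun k =>
    IsPullback.of_hasPullback _ _
  have hκ : ∀ k, IsPullback (pullback.fst (j k) ρ₂) (pullback.snd (j k) ρ₂) (j k) ρ₂ := fun k =>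
    IsPullback.of_hasPullback _ _
  have wl : ∀ k, pullback.fst (j k) ρ₂ ≫ j k ≫ b₁
      = (pullback.snd (j k) ρ₂ ≫ v₂ ≫ pr k) ≫ πk k := fun k => by
    rw [reassoc_of% (hκ k).w, hP₂.w, Category.assoc, Category.assoc, hpr]
  let l : ∀ k, pullback (j k) ρ₂ ⟶ Pk k := fun k => (hk k).isPullback.lift _ _ (wl k)
  have hl₁ : ∀ k, l k ≫ ak k = pullback.fst (j k) ρ₂ := fun k =>
    (hk k).isPullback.lift_fst _ _ (wl k)
  have hl₂ : ∀ k, l k ≫ bk k = pullback.snd (j k) ρ₂ ≫ v₂ ≫ pr k := fun k =>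
    (hk k).isPullback.lift_snd _ _ (wl k)
  let g : FillProblem π m q :=
    { Z := W₂
      P' := pullback b₁ β
      K' := fun k => pullback (j k) ρ₂
      t := β ≫ π₁
      u := ρ₂ ≫ a₁
      v := v₂
      hP := hP₂.paste_horiz h₁.isPullback
      e := fun k => pullback.fst (j k) ρ₂ ≫ pullback.fst (m k) a₁
      m' := fun k => pullback.snd (j k) ρ₂
      hK := fun k => (hκ k).paste_horiz (hj k)
      c := ρ₂ ≫ c₁
      d := fun k => l k ≫ evk k ≫ pullback.fst _ _
      hd := fun k => by
        rw [Category.assoc, Category.assoc, pullback.condition, reassoc_of% (hk k).ev_q,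
          reassoc_of% hl₁, reassoc_of% (hκ k).w] }
  refine ⟨g, fun x => ⟨?_, ?_⟩⟩
  · obtain ⟨r₁, ⟨hr₁, l₁, ha, hb, hev⟩, -⟩ := h₁.existsUnique x.hP (prod.lift x.u x.c) (prod.lift_fst _ _)
    have hc : l₁ ≫ c₁ = x.c := by
      change l₁ ≫ ev₁ ≫ prod.snd = x.c
      rw [reassoc_of% hev, prod.lift_snd]
    have sq₁ : IsPullback l₁ x.v b₁ r₁ := by
      refine IsPullback.of_right ?_ hb h₁.isPullback
      rw [ha, hr₁]
      exact x.hP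
    let γ : ∀ k, x.K' k ⟶ pullback (m k) a₁ := fun k =>
      pullback.lift (x.e k) (x.m' k ≫ l₁) (by rw [Category.assoc, ha, (x.hK k).w])
    have hγ₁ : ∀ k, γ k ≫ pullback.fst (m k) a₁ = x.e k := fun k => pullback.lift_fst _ _ _
    have hγ₂ : ∀ k, γ k ≫ j k = x.m' k ≫ l₁ := fun k => pullback.lift_snd _ _ _
    have sq₂ : ∀ k, IsPullback (γ k) (x.m' k) (j k) l₁ := fun k => by
      refine IsPullback.of_right ?_ (hγ₂ k) (hj k)
      rw [hγ₁, ha]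
      exact x.hK k
    have sq₃ : ∀ k, IsPullback (γ k) (x.m' k ≫ x.v) (j k ≫ b₁) r₁ := fun k =>
      (sq₂ k).paste_vert sq₁
    have := fun k => ((hk k).existsUnique (sq₃ k) (pullback.lift (x.d k) (γ k) (by
      rw [x.hd, reassoc_of% hγ₂, hc])) (pullback.lift_snd _ _ _)).exists
    choose r₂ hr₂ l₂ hl₂₁ hl₂₂ hl₂₃ using this
    let r : x.Z ⟶ W₂ := WidePullback.lift r₁ r₂ hr₂
    have hrβ : r ≫ β = r₁ := WidePullback.lift_base _ _ _ _
    have hrpr : ∀ k, r ≫ pr k = r₂ k := fun k => WidePullback.lift_π _ _ _ _ _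
    let ρ : x.P' ⟶ pullback b₁ β := pullback.lift l₁ (x.v ≫ r) (by
      rw [hb, Category.assoc, hrβ])
    have hρ₁ : ρ ≫ ρ₂ = l₁ := pullback.lift_fst _ _ _
    have hρ₂ : ρ ≫ v₂ = x.v ≫ r := pullback.lift_snd _ _ _
    let κ : ∀ k, x.K' k ⟶ pullback (j k) ρ₂ := fun k => pullback.lift (γ k) (x.m' k ≫ ρ) (by
      rw [Category.assoc, hρ₁, hγ₂])
    have hκ₁ : ∀ k, κ k ≫ pullback.fst (j k) ρ₂ = γ k := fun k => pullback.lift_fst _ _ _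
    have hκ₂ : ∀ k, κ k ≫ pullback.snd (j k) ρ₂ = x.m' k ≫ ρ := fun k => pullback.lift_snd _ _ _
    have hκl : ∀ k, κ k ≫ l k = l₂ k := fun k => by
      apply (hk k).isPullback.hom_ext
      · rw [Category.assoc, hl₁, hκ₁, hl₂₁]
      · rw [Category.assoc, hl₂, reassoc_of% hκ₂, reassoc_of% hρ₂, hrpr, hl₂₂, Category.assoc]
    refine ⟨r, ρ, κ, ?_, ?_, hρ₂, ?_, hκ₂, ?_, ?_⟩
    · rw [reassoc_of% hrβ, hr₁]
    · rw [reassoc_of% hρ₁, ha]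
    · intro k
      rw [reassoc_of% hκ₁, hγ₁]
    · rw [reassoc_of% hρ₁, hc]
    · intro k
      rw [reassoc_of% hκl, reassoc_of% hl₂₃, pullback.lift_fst]
  · rintro r r' ρ ρ' κ κ' H H'
    -- Each classifying map recovers the problem by evaluation: `c` determines the component in
    -- `W₁`, and then `d k` determines the component in `Wk k`.
    have base : r ≫ β = r' ≫ β := by
      refine h₁.hom_ext x.hP (w := r ≫ β) (w' := r' ≫ β) (by rw [Category.assoc]; exact H.t)
        (by rw [Category.assoc]; exact H'.t) (ρ ≫ ρ₂) (ρ' ≫ ρ₂) (by rw [Category.assoc]; exact H.u)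
        (by rw [Category.assoc, hP₂.w, ← Category.assoc, ← Category.assoc]; exact
          congrArg (· ≫ β) H.v) (by rw [Category.assoc]; exact H'.u)
        (by rw [Category.assoc, hP₂.w, ← Category.assoc, ← Category.assoc]; exact
          congrArg (· ≫ β) H'.v) ?_
      apply Limits.prod.hom_ext
      · rw [Category.assoc, Category.assoc, Category.assoc, Category.assoc, h₁.ev_q]
        exact H.u.trans H'.u.symm
      · simp only [Category.assoc]
        exact H.c.symm.trans H'.c
    have hρ : ρ ≫ ρ₂ = ρ' ≫ ρ₂ := by
      apply h₁.isPullback.hom_ext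
      · rw [Category.assoc, Category.assoc]
        exact H.u.trans H'.u.symm
      · rw [Category.assoc, Category.assoc, hP₂.w]
        refine (congrArg (· ≫ β) H.v).trans ?_ |>.trans (congrArg (· ≫ β) H'.v).symm |> fun h => by
          simpa only [Category.assoc] using h
        simp only [Category.assoc, base]
    have sq₁ : IsPullback (ρ ≫ ρ₂) x.v b₁ (r ≫ β) := by
      refine IsPullback.of_right ?_ ?_ h₁.isPullback
      · rw [Category.assoc, Category.assoc]
        have e₁ : ρ ≫ ρ₂ ≫ a₁ = x.u := H.u
        have e₂ : r ≫ β ≫ π₁ = x.t := H.t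
        rw [e₁, e₂]
        exact x.hP
      · rw [Category.assoc, hP₂.w, ← Category.assoc, ← Category.assoc]
        exact congrArg (· ≫ β) H.v
    have hγ : ∀ k, κ k ≫ pullback.fst (j k) ρ₂ = κ' k ≫ pullback.fst (j k) ρ₂ := fun k => by
      apply (hj k).hom_ext
      · rw [Category.assoc, Category.assoc]
        exact (H.e k).trans (H'.e k).symm
      · rw [Category.assoc, Category.assoc, (hκ k).w, ← Category.assoc, ← Category.assoc]
        refine (congrArg (· ≫ ρ₂) (H.m' k)).trans (Eq.trans ?_ (congrArg (· ≫ ρ₂) (H'.m' k)).symm)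
        simp only [Category.assoc, hρ]
    apply WidePullback.hom_ext
    · intro k
      have sq₂ : IsPullback (κ k ≫ pullback.fst (j k) ρ₂) (x.m' k) (j k) (ρ ≫ ρ₂) := by
        refine IsPullback.of_right ?_ ?_ (hj k)
        · rw [Category.assoc, Category.assoc]
          have e₁ : ρ ≫ ρ₂ ≫ a₁ = x.u := H.u
          have e₂ : κ k ≫ pullback.fst (j k) ρ₂ ≫ pullback.fst (m k) a₁ = x.e k := H.e k
          rw [e₁, e₂]
          exact x.hK k
        · rw [Category.assoc, (hκ k).w, ← Category.assoc, ← Category.assoc]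
          exact congrArg (· ≫ ρ₂) (H.m' k)
      refine (hk k).hom_ext (sq₂.paste_vert sq₁) (w := r ≫ pr k) (w' := r' ≫ pr k)
        (by rw [Category.assoc, hpr]) (by rw [Category.assoc, hpr, base])
        (κ k ≫ l k) (κ' k ≫ l k) (by rw [Category.assoc, hl₁]) ?_
        (by rw [Category.assoc, hl₁, hγ]) ?_ ?_
      · have e₁ : κ k ≫ pullback.snd (j k) ρ₂ = x.m' k ≫ ρ := H.m' k
        have e₂ : ρ ≫ v₂ = x.v ≫ r := H.v
        rw [Category.assoc, hl₂, reassoc_of% e₁, reassoc_of% e₂, Category.assoc]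
      · have e₁ : κ' k ≫ pullback.snd (j k) ρ₂ = x.m' k ≫ ρ' := H'.m' k
        have e₂ : ρ' ≫ v₂ = x.v ≫ r' := H'.v
        rw [Category.assoc, hl₂, reassoc_of% e₁, reassoc_of% e₂, Category.assoc]
      · apply pullback.hom_ext
        · simp only [Category.assoc]
          exact (H.d k).symm.trans (H'.d k)
        · rw [Category.assoc, Category.assoc, Category.assoc, Category.assoc, (hk k).ev_q, hl₁, hγ]
    · exact base

end FillProblem

/-- The family `m` of maps over `Y` has the left lifting property against `q`, stably under base
change. -/
def StableLLP (π : P ⟶ Y) (m : ∀ k, K k ⟶ P) (q : V' ⟶ V) : Prop :=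
  ∀ x : FillProblem π m q, ∃ s, x.IsSolution s

/-- Any two pullbacks along `t` are isomorphic, compatibly with the pulled back family, so it
suffices to solve the problems posed on one choice of pullbacks for each `t`. -/
theorem StableLLP.of_pullback {π : P ⟶ Y} {m : ∀ k, K k ⟶ P} {q : V' ⟶ V}
    (H : ∀ {Z : C} (t : Z ⟶ Y), ∃ (P' : C) (u : P' ⟶ P) (v : P' ⟶ Z) (_ : IsPullback u v π t)
      (K' : ι → C) (e : ∀ k, K' k ⟶ K k) (m' : ∀ k, K' k ⟶ P')
      (_ : ∀ k, IsPullback (e k) (m' k) (m k) u), ∀ (c : P' ⟶ V) (d : ∀ k, K' k ⟶ V')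
      (_ : ∀ k, d k ≫ q = m' k ≫ c), ∃ s : P' ⟶ V', s ≫ q = c ∧ ∀ k, m' k ≫ s = d k) :
    StableLLP π m q := by
  intro x
  obtain ⟨P', u, v, hP, K', e, m', hK, h⟩ := H x.t
  let φ := hP.isoIsPullback _ _ x.hP
  have hφ₁ : φ.hom ≫ x.u = u := hP.isoIsPullback_hom_fst _ _ x.hP
  have hK' : ∀ k, IsPullback (e k) (m' k ≫ φ.hom) (m k) x.u := fun k =>
    (hK k).of_iso (Iso.refl _) (Iso.refl _) φ (Iso.refl _) (by simp) (by simp) (by simp)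
      (by simp [hφ₁])
  let ψ := fun k => (hK' k).isoIsPullback _ _ (x.hK k)
  have hψ₂ : ∀ k, (ψ k).hom ≫ x.m' k = m' k ≫ φ.hom := fun k =>
    (hK' k).isoIsPullback_hom_snd _ _ (x.hK k)
  obtain ⟨s, hs₁, hs₂⟩ := h (φ.hom ≫ x.c) (fun k => (ψ k).hom ≫ x.d k) (fun k => by
    rw [Category.assoc, x.hd, reassoc_of% hψ₂])
  refine ⟨φ.inv ≫ s, by rw [Category.assoc, hs₁, Iso.inv_hom_id_assoc], fun k => ?_⟩
  rw [← cancel_epi (ψ k).hom, reassoc_of% hψ₂, Iso.hom_inv_id_assoc, hs₂]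

/-- Solutions of lifting problems can be chosen naturally. -/
theorem StableLLP.exists_fill [HasFiniteLimits C] [HasPushes C] [Finite ι] {π : P ⟶ Y}
    {m : ∀ k, K k ⟶ P} {q : V' ⟶ V} (H : StableLLP π m q) :
    ∃ fill : ∀ x : FillProblem π m q, x.P' ⟶ V', (∀ x : FillProblem π m q, x.IsSolution (fill x)) ∧
      ∀ x y r ρ κ, FillProblem.Restr x y r ρ κ → fill x = ρ ≫ fill y := by
  obtain ⟨g, hg⟩ := FillProblem.exists_universal π m q
  -- Only the universal problem is solved by choice. All other solutions are its restrictions, and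
  -- uniqueness of the classifying map `r` makes them natural.
  obtain ⟨s, hs₁, hs₂⟩ := H g
  choose r ρ κ h using fun x => (hg x).1
  refine ⟨fun x => ρ x ≫ s, fun x => ⟨by rw [Category.assoc, hs₁, (h x).c], fun k => ?_⟩, ?_⟩
  · rw [← Category.assoc, ← (h x).m', Category.assoc, hs₂, (h x).d]
  · intro x y r' ρ' κ' h'
    have := (hg x).2 _ _ _ _ _ _ (h x) (h'.trans (h y))
    dsimp only
    rw [← Category.assoc]
    congr 1
    -- The map `ρ` is determined by `r`, since its target is a pullback over `g.Z`.
    apply g.hP.hom_ext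
    · rw [(h x).u, Category.assoc, (h y).u, h'.u]
    · rw [(h x).v, this, Category.assoc, (h y).v, reassoc_of% h'.v]

end Fill

/-! ## The left adjoint splitting, restricted along a left exact localization -/

theorem _root_.CategoryTheory.IsPullback.congr {C : Type u} [Category.{v} C] {P X Y Z : C}
    {a a' : P ⟶ X} {b b' : P ⟶ Y} {f f' : X ⟶ Z} {g g' : Y ⟶ Z} (h : IsPullback a b f g)
    (ha : a = a') (hb : b = b') (hf : f = f') (hg : g = g') : IsPullback a' b' f' g' := by
  subst ha hb hf hg
  exact h

section Restricted

variable {C : Type u} [Category.{v} C] {E : Type u} [Category.{v} E] [HasPullbacks E]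
  {F : E ⥤ C} {R : C ⥤ E} (adj : F ⊣ R) (M : TypeCat.{v, u, w} C)

/-- The types and comprehension of the restriction along `F` of the left adjoint splitting. -/
noncomputable def splitCat : TypeCat.{v, u, max u v w} E :=
  (M.leftAdjointSplitting.restrict adj).typeCat

namespace splitCat

variable {adj M}

/-- The local universe of a type. -/
def base {Γ : E} (A : (splitCat adj M).Ty Γ) : C := TypeCat.SplitTy.base A

/-- The type over the local universe. -/
def top {Γ : E} (A : (splitCat adj M).Ty Γ) : M.Ty (base A) := TypeCat.SplitTy.top A

/-- The name of a type. -/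
def name {Γ : E} (A : (splitCat adj M).Ty Γ) : F.obj Γ ⟶ base A := TypeCat.SplitTy.name A

/-- The type with a given name. -/
def mk {Γ : E} {W : C} (T : M.Ty W) (χ : F.obj Γ ⟶ W) : (splitCat adj M).Ty Γ :=
  TypeCat.SplitTy.mk W T χ

theorem mk_inj {Γ : E} {W : C} {T : M.Ty W} {χ χ' : F.obj Γ ⟶ W}
    (h : mk (adj := adj) T χ = mk T χ') : χ = χ' :=
  eq_of_heq (TypeCat.SplitTy.mk.inj h).2.2

theorem sub_mk {Θ Γ : E} (σ : Θ ⟶ Γ) {W : C} (T : M.Ty W) (χ : F.obj Γ ⟶ W) :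
    (splitCat adj M).sub σ (mk T χ) = mk T (F.map σ ≫ χ) := rfl

/-- The generic term of a type. -/
noncomputable def gen {Γ : E} (A : (splitCat adj M).Ty Γ) :
    F.obj ((splitCat adj M).ext A) ⟶ M.ext (top A) :=
  TypeCat.SplitTm.name ((M.leftAdjointSplitting.restrict adj).q A)

/-- Substitution alters only the name, so both sides have the same target, and `up` is characterised
by pulling the generic term back to the generic term. -/
theorem gen_sub {Θ Γ : E} (σ : Θ ⟶ Γ) (A : (splitCat adj M).Ty Γ) :
    gen ((splitCat adj M).sub σ A) = F.map ((splitCat adj M).up σ A) ≫ gen A := by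
  have := (M.leftAdjointSplitting.restrict adj).up_q σ A
  exact (eq_of_heq (TypeCat.SplitTm.mk.inj this).2.2).symm

/-- The comprehension is defined as a pullback of a map in the image of `R`. This is what allows
terms in `E` to be handled in `C`. -/
theorem isLocalMap_p [PreservesFiniteLimits F] [R.Full] [R.Faithful] {Γ : E}
    (A : (splitCat adj M).Ty Γ) : IsLocalMap adj ((splitCat adj M).p A) :=
  IsPullbackOfImage.isLocalMap adj
    ⟨_, _, M.p (M.sub (name A) (top A)), _, _, IsPullback.of_hasPullback _ _⟩

variable (adj) in
/-- A type `A` over `Γ` is classified by the type `T` along `χ`, with generic term `α`. -/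
abbrev Cls {Γ : E} (A : (splitCat adj M).Ty Γ) {W : C} (T : M.Ty W) (χ : F.obj Γ ⟶ W)
    (α : F.obj ((splitCat adj M).ext A) ⟶ M.ext T) : Prop :=
  IsPullback α (F.map ((splitCat adj M).p A)) (M.p T) χ

/-- `F` preserves the pullback that defines the comprehension, the counit removes `F (R _)`, and the
substitution square of `M` is pasted on. The bottom edge simplifies to the name by a triangle
identity. -/
theorem cls_gen [PreservesFiniteLimits F] [R.Full] [R.Faithful] {Γ : E}
    (A : (splitCat adj M).Ty Γ) : Cls adj A (top A) (name A) (gen A) := by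
  let p₀ := M.p (M.sub (name A) (top A))
  have sq₁ := (IsPullback.of_hasPullback (R.map p₀) (adj.unit.app Γ)).map F
  have sq₂ : IsPullback (adj.counit.app _) (F.map (R.map p₀)) p₀ (adj.counit.app _) :=
    IsPullback.of_horiz_isIso ⟨by simp⟩
  have sq₃ := (sq₁.paste_horiz sq₂).paste_horiz (M.isPullback (name A) (top A))
  have e₁ : (F.map (adj.unit.app Γ) ≫ adj.counit.app (F.obj Γ)) ≫ name A = name A :=
    (congrArg (· ≫ name A) (adj.left_triangle_components Γ)).trans (Category.id_comp _)
  exact sq₃.congr (congrArg (· ≫ M.up (name A) (top A)) (adj.homEquiv_counit _ _ _).symm) rfl rfl e₁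

section

variable {Γ : E} {A : (splitCat adj M).Ty Γ} {W : C} {T : M.Ty W} {χ : F.obj Γ ⟶ W}
  {α : F.obj ((splitCat adj M).ext A) ⟶ M.ext T}

theorem Cls.sub [PreservesFiniteLimits F] (h : Cls adj A T χ α) {Θ : E} (σ : Θ ⟶ Γ) :
    Cls adj ((splitCat adj M).sub σ A) T (F.map σ ≫ χ) (F.map ((splitCat adj M).up σ A) ≫ α) :=
  (((splitCat adj M).isPullback σ A).map F).paste_horiz h

/-- As the projection is local, a term over `f` is determined by its image under `F`, and that image
by its component in `M.ext T`. This is the uniqueness half of the dictionary between terms and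
names; `Cls.exists_lift` is the existence half. -/
theorem Cls.lift_ext [PreservesFiniteLimits F] [R.Full] [R.Faithful] (h : Cls adj A T χ α) {X : E}
    {f : X ⟶ Γ} {d d' : (splitCat adj M).Lift f A} (e : F.map d.hom ≫ α = F.map d'.hom ≫ α) :
    d = d' := by
  refine TypeCat.Lift.ext ((isLocalMap_p A).hom_ext (d.w.trans d'.w.symm) (h.hom_ext e ?_))
  rw [← F.map_comp, ← F.map_comp, d.w, d'.w]

theorem Cls.exists_lift [PreservesFiniteLimits F] [R.Full] [R.Faithful] (h : Cls adj A T χ α)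
    {X : E} (f : X ⟶ Γ) (k : F.obj X ⟶ M.ext T) (w : k ≫ M.p T = F.map f ≫ χ) :
    ∃ d : (splitCat adj M).Lift f A, F.map d.hom ≫ α = k := by
  obtain ⟨x, hx, hx'⟩ := (isLocalMap_p A).exists_map f (h.lift k (F.map f) w) (h.lift_snd _ _ _)
  exact ⟨⟨x, hx⟩, by rw [hx', h.lift_fst]⟩

/-- The term with a given name. -/
noncomputable def Cls.lift [PreservesFiniteLimits F] [R.Full] [R.Faithful] (h : Cls adj A T χ α)
    {X : E} (f : X ⟶ Γ) (k : F.obj X ⟶ M.ext T) (w : k ≫ M.p T = F.map f ≫ χ) :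
    (splitCat adj M).Lift f A := (h.exists_lift f k w).choose

@[simp]
theorem Cls.map_lift [PreservesFiniteLimits F] [R.Full] [R.Faithful] (h : Cls adj A T χ α)
    {X : E} (f : X ⟶ Γ) (k : F.obj X ⟶ M.ext T) (w : k ≫ M.p T = F.map f ≫ χ) :
    F.map (h.lift f k w).hom ≫ α = k := (h.exists_lift f k w).choose_spec

theorem Cls.map_w (h : Cls adj A T χ α) {X : E} {f : X ⟶ Γ} (d : (splitCat adj M).Lift f A) :
    F.map d.hom ≫ α ≫ M.p T = F.map f ≫ χ := by
  rw [h.w, ← Category.assoc, ← F.map_comp, d.w]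

end

section Named

variable {Γ : E} {A : (splitCat adj M).Ty Γ} {W : C} {T : M.Ty W} {χ : F.obj Γ ⟶ W}

/-- The generic term of a type that equals a type with a given name. -/
noncomputable def genOf (h : A = mk T χ) : F.obj ((splitCat adj M).ext A) ⟶ M.ext T :=
  F.map (eqToHom (congrArg (splitCat adj M).ext h)) ≫ gen (mk T χ)

theorem genOf_rfl : genOf (rfl : mk (adj := adj) T χ = mk T χ) = gen (mk (adj := adj) T χ) :=
  (congrArg (· ≫ gen (mk (adj := adj) T χ)) (F.map_id _)).trans (Category.id_comp _)

theorem cls_genOf [PreservesFiniteLimits F] [R.Full] [R.Faithful] (h : A = mk T χ) :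
    Cls adj A T χ (genOf h) := by
  subst h
  rw [genOf_rfl]
  exact cls_gen (mk (adj := adj) T χ)

/-- The strict rules take the formed type as a variable with an equation, so generic terms carry a
transport along that equation. Once the equations are eliminated, this is naturality of the generic
term. -/
theorem genOf_sub (h : A = mk T χ) {Θ : E} (σ : Θ ⟶ Γ) {χ' : F.obj Θ ⟶ W}
    (h' : (splitCat adj M).sub σ A = mk T χ') :
    F.map ((splitCat adj M).up σ A) ≫ genOf h = genOf h' := by
  subst h
  obtain rfl := mk_inj (h'.symm.trans (sub_mk σ T χ))
  rw [genOf_rfl]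
  exact (gen_sub σ (mk T χ)).symm.trans genOf_rfl.symm

end Named

section Mk

variable [PreservesFiniteLimits F] [R.Full] [R.Faithful] {Γ : E} {W : C} {T : M.Ty W}
  {χ : F.obj Γ ⟶ W}

/-- The term with a given name, of a type with a given name. -/
noncomputable def mkLift {X : E} (f : X ⟶ Γ) (k : F.obj X ⟶ M.ext T)
    (w : k ≫ M.p T = F.map f ≫ χ) : (splitCat adj M).Lift f (mk T χ) :=
  (cls_genOf rfl).lift f k w

theorem map_mkLift {X : E} (f : X ⟶ Γ) (k : F.obj X ⟶ M.ext T) (w : k ≫ M.p T = F.map f ≫ χ) :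
    F.map (mkLift (adj := adj) f k w).hom ≫ genOf rfl = k :=
  Cls.map_lift _ _ _ _

theorem map_mkLift_genOf {X : E} (f : X ⟶ Γ) (k : F.obj X ⟶ M.ext T)
    (w : k ≫ M.p T = F.map f ≫ χ) (h : mk (adj := adj) T χ = mk T χ) :
    F.map (mkLift (adj := adj) f k w).hom ≫ genOf h = k :=
  Cls.map_lift _ _ _ _

/-- Both terms are compared by their names, so that strict stability of an introduction term reduces
to an equation `k' = F.map t ≫ k` in `C`. -/
theorem reindex_mkLift {X X' Θ : E} (f : X ⟶ Γ) (k : F.obj X ⟶ M.ext T)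
    (w : k ≫ M.p T = F.map f ≫ χ) (σ : Θ ⟶ Γ) (t : X' ⟶ X) (f' : X' ⟶ Θ) (h : t ≫ f = f' ≫ σ)
    (k' : F.obj X' ⟶ M.ext T) (e : k' = F.map t ≫ k) (w' : k' ≫ M.p T = F.map f' ≫ F.map σ ≫ χ) :
    (mkLift (adj := adj) f k w).reindex σ t f' h = mkLift f' k' w' := by
  apply ((cls_genOf (adj := adj) (rfl : mk T χ = mk T χ)).sub σ).lift_ext
  simp only [TypeCat.Lift.reindex]
  rw [← Category.assoc, ← F.map_comp, TypeCat.pair_up, F.map_comp, Category.assoc, map_mkLift]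
  refine (e.symm.trans (map_mkLift (adj := adj) f' k' w').symm).trans ?_
  exact congrArg (F.map _ ≫ ·) (genOf_sub rfl σ rfl).symm

end Mk

/-! ### Reindexing in terms of names -/

section Reindex

variable {Γ : E} {A : (splitCat adj M).Ty Γ} {W : C} {T : M.Ty W}
  {α : F.obj ((splitCat adj M).ext A) ⟶ M.ext T}

theorem map_reindex {X X' Θ : E} {f : X ⟶ Γ} (d : (splitCat adj M).Lift f A)
    (σ : Θ ⟶ Γ) (t : X' ⟶ X) (f' : X' ⟶ Θ) (h : t ≫ f = f' ≫ σ) :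
    F.map (d.reindex σ t f' h).hom ≫ F.map ((splitCat adj M).up σ A) ≫ α
      = F.map t ≫ F.map d.hom ≫ α := by
  simp only [← Category.assoc, ← F.map_comp]
  simp [TypeCat.Lift.reindex]

theorem map_secSub {Θ : E} (a : (splitCat adj M).Sec A) (σ : Θ ⟶ Γ) :
    F.map (a.sub σ).hom ≫ F.map ((splitCat adj M).up σ A) ≫ α = F.map σ ≫ F.map a.hom ≫ α :=
  map_reindex a σ σ (𝟙 Θ) (by simp)

end Reindex

end splitCat

end Restricted

/-! ### Base change of terms, and lifting properties from sections -/

theorem TypeCat.Lift.isPullback_reindex {D : Type u} [Category.{v} D] {M : TypeCat.{v, u, w} D}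
    {X Γ X' Θ : D} {f : X ⟶ Γ} {A : M.Ty Γ} (d : M.Lift f A) {σ : Θ ⟶ Γ} {t : X' ⟶ X}
    {f' : X' ⟶ Θ} (h : IsPullback t f' f σ) :
    IsPullback t (d.reindex σ t f' h.w).hom d.hom (M.up σ A) := by
  refine IsPullback.of_bot ?_ ?_ (M.isPullback σ A)
  · rw [d.w, TypeCat.Lift.w]
    exact h
  · simp [TypeCat.Lift.reindex]

/-- Two base changes of `m` along the same `t` differ by an isomorphism. Invertibility known for the
chosen substitution thus passes to the image under `F` of a constructor in `E`. -/
theorem isIso_of_isPullback {C : Type u} [Category.{v} C] {Y P Z P' P₂ K K' K₂ : C} {π : P ⟶ Y}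
    {m : K ⟶ P} {t : Z ⟶ Y} {u : P' ⟶ P} {v : P' ⟶ Z} {e : K' ⟶ K} {m' : K' ⟶ P'} {u₂ : P₂ ⟶ P}
    {v₂ : P₂ ⟶ Z} {e₂ : K₂ ⟶ K} {m₂ : K₂ ⟶ P₂} (hP : IsPullback u v π t)
    (hK : IsPullback e m' m u) (hP₂ : IsPullback u₂ v₂ π t) (hK₂ : IsPullback e₂ m₂ m u₂)
    [IsIso m₂] : IsIso m' := by
  let φ := hP.isoIsPullback _ _ hP₂
  have hφ : φ.hom ≫ u₂ = u := hP.isoIsPullback_hom_fst _ _ hP₂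
  have w : e ≫ m = (m' ≫ φ.hom) ≫ u₂ := by rw [Category.assoc, hφ, hK.w]
  have h : IsPullback (hK₂.lift e (m' ≫ φ.hom) w) m' m₂ φ.hom :=
    IsPullback.of_right (hK.congr (hK₂.lift_fst _ _ w).symm rfl rfl hφ.symm)
      (hK₂.lift_snd _ _ w) hK₂
  exact h.isIso_snd_of_isIso

/-- A lifting problem against `M.p T` with bottom map `c` is a section problem for the motive
`T[c]`. In this form weakly stable eliminators become a stable lifting property against every type
projection. -/
theorem StableLLP.of_sections {C : Type u} [Category.{v} C] (M : TypeCat.{v, u, w} C) {Y P : C}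
    {ι : Type} {K : ι → C} {π : P ⟶ Y} {m : ∀ k, K k ⟶ P}
    (H : ∀ {Z : C} (t : Z ⟶ Y), ∃ (P' : C) (u : P' ⟶ P) (v : P' ⟶ Z) (_ : IsPullback u v π t)
      (K' : ι → C) (e : ∀ k, K' k ⟶ K k) (m' : ∀ k, K' k ⟶ P')
      (_ : ∀ k, IsPullback (e k) (m' k) (m k) u), ∀ (A : M.Ty P') (d : ∀ k, M.Lift (m' k) A),
      ∃ s : M.Sec A, ∀ k, m' k ≫ s.hom = (d k).hom) {V : C} (T : M.Ty V) :
    StableLLP π m (M.p T) := by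
  refine StableLLP.of_pullback fun t => ?_
  obtain ⟨P', u, v, hP, K', e, m', hK, h⟩ := H t
  refine ⟨P', u, v, hP, K', e, m', hK, fun c d hd => ?_⟩
  obtain ⟨s, hs⟩ := h (M.sub c T) (fun k => ⟨M.pair c T (m' k) (d k) (hd k), by simp⟩)
  refine ⟨s.hom ≫ M.up c T, ?_, fun k => ?_⟩
  · rw [Category.assoc, M.up_p, ← Category.assoc, s.w, Category.id_comp]
  · rw [← Category.assoc, hs, M.pair_up]

section Restricted

variable {C : Type u} [Category.{v} C] {E : Type u} [Category.{v} E] [HasPullbacks E]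
  {F : E ⥤ C} {R : C ⥤ E} {adj : F ⊣ R} {M : TypeCat.{v, u, w} C}

namespace splitCat

/-! ### Eliminators -/

section Elim

variable {Y P : C} {ι : Type} {K : ι → C} (π : P ⟶ Y) (m : ∀ k, K k ⟶ P)

/-- A family `μ` of maps over `Γ` whose image under `F` is the pullback of the family `m`. -/
structure Frame (F : E ⥤ C) {Γ Ψ : E} (v : Ψ ⟶ Γ) {K' : ι → E} (μ : ∀ k, K' k ⟶ Ψ) where
  t : F.obj Γ ⟶ Y
  u : F.obj Ψ ⟶ P
  hP : IsPullback u (F.map v) π t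
  e : ∀ k, F.obj (K' k) ⟶ K k
  hK : ∀ k, IsPullback (e k) (F.map (μ k)) (m k) u

variable {π m}

/-- The lifting problem given by the premises of an elimination rule. -/
noncomputable def Frame.problem {Γ Ψ : E} {v : Ψ ⟶ Γ} {K' : ι → E} {μ : ∀ k, K' k ⟶ Ψ}
    (x : Frame π m F v μ) {V : C} (T : M.Ty V) (c : F.obj Ψ ⟶ V)
    (d : ∀ k, F.obj (K' k) ⟶ M.ext T) (hd : ∀ k, d k ≫ M.p T = F.map (μ k) ≫ c) :
    FillProblem π m (M.p T) where
  t := x.t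
  u := x.u
  v := F.map v
  hP := x.hP
  e := x.e
  m' k := F.map (μ k)
  hK := x.hK
  c := c
  d := d
  hd := hd

variable [HasFiniteLimits C] [HasPushes C] [Finite ι]

/-- The chosen solutions of lifting problems. -/
noncomputable def fill (H : ∀ {V : C} (T : M.Ty V), StableLLP π m (M.p T))
    {V : C} (T : M.Ty V) (x : FillProblem π m (M.p T)) : x.P' ⟶ M.ext T :=
  ((H T).exists_fill).choose x

theorem fill_isSolution (H : ∀ {V : C} (T : M.Ty V), StableLLP π m (M.p T))
    {V : C} (T : M.Ty V) (x : FillProblem π m (M.p T)) : x.IsSolution (fill H T x) :=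
  ((H T).exists_fill).choose_spec.1 x

theorem fill_restr (H : ∀ {V : C} (T : M.Ty V), StableLLP π m (M.p T))
    {V : C} {T : M.Ty V} {x y : FillProblem π m (M.p T)} {r : x.Z ⟶ y.Z} {ρ : x.P' ⟶ y.P'}
    {κ : ∀ k, x.K' k ⟶ y.K' k} (h : FillProblem.Restr x y r ρ κ) :
    fill H T x = ρ ≫ fill H T y :=
  ((H T).exists_fill).choose_spec.2 x y r ρ κ h

variable [PreservesFiniteLimits F] [R.Full] [R.Faithful]
  (H : ∀ {V : C} (T : M.Ty V), StableLLP π m (M.p T))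

variable {Γ Ψ : E} {v : Ψ ⟶ Γ} {K' : ι → E} {μ : ∀ k, K' k ⟶ Ψ} (x : Frame π m F v μ)
  (A : (splitCat adj M).Ty Ψ) (d : ∀ k, (splitCat adj M).Lift (μ k) A)

/-- The lifting problem given by the premises of an elimination rule. -/
noncomputable def elimProblem : FillProblem π m (M.p (top A)) :=
  x.problem (top A) (name A) (fun k => F.map (d k).hom ≫ gen A) (fun k => by
    rw [Category.assoc]
    exact (cls_gen A).map_w (d k))

/-- The chosen eliminator. -/
noncomputable def elimOf : (splitCat adj M).Sec A :=
  (cls_gen A).lift (𝟙 Ψ) (fill H (top A) (elimProblem x A d)) (by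
    refine (fill_isSolution H (top A) (elimProblem x A d)).1.trans ?_
    rw [F.map_id, Category.id_comp]
    rfl)

/-- Both sides are terms of `A` over `μ k`, so their names may be compared; the names agree because
the filler solves its lifting problem. -/
theorem elimOf_comp (k : ι) : μ k ≫ (elimOf H x A d).hom = (d k).hom := by
  let s : (splitCat adj M).Lift (μ k) A :=
    (elimOf H x A d).precomp (μ k) _ (Category.comp_id _)
  suffices s = d k from congrArg TypeCat.Lift.hom this
  apply (cls_gen A).lift_ext
  simp only [s, TypeCat.Lift.precomp, F.map_comp, Category.assoc]
  exact (congrArg (F.map (μ k) ≫ ·) (Cls.map_lift _ _ _ _)).trans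
    ((fill_isSolution H (top A) (elimProblem x A d)).2 k)

/-- The hypotheses say that the second lifting problem is the restriction of the first along `F σ`.
The chosen fillers are natural in restrictions, and names determine terms. -/
theorem elimOf_sub {Θ Ψ' : E} {v' : Ψ' ⟶ Θ} {K'' : ι → E} {μ' : ∀ k, K'' k ⟶ Ψ'}
    (x' : Frame π m F v' μ') (σ : Θ ⟶ Γ) (δ : Ψ' ⟶ Ψ) (κ : ∀ k, K'' k ⟶ K' k)
    (ht : F.map σ ≫ x.t = x'.t) (hu : F.map δ ≫ x.u = x'.u) (hv : δ ≫ v = v' ≫ σ)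
    (he : ∀ k, F.map (κ k) ≫ x.e k = x'.e k) (hμ : ∀ k, κ k ≫ μ k = μ' k ≫ δ)
    (d' : ∀ k, (splitCat adj M).Lift (μ' k) ((splitCat adj M).sub δ A))
    (hd' : ∀ k, (d' k).hom ≫ (splitCat adj M).up δ A = κ k ≫ (d k).hom) :
    elimOf H x' ((splitCat adj M).sub δ A) d' = (elimOf H x A d).sub δ := by
  apply (cls_gen ((splitCat adj M).sub δ A)).lift_ext
  have e₁ : FillProblem.Restr (elimProblem x' ((splitCat adj M).sub δ A) d') (elimProblem x A d)
      (F.map σ) (F.map δ) (fun k => F.map (κ k)) := by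
    refine ⟨ht, hu, ?_, he, fun k => ?_, rfl, fun k => ?_⟩
    · exact (F.map_comp _ _).symm.trans ((congrArg F.map hv).trans (F.map_comp _ _))
    · exact (F.map_comp _ _).symm.trans ((congrArg F.map (hμ k)).trans (F.map_comp _ _))
    · refine (congrArg (F.map (d' k).hom ≫ ·) (gen_sub δ A)).trans ?_
      refine (Category.assoc _ _ _).symm.trans ?_
      refine (congrArg (· ≫ gen A) ((F.map_comp _ _).symm.trans
        ((congrArg F.map (hd' k)).trans (F.map_comp _ _)))).trans (Category.assoc _ _ _)
  refine (Cls.map_lift _ _ _ _).trans ((fill_restr H e₁).trans ?_)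
  refine Eq.trans ?_ (congrArg (F.map _ ≫ ·) (gen_sub δ A)).symm
  refine Eq.trans ?_ (map_secSub _ _).symm
  exact congrArg (F.map δ ≫ ·) (Cls.map_lift _ _ _ _).symm

end Elim

end splitCat

end Restricted

section Restricted

variable {C : Type u} [Category.{v} C] {E : Type u} [Category.{v} E] [HasPullbacks E]
  {F : E ⥤ C} {R : C ⥤ E} {adj : F ⊣ R} {M : TypeCat.{v, u, w} C}

/-- A universe of names of families: of a name of a type `T`, and a map into `V'` that depends on
a variable of that type. -/
structure FamilyUniverse {V : C} (T : M.Ty V) (V' : C) where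
  W : C
  π : W ⟶ V
  ev : M.ext (M.sub π T) ⟶ V'
  existsUnique : ∀ {Z Q : C} {n : Z ⟶ V} {g : Q ⟶ M.ext T} {r : Q ⟶ Z}
    (_ : IsPullback g r (M.p T) n) (k : Q ⟶ V'), ∃! χ : Z ⟶ W, χ ≫ π = n ∧
      ∃ α : Q ⟶ M.ext (M.sub π T), α ≫ M.up π T = g ∧ α ≫ M.p (M.sub π T) = r ≫ χ ∧ α ≫ ev = k

/-- The universe is the pushforward along `M.p T` of the constant family with value `V'`, its
evaluation moved to the comprehension of `T[π]`. -/
theorem HasPushes.nonempty_familyUniverse [HasFiniteLimits C] [HasPushes C] {V : C}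
    (T : M.Ty V) (V' : C) : Nonempty (FamilyUniverse T V') := by
  obtain ⟨W, P, π, a, b, ev, h⟩ := HasPushes.exists_isPush (prod.fst : M.ext T ⨯ V' ⟶ M.ext T) (M.p T)
  obtain ⟨ev', h'⟩ := h.of_isPullback (M.isPullback π T)
  refine ⟨⟨W, π, ev' ≫ prod.snd, fun {Z Q n g r} hQ k => ?_⟩⟩
  obtain ⟨χ, ⟨hχ, α, h₁, h₂, h₃⟩, hu⟩ := h'.existsUnique hQ (prod.lift g k) (prod.lift_fst _ _)
  refine ⟨χ, ⟨hχ, α, h₁, h₂, by rw [reassoc_of% h₃, prod.lift_snd]⟩, ?_⟩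
  rintro χ' ⟨hχ', α', h₁', h₂', h₃'⟩
  refine hu χ' ⟨hχ', α', h₁', h₂', ?_⟩
  apply Limits.prod.hom_ext
  · rw [Category.assoc, h'.ev_q, h₁', prod.lift_fst]
  · rw [Category.assoc, h₃', prod.lift_snd]

namespace splitCat

section Family

variable [HasFiniteLimits C] [HasPushes C]

/-- The chosen universe of names of families. -/
noncomputable def famU {V : C} (T : M.Ty V) (V' : C) : FamilyUniverse T V' :=
  (HasPushes.nonempty_familyUniverse T V').some

/-- The generic domain of a family. -/
noncomputable abbrev famDom {V : C} (T : M.Ty V) (V' : C) : M.Ty (famU T V').W :=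
  M.sub (famU T V').π T

/-- The generic family. -/
noncomputable abbrev famCod {V V' : C} (T : M.Ty V) (T' : M.Ty V') : M.Ty (M.ext (famDom T V')) :=
  M.sub (famU T V').ev T'

variable [PreservesFiniteLimits F] [R.Full] [R.Faithful] {Γ : E} (A : (splitCat adj M).Ty Γ)
  (B : (splitCat adj M).Ty ((splitCat adj M).ext A))

/-- The name of a family. -/
noncomputable def famName : F.obj Γ ⟶ (famU (top A) (base B)).W :=
  ((famU (top A) (base B)).existsUnique (cls_gen A) (name B)).choose

theorem famName_π : famName A B ≫ (famU (top A) (base B)).π = name A :=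
  ((famU (top A) (base B)).existsUnique (cls_gen A) (name B)).choose_spec.1.1

/-- The generic term of the domain of a family. -/
noncomputable def famGen : F.obj ((splitCat adj M).ext A) ⟶ M.ext (famDom (top A) (base B)) :=
  ((famU (top A) (base B)).existsUnique (cls_gen A) (name B)).choose_spec.1.2.choose

theorem famGen_up : famGen A B ≫ M.up (famU (top A) (base B)).π (top A) = gen A :=
  ((famU (top A) (base B)).existsUnique (cls_gen A) (name B)).choose_spec.1.2.choose_spec.1

theorem famGen_p : famGen A B ≫ M.p (famDom (top A) (base B))
    = F.map ((splitCat adj M).p A) ≫ famName A B :=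
  ((famU (top A) (base B)).existsUnique (cls_gen A) (name B)).choose_spec.1.2.choose_spec.2.1

theorem famGen_ev : famGen A B ≫ (famU (top A) (base B)).ev = name B :=
  ((famU (top A) (base B)).existsUnique (cls_gen A) (name B)).choose_spec.1.2.choose_spec.2.2

theorem famName_unique {χ : F.obj Γ ⟶ (famU (top A) (base B)).W}
    (α : F.obj ((splitCat adj M).ext A) ⟶ M.ext (famDom (top A) (base B)))
    (h₁ : χ ≫ (famU (top A) (base B)).π = name A)
    (h₂ : α ≫ M.up (famU (top A) (base B)).π (top A) = gen A)
    (h₃ : α ≫ M.p (famDom (top A) (base B)) = F.map ((splitCat adj M).p A) ≫ χ)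
    (h₄ : α ≫ (famU (top A) (base B)).ev = name B) : famName A B = χ :=
  (((famU (top A) (base B)).existsUnique (cls_gen A) (name B)).choose_spec.2 χ
    ⟨h₁, α, h₂, h₃, h₄⟩).symm

theorem cls_famGen :
    Cls adj A (famDom (top A) (base B)) (famName A B) (famGen A B) := by
  refine IsPullback.of_right ?_ (famGen_p A B) (M.isPullback _ _)
  rw [famGen_up, famName_π]
  exact cls_gen A

/-- The generic term of a family. -/
noncomputable def famGen' : F.obj ((splitCat adj M).ext B) ⟶ M.ext (famCod (top A) (top B)) :=
  M.pair (famU (top A) (base B)).ev (top B) (F.map ((splitCat adj M).p B) ≫ famGen A B)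
    (gen B) (by rw [Category.assoc, famGen_ev]; exact (cls_gen B).w)

theorem famGen'_p : famGen' A B ≫ M.p (famCod (top A) (top B))
    = F.map ((splitCat adj M).p B) ≫ famGen A B := M.pair_p _ _ _ _ _

theorem famGen'_up : famGen' A B ≫ M.up (famU (top A) (base B)).ev (top B) = gen B :=
  M.pair_up _ _ _ _ _

theorem cls_famGen' : Cls adj B (famCod (top A) (top B)) (famGen A B) (famGen' A B) := by
  refine IsPullback.of_right ?_ (famGen'_p A B) (M.isPullback _ _)
  rw [famGen'_up, famGen_ev]
  exact cls_gen B

variable {Θ : E} (σ : Θ ⟶ Γ)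

/-- The universe depends only on `top A` and `base B`, which substitution leaves unchanged, and the
composite with `F σ` classifies the substituted family. Uniqueness of the classifying map turns
stability up to isomorphism into equality. -/
theorem famName_sub :
    famName ((splitCat adj M).sub σ A) ((splitCat adj M).sub ((splitCat adj M).up σ A) B)
      = F.map σ ≫ famName A B := by
  refine famName_unique ((splitCat adj M).sub σ A)
    ((splitCat adj M).sub ((splitCat adj M).up σ A) B)
    (F.map ((splitCat adj M).up σ A) ≫ famGen A B) ?_ ?_ ?_ ?_
  · exact (Category.assoc _ _ _).trans (congrArg (F.map σ ≫ ·) (famName_π A B))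
  · exact (Category.assoc _ _ _).trans ((congrArg (F.map _ ≫ ·) (famGen_up A B)).trans
      (gen_sub σ A).symm)
  · exact ((cls_famGen A B).sub σ).w
  · exact (Category.assoc _ _ _).trans (congrArg (F.map _ ≫ ·) (famGen_ev A B))

theorem famGen_sub :
    famGen ((splitCat adj M).sub σ A) ((splitCat adj M).sub ((splitCat adj M).up σ A) B)
      = F.map ((splitCat adj M).up σ A) ≫ famGen A B := by
  apply M.hom_ext
  · refine (famGen_p _ _).trans ?_
    rw [famName_sub]
    exact ((cls_famGen A B).sub σ).w.symm
  · refine (famGen_up _ _).trans ?_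
    refine (gen_sub σ A).trans ?_
    exact ((Category.assoc _ _ _).trans (congrArg (F.map _ ≫ ·) (famGen_up A B))).symm

theorem famGen'_sub :
    famGen' ((splitCat adj M).sub σ A) ((splitCat adj M).sub ((splitCat adj M).up σ A) B)
      = F.map ((splitCat adj M).up ((splitCat adj M).up σ A) B) ≫ famGen' A B := by
  apply M.hom_ext
  · refine (famGen'_p _ _).trans ?_
    refine (congrArg (F.map _ ≫ ·) (famGen_sub A B σ)).trans ?_
    exact ((cls_famGen' A B).sub ((splitCat adj M).up σ A)).w.symm
  · refine (famGen'_up _ _).trans ?_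
    refine (gen_sub ((splitCat adj M).up σ A) B).trans ?_
    exact ((Category.assoc _ _ _).trans (congrArg (F.map _ ≫ ·) (famGen'_up A B))).symm

end Family

/-! ### Dependent sums -/

section Sigma

variable [PreservesFiniteLimits F] [R.Full] [R.Faithful] {Y : C} {a : M.Ty Y} {b : M.Ty (M.ext a)}
  (X : M.SigmaData a b) {Γ : E} {A : (splitCat adj M).Ty Γ}
  {B : (splitCat adj M).Ty ((splitCat adj M).ext A)} {χ : F.obj Γ ⟶ Y}
  {α : F.obj ((splitCat adj M).ext A) ⟶ M.ext a} {β : F.obj ((splitCat adj M).ext B) ⟶ M.ext b}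

/-- The dependent sum classified by a given one. -/
noncomputable def mkSigma (hA : Cls adj A a χ α) (hB : Cls adj B b α β) :
    (splitCat adj M).SigmaData A B where
  ty := mk X.ty χ
  tm := mkLift _ (β ≫ X.tm.hom) (by
    rw [Category.assoc, X.tm.w, ← Category.assoc, hB.w, Category.assoc, hA.w, F.map_comp,
      Category.assoc])

theorem mkSigma_reindex (hA : Cls adj A a χ α) (hB : Cls adj B b α β) {Θ : E} (σ : Θ ⟶ Γ) :
    (mkSigma X hA hB).reindex σ = mkSigma X (hA.sub σ) (hB.sub _) := by
  refine TypeCat.SigmaData.ext rfl (heq_of_eq ?_)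
  dsimp only [TypeCat.SigmaData.reindex, mkSigma]
  exact reindex_mkLift _ _ _ _ _ _ _ _ (Category.assoc _ _ _) _

/-- The classifying squares are propositions, so the result depends on the three names only. -/
theorem mkSigma_congr {χ' α' β'} (hA : Cls adj A a χ α) (hB : Cls adj B b α β)
    (hA' : Cls adj A a χ' α') (hB' : Cls adj B b α' β') (e₁ : χ = χ') (e₂ : α = α') (e₃ : β = β') :
    mkSigma X hA hB = mkSigma X hA' hB' := by
  subst e₁ e₂ e₃
  rfl

/-- The two classifying squares paste to the outer rectangle, and the square of the sum type
cancels. Hence `F` sends pairing in `E` to a base change of the given pairing, as a lifting problem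
requires. -/
theorem mkSigma_isPullback (hA : Cls adj A a χ α) (hB : Cls adj B b α β)
    {X₀ : (splitCat adj M).SigmaData A B} (hX : X₀ = mkSigma X hA hB) :
    IsPullback β (F.map X₀.tm.hom) X.tm.hom (genOf (congrArg TypeCat.SigmaData.ty hX)) := by
  refine IsPullback.of_bot ?_ ?_ (cls_genOf (congrArg TypeCat.SigmaData.ty hX))
  · exact (hB.paste_vert hA).congr rfl ((F.map_comp _ _).symm.trans
      ((congrArg F.map X₀.tm.w).trans (F.map_comp _ _))).symm X.tm.w.symm rfl
  · subst hX
    dsimp only [mkSigma]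
    exact (map_mkLift_genOf _ _ _ _).symm

/-- The premises of the elimination rule. -/
noncomputable def sigmaFrame (hA : Cls adj A a χ α) (hB : Cls adj B b α β)
    {X₀ : (splitCat adj M).SigmaData A B} (hX : X₀ = mkSigma X hA hB) :
    Frame (M.p X.ty) (fun _ : Unit => X.tm.hom) F ((splitCat adj M).p X₀.ty)
      (fun _ : Unit => X₀.tm.hom) where
  t := χ
  u := genOf (congrArg TypeCat.SigmaData.ty hX)
  hP := cls_genOf _
  e _ := β
  hK _ := mkSigma_isPullback X hA hB hX

-- The pairing of the reindexed sum is the base change of the pairing, so the eliminators after all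
-- reindexings amount to a stable lifting property.
omit [PreservesFiniteLimits F] [R.Full] [R.Faithful] in
theorem stableLLP_sigma (hX : ∀ {Θ : C} (σ : Θ ⟶ Y), (X.reindex σ).IsSigma) {V : C} (T : M.Ty V) :
    StableLLP (M.p X.ty) (fun _ : Unit => X.tm.hom) (M.p T) := by
  refine StableLLP.of_sections M (fun t => ⟨_, _, _, M.isPullback t X.ty, _,
    fun _ => M.up (M.up t a) b, fun _ => (X.reindex t).tm.hom, fun _ => ?_, fun A d => ?_⟩) T
  · exact X.tm.isPullback_reindex ((M.isPullback _ _).paste_vert (M.isPullback _ _))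
  · obtain ⟨s, hs⟩ := hX t A (d ())
    exact ⟨s, fun _ => hs⟩

variable [HasFiniteLimits C] [HasPushes C]

section

variable (S : ∀ {Γ : C} (A : M.Ty Γ) (B : M.Ty (M.ext A)), M.SigmaData A B)

/-- The chosen dependent sum. -/
noncomputable def formSigma {Γ : E} (A : (splitCat adj M).Ty Γ)
    (B : (splitCat adj M).Ty ((splitCat adj M).ext A)) : (splitCat adj M).SigmaData A B :=
  mkSigma (S (famDom (top A) (base B)) (famCod (top A) (top B))) (cls_famGen A B)
    (cls_famGen' A B)

theorem formSigma_sub {Θ Γ : E} (σ : Θ ⟶ Γ) (A : (splitCat adj M).Ty Γ)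
    (B : (splitCat adj M).Ty ((splitCat adj M).ext A)) :
    formSigma S ((splitCat adj M).sub σ A) ((splitCat adj M).sub ((splitCat adj M).up σ A) B)
      = (formSigma S A B).reindex σ := by
  refine Eq.trans ?_ (mkSigma_reindex _ _ _ σ).symm
  exact mkSigma_congr _ _ _ _ _ (famName_sub A B σ) (famGen_sub A B σ)
    (famGen'_sub A B σ)

end

theorem strictSigma (h : M.WeakSigma) : Nonempty (splitCat adj M).StrictSigma := by
  choose S hS using @h
  exact ⟨{
    form := formSigma S
    form_sub := formSigma_sub S
    elim := @fun Γ A B X₀ hX A d => elimOf (stableLLP_sigma _ (hS _ _)) (sigmaFrame _ _ _ hX) A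
      (fun _ => d)
    comp := @fun Γ A B X₀ hX A d => elimOf_comp _ _ A (fun _ => d) ()
    elim_sub := @fun Θ Γ σ A B X₀ hX hX' A' d => by
      -- The names of the family and of its generic terms are natural in `σ`, so the second frame
      -- restricts from the first.
      refine elimOf_sub (stableLLP_sigma _ (hS _ _)) (sigmaFrame _ _ _ hX) A' (fun _ => d)
        (sigmaFrame _ _ _ hX') σ ((splitCat adj M).up σ X₀.ty)
        (fun _ => (splitCat adj M).up ((splitCat adj M).up σ A) B)
        (famName_sub A B σ).symm (genOf_sub (congrArg TypeCat.SigmaData.ty hX) σ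
          (congrArg TypeCat.SigmaData.ty hX')) (TypeCat.up_p _ _ _)
        (fun _ => (famGen'_sub A B σ).symm) (fun _ => ?_) (fun _ => d.reindex _ _ _ _)
        (fun _ => ?_)
      · exact ((splitCat adj M).pair_up _ _ _ _ _).symm
      · exact (splitCat adj M).pair_up _ _ _ _ _ }⟩

/-- `F` sends pairing to a base change along the name `famName A B` of the pairing of the generic
sum, invertible by weak stability. Source and target are local over `Γ`, so pairing is itself
invertible. -/
theorem strictSigmaEta (h : M.WeakSigmaEta) : Nonempty (splitCat adj M).StrictSigmaEta := by
  choose S hS using @h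
  refine ⟨⟨formSigma S, formSigma_sub S, fun {Γ} A B => ?_⟩⟩
  have sq := mkSigma_isPullback (S (famDom (top A) (base B)) (famCod (top A) (top B)))
    (cls_famGen A B) (cls_famGen' A B) rfl
  have := hS (famDom (top A) (base B)) (famCod (top A) (top B)) (famName A B)
  have : IsIso (F.map (formSigma S A B).tm.hom) := isIso_of_isPullback
    (m₂ := ((S (famDom (top A) (base B)) (famCod (top A) (top B))).reindex (famName A B)).tm.hom)
    (cls_genOf rfl) sq (M.isPullback _ _)
    ((S (famDom (top A) (base B)) (famCod (top A) (top B))).tm.isPullback_reindex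
      ((M.isPullback _ _).paste_vert (M.isPullback _ _)))
  exact ((isLocalMap_p B).comp (isLocalMap_p A)).isIso (isLocalMap_p _) _ (formSigma S A B).tm.w

end Sigma

end splitCat

end Restricted

/-! ### Base change of weakenings and diagonals -/

namespace TypeCat

variable {D : Type u} [Category.{v} D] (M : TypeCat.{v, u, w} D)

theorem isPullback_up₂ {X Γ X' Θ : D} (f : X ⟶ Γ) (A : M.Ty Γ) (σ : Θ ⟶ Γ) (t : X' ⟶ X)
    (f' : X' ⟶ Θ) (h : t ≫ f = f' ≫ σ) :
    IsPullback (M.up₂ f A σ t f' h) (M.p (M.sub f' (M.sub σ A))) (M.p (M.sub f A)) t := by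
  refine IsPullback.of_right ?_ (by simp [up₂]) (M.isPullback f A)
  exact ((M.isPullback f' (M.sub σ A)).paste_horiz (M.isPullback σ A)).congr
    (M.pair_up _ _ _ _ _).symm rfl rfl h.symm

theorem diag_p {Γ : D} (A : M.Ty Γ) : M.diag A ≫ M.p (M.sub (M.p A) A) = 𝟙 _ := M.pair_p _ _ _ _ _

theorem diag_up {Γ : D} (A : M.Ty Γ) : M.diag A ≫ M.up (M.p A) A = 𝟙 _ := M.pair_up _ _ _ _ _

/-- The diagonal is a section of the projection from the weakened comprehension, so the square is
obtained by cancelling the base change square of that projection from an identity square. -/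
theorem isPullback_diag {Θ Γ : D} (σ : Θ ⟶ Γ) (A : M.Ty Γ) :
    IsPullback (M.up σ A) (M.diag (M.sub σ A)) (M.diag A) (M.upDiag σ A) := by
  refine IsPullback.of_bot ?_ ?_ (M.isPullback_up₂ (M.p A) A σ (M.up σ A) (M.p _) (M.up_p σ A))
  · rw [diag_p, diag_p]
    exact IsPullback.id_vert _
  · apply M.hom_ext
    · simp [diag, upDiag, up₂]
    · simp [diag, upDiag, up₂]

theorem upDiag_p {Θ Γ : D} (σ : Θ ⟶ Γ) (A : M.Ty Γ) :
    M.upDiag σ A ≫ M.p (M.sub (M.p A) A) = M.p (M.sub (M.p (M.sub σ A)) (M.sub σ A)) ≫ M.up σ A :=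
  M.pair_p _ _ _ _ _

theorem up_upDiag_p {Θ Γ : D} (σ : Θ ⟶ Γ) (A : M.Ty Γ) (T : M.Ty (M.ext (M.sub (M.p A) A))) :
    M.up (M.upDiag σ A) T ≫ M.p T ≫ M.p (M.sub (M.p A) A) ≫ M.p A
      = (M.p (M.sub (M.upDiag σ A) T) ≫ M.p (M.sub (M.p (M.sub σ A)) (M.sub σ A)) ≫
        M.p (M.sub σ A)) ≫ σ := by
  rw [← Category.assoc, up_p, Category.assoc, ← Category.assoc (M.upDiag σ A), upDiag_p]
  simp only [Category.assoc, up_p]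

end TypeCat

section Restricted

variable {C : Type u} [Category.{v} C] {E : Type u} [Category.{v} E] [HasPullbacks E]
  {F : E ⥤ C} {R : C ⥤ E} {adj : F ⊣ R} {M : TypeCat.{v, u, w} C}

namespace splitCat

/-! ### Identity types -/

section Weaken

variable {Y : C} {a b : M.Ty Y} {Γ : E} {A B : (splitCat adj M).Ty Γ} {χ : F.obj Γ ⟶ Y}
  {α : F.obj ((splitCat adj M).ext A) ⟶ M.ext a} {β : F.obj ((splitCat adj M).ext B) ⟶ M.ext b}

/-- The generic term of a weakened type. -/
noncomputable def weakGen [PreservesFiniteLimits F] (hA : Cls adj A a χ α) (hB : Cls adj B b χ β) :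
    F.obj ((splitCat adj M).ext ((splitCat adj M).sub ((splitCat adj M).p A) B)) ⟶
      M.ext (M.sub (M.p a) b) :=
  M.pair (M.p a) b (F.map ((splitCat adj M).p _) ≫ α)
    (F.map ((splitCat adj M).up ((splitCat adj M).p A) B) ≫ β) 
    ((hB.sub ((splitCat adj M).p A)).w.trans ((congrArg (F.map _ ≫ ·) hA.w.symm).trans
      (Category.assoc _ _ _).symm))

variable [PreservesFiniteLimits F] (hA : Cls adj A a χ α) (hB : Cls adj B b χ β)

theorem weakGen_p : weakGen hA hB ≫ M.p (M.sub (M.p a) b)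
    = F.map ((splitCat adj M).p ((splitCat adj M).sub ((splitCat adj M).p A) B)) ≫ α :=
  M.pair_p _ _ _ _ _

theorem weakGen_up : weakGen hA hB ≫ M.up (M.p a) b
    = F.map ((splitCat adj M).up ((splitCat adj M).p A) B) ≫ β :=
  M.pair_up _ _ _ _ _

theorem weakGen_congr {χ' α' β'} (hA : Cls adj A a χ α) (hB : Cls adj B b χ β)
    (hA' : Cls adj A a χ' α') (hB' : Cls adj B b χ' β') (e₁ : χ = χ') (e₂ : α = α')
    (e₃ : β = β') : weakGen hA hB = weakGen hA' hB' := by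
  subst e₁ e₂ e₃
  rfl

/-- The weakened type in `E`, classified through `B`, is the composite of this square with the
substitution square of `b` along `M.p a`; the latter cancels. -/
theorem cls_weakGen : Cls adj ((splitCat adj M).sub ((splitCat adj M).p A) B) (M.sub (M.p a) b) α
    (weakGen hA hB) := by
  refine IsPullback.of_right ?_ (weakGen_p hA hB) (M.isPullback _ _)
  exact (hB.sub ((splitCat adj M).p A)).congr (weakGen_up hA hB).symm rfl rfl hA.w.symm

theorem weakGen_sub {Θ : E} (σ : Θ ⟶ Γ) :
    weakGen (hA.sub σ) (hB.sub σ) = F.map ((splitCat adj M).up₂ ((splitCat adj M).p A) B σ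
      ((splitCat adj M).up σ A) ((splitCat adj M).p _) ((splitCat adj M).up_p σ A)) ≫
        weakGen hA hB := by
  apply M.hom_ext
  · rw [weakGen_p, Category.assoc, weakGen_p, ← Category.assoc, ← Category.assoc, ← F.map_comp,
      ← F.map_comp, TypeCat.up₂, TypeCat.pair_p]
  · rw [weakGen_up, Category.assoc, weakGen_up, ← Category.assoc, ← Category.assoc, ← F.map_comp,
      ← F.map_comp, TypeCat.up₂, TypeCat.pair_up]

theorem map_diag_weakGen :
    F.map ((splitCat adj M).diag A) ≫ weakGen hA hA = α ≫ M.diag a := by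
  apply M.hom_ext
  · rw [Category.assoc, weakGen_p, Category.assoc, M.diag_p, ← Category.assoc, ← F.map_comp,
      TypeCat.diag_p, F.map_id, Category.id_comp, Category.comp_id]
  · rw [Category.assoc, weakGen_up, Category.assoc, M.diag_up, ← Category.assoc, ← F.map_comp,
      TypeCat.diag_up, F.map_id, Category.id_comp, Category.comp_id]

end Weaken

section Id

variable [PreservesFiniteLimits F] [R.Full] [R.Faithful] {Y : C} {a : M.Ty Y}
  (X : M.IdData a) {Γ : E} {A : (splitCat adj M).Ty Γ} {χ : F.obj Γ ⟶ Y}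
  {α : F.obj ((splitCat adj M).ext A) ⟶ M.ext a}

/-- The identity type classified by a given one. -/
noncomputable def mkId
    (δ : F.obj ((splitCat adj M).ext ((splitCat adj M).sub ((splitCat adj M).p A) A)) ⟶
      M.ext (M.sub (M.p a) a))
    (hδ : F.map ((splitCat adj M).diag A) ≫ δ = α ≫ M.diag a) : (splitCat adj M).IdData A where
  ty := mk X.ty δ
  refl := mkLift _ (α ≫ X.refl.hom) (by rw [Category.assoc, X.refl.w, hδ])

theorem mkId_reindex
    (δ : F.obj ((splitCat adj M).ext ((splitCat adj M).sub ((splitCat adj M).p A) A)) ⟶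
      M.ext (M.sub (M.p a) a))
    (hδ : F.map ((splitCat adj M).diag A) ≫ δ = α ≫ M.diag a) {Θ : E} (σ : Θ ⟶ Γ)
    (hδ' : F.map ((splitCat adj M).diag ((splitCat adj M).sub σ A)) ≫
      F.map ((splitCat adj M).upDiag σ A) ≫ δ
        = (F.map ((splitCat adj M).up σ A) ≫ α) ≫ M.diag a) :
    (mkId X δ hδ).reindex σ = mkId X (F.map ((splitCat adj M).upDiag σ A) ≫ δ) hδ' := by
  refine TypeCat.IdData.ext rfl (heq_of_eq ?_)
  dsimp only [TypeCat.IdData.reindex, mkId]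
  exact reindex_mkLift _ _ _ _ _ _ _ _ (Category.assoc _ _ _) _

theorem mkId_congr {α' δ δ'} (hδ : F.map ((splitCat adj M).diag A) ≫ δ = α ≫ M.diag a)
    (hδ' : F.map ((splitCat adj M).diag A) ≫ δ' = α' ≫ M.diag a) (e₁ : α = α') (e₂ : δ = δ') :
    mkId X δ hδ = mkId X δ' hδ' := by
  subst e₁ e₂
  rfl

/-- The image under `F` of the diagonal is a base change of the diagonal of `a`, being a section of
a classified projection; cancelling the square of the identity type leaves reflexivity. -/
theorem mkId_isPullback (hA : Cls adj A a χ α) {X₀ : (splitCat adj M).IdData A}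
    (hX : X₀ = mkId X (weakGen hA hA) (map_diag_weakGen hA)) :
    IsPullback α (F.map X₀.refl.hom) X.refl.hom (genOf (congrArg TypeCat.IdData.ty hX)) := by
  refine IsPullback.of_bot ?_ ?_ (cls_genOf (congrArg TypeCat.IdData.ty hX))
  · have sq : IsPullback α (F.map ((splitCat adj M).diag A)) (M.diag a) (weakGen hA hA) := by
      refine IsPullback.of_bot ?_ (map_diag_weakGen hA).symm (cls_weakGen hA hA)
      exact (IsPullback.id_vert α).congr rfl (by
        rw [← F.map_comp, TypeCat.diag_p, F.map_id]) (M.diag_p a).symm rfl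
    exact sq.congr rfl ((F.map_comp _ _).symm.trans (congrArg F.map X₀.refl.w)).symm
      X.refl.w.symm rfl
  · subst hX
    dsimp only [mkId]
    exact (map_mkLift_genOf _ _ _ _).symm

/-- The premises of the elimination rule. -/
noncomputable def idFrame (hA : Cls adj A a χ α) {X₀ : (splitCat adj M).IdData A}
    (hX : X₀ = mkId X (weakGen hA hA) (map_diag_weakGen hA)) :
    Frame (M.p X.ty ≫ M.p (M.sub (M.p a) a) ≫ M.p a) (fun _ : Unit => X.refl.hom) F
      ((splitCat adj M).p X₀.ty ≫ (splitCat adj M).p ((splitCat adj M).sub _ A) ≫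
        (splitCat adj M).p A)
      (fun _ : Unit => X₀.refl.hom) where
  t := χ
  u := genOf (congrArg TypeCat.IdData.ty hX)
  hP := ((cls_genOf (congrArg TypeCat.IdData.ty hX)).paste_vert
    ((cls_weakGen hA hA).paste_vert hA)).congr rfl (by simp only [F.map_comp]) rfl rfl
  e _ := α
  hK _ := mkId_isPullback X hA hX

-- The base is `Y` and not the context of two variables of type `a`: weak stability gives
-- eliminators after substitution in the context of `a` only. So the total object is the whole
-- telescope over `Y`.
omit [PreservesFiniteLimits F] [R.Full] [R.Faithful] in
theorem stableLLP_id (hX : ∀ {Θ : C} (σ : Θ ⟶ Y), (X.reindex σ).IsId) {V : C} (T : M.Ty V) :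
    StableLLP (M.p X.ty ≫ M.p (M.sub (M.p a) a) ≫ M.p a) (fun _ : Unit => X.refl.hom)
      (M.p T) := by
  refine StableLLP.of_sections M (fun t => ⟨_, _, _, (M.isPullback (M.upDiag t a) X.ty).paste_vert
    ((M.isPullback_up₂ _ _ _ _ _ _).paste_vert (M.isPullback t a)), _,
    fun _ => M.up t a, fun _ => (X.reindex t).refl.hom, fun _ => ?_, fun A d => ?_⟩) T
  · exact X.refl.isPullback_reindex (M.isPullback_diag t a)
  · obtain ⟨s, hs⟩ := hX t A (d ())
    exact ⟨s, fun _ => hs⟩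

section

variable (S : ∀ {Γ : C} (A : M.Ty Γ), M.IdData A)

/-- The chosen identity type. -/
noncomputable def formId {Γ : E} (A : (splitCat adj M).Ty Γ) : (splitCat adj M).IdData A :=
  mkId (S (top A)) (weakGen (cls_gen A) (cls_gen A)) (map_diag_weakGen (cls_gen A))

/-- The only premise is `A`, so its own local universe suffices. Strictness reduces to naturality of
the generic term of the twice extended context. -/
theorem formId_sub {Θ Γ : E} (σ : Θ ⟶ Γ) (A : (splitCat adj M).Ty Γ) :
    formId S ((splitCat adj M).sub σ A) = (formId S A).reindex σ := by
  have e : weakGen (cls_gen ((splitCat adj M).sub σ A)) (cls_gen ((splitCat adj M).sub σ A))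
      = F.map ((splitCat adj M).upDiag σ A) ≫ weakGen (cls_gen A) (cls_gen A) := by
    exact (weakGen_congr _ _ _ _ rfl (gen_sub σ A) (gen_sub σ A)).trans
      (weakGen_sub (cls_gen A) (cls_gen A) σ)
  have e₁ : F.map ((splitCat adj M).diag ((splitCat adj M).sub σ A)) ≫
      F.map ((splitCat adj M).upDiag σ A) ≫ weakGen (cls_gen A) (cls_gen A)
        = (F.map ((splitCat adj M).up σ A) ≫ gen A) ≫ M.diag (top A) := by
    rw [← e]
    refine (map_diag_weakGen (cls_gen ((splitCat adj M).sub σ A))).trans ?_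
    exact congrArg (· ≫ M.diag (top A)) (gen_sub σ A)
  refine Eq.trans ?_ (mkId_reindex _ _ _ σ e₁).symm
  exact mkId_congr _ _ _ (gen_sub σ A) e

end

variable [HasFiniteLimits C] [HasPushes C]

theorem strictId (h : M.WeakId) : Nonempty (splitCat adj M).StrictId := by
  choose S hS using @h
  exact ⟨{
    form := formId S
    form_sub := formId_sub S
    elim := @fun Γ A X₀ hX A' d => elimOf (stableLLP_id _ (hS _)) (idFrame _ (cls_gen A) hX) A'
      (fun _ => d)
    comp := @fun Γ A X₀ hX A' d => elimOf_comp _ _ A' (fun _ => d) ()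
    elim_sub := @fun Θ Γ σ A X₀ hX hX' A' d => by
      refine elimOf_sub (stableLLP_id _ (hS _)) (idFrame _ (cls_gen A) hX) A' (fun _ => d)
        (idFrame _ (cls_gen ((splitCat adj M).sub σ A)) hX') σ
        ((splitCat adj M).up ((splitCat adj M).upDiag σ A) X₀.ty)
        (fun _ => (splitCat adj M).up σ A) rfl
        (genOf_sub (congrArg TypeCat.IdData.ty hX) ((splitCat adj M).upDiag σ A)
          (congrArg TypeCat.IdData.ty hX')) ?_
        (fun _ => (gen_sub σ A).symm) (fun _ => ?_) (fun _ => d.reindex _ _ _ _)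
        (fun _ => ?_)
      · exact (splitCat adj M).up_upDiag_p σ A X₀.ty
      · exact ((splitCat adj M).pair_up _ _ _ _ _).symm
      · exact (splitCat adj M).pair_up _ _ _ _ _ }⟩

-- Seen over `Γ`, reflexivity goes from `Γ ▷ A` to the telescope ending in the identity type, both
-- local over `Γ`, and `F` sends it to a base change of an invertible map. The formation uses no
-- family universe and there is no eliminator to choose, so pushforwards play no role.
omit [HasFiniteLimits C] [HasPushes C] in
theorem strictIdExt (h : M.WeakIdExt) : Nonempty (splitCat adj M).StrictIdExt := by
  choose S hS using @h
  refine ⟨⟨formId S, formId_sub S, fun {Γ} A => ?_⟩⟩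
  have := hS (top A) (name A)
  have : IsIso (F.map (formId S A).refl.hom) := isIso_of_isPullback
    (m₂ := ((S (top A)).reindex (name A)).refl.hom)
    (idFrame (S (top A)) (cls_gen A) rfl).hP (mkId_isPullback (S (top A)) (cls_gen A) rfl)
    ((M.isPullback (M.upDiag (name A) (top A)) (S (top A)).ty).paste_vert
      ((M.isPullback_up₂ _ _ _ _ _ _).paste_vert (M.isPullback (name A) (top A))))
    ((S (top A)).refl.isPullback_reindex (M.isPullback_diag (name A) (top A)))
  refine (isLocalMap_p A).isIso ((isLocalMap_p (formId S A).ty).comp ((isLocalMap_p _).comp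
    (isLocalMap_p A))) _ ?_
  rw [← Category.assoc, (formId S A).refl.w, ← Category.assoc, TypeCat.diag_p, Category.id_comp]

end Id

/-! ### Unit and empty types -/

section UnitEmpty

variable [PreservesFiniteLimits F] [R.Full] [R.Faithful] {Y : C} (X : M.UnitData Y) {Γ : E}

/-- The unit type classified by a given one. -/
noncomputable def mkUnit (χ : F.obj Γ ⟶ Y) : (splitCat adj M).UnitData Γ where
  ty := mk X.ty χ
  star := mkLift _ (χ ≫ X.star.hom) (by
    rw [Category.assoc, X.star.w, F.map_id, Category.id_comp, Category.comp_id])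

theorem mkUnit_reindex (χ : F.obj Γ ⟶ Y) {Θ : E} (σ : Θ ⟶ Γ) :
    (mkUnit (adj := adj) X χ).reindex σ = mkUnit X (F.map σ ≫ χ) := by
  refine TypeCat.UnitData.ext rfl (heq_of_eq ?_)
  dsimp only [TypeCat.UnitData.reindex, mkUnit, TypeCat.Sec.sub]
  exact reindex_mkLift _ _ _ _ _ _ _ _ (Category.assoc _ _ _) _

/-- The premises of the elimination rule. -/
noncomputable def unitFrame {χ : F.obj Γ ⟶ Y} {X₀ : (splitCat adj M).UnitData Γ}
    (hX : X₀ = mkUnit X χ) :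
    Frame (M.p X.ty) (fun _ : Unit => X.star.hom) F ((splitCat adj M).p X₀.ty)
      (fun _ : Unit => X₀.star.hom) where
  t := χ
  u := genOf (congrArg TypeCat.UnitData.ty hX)
  hP := cls_genOf _
  -- The canonical term is a section, so its domain is the base itself and the comparison map is the
  -- name.
  e _ := χ
  hK _ := by
    refine IsPullback.of_bot ?_ ?_ (cls_genOf (congrArg TypeCat.UnitData.ty hX))
    · exact (IsPullback.id_vert χ).congr rfl (by rw [← F.map_comp, X₀.star.w, F.map_id])
        X.star.w.symm rfl
    · subst hX
      dsimp only [mkUnit]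
      exact (map_mkLift_genOf _ _ _ _).symm

omit [PreservesFiniteLimits F] [R.Full] [R.Faithful] in
theorem stableLLP_unit (hX : ∀ {Θ : C} (σ : Θ ⟶ Y), (X.reindex σ).IsUnit) {V : C} (T : M.Ty V) :
    StableLLP (M.p X.ty) (fun _ : Unit => X.star.hom) (M.p T) := by
  refine StableLLP.of_sections M (fun t => ⟨_, _, _, M.isPullback t X.ty, _,
    fun _ => t, fun _ => (X.reindex t).star.hom, fun _ => ?_, fun A d => ?_⟩) T
  · exact X.star.isPullback_reindex (IsPullback.id_vert t)
  · obtain ⟨s, hs⟩ := hX t A (d ())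
    exact ⟨s, fun _ => hs⟩

-- Lifting of the empty family against a type projection just means that every motive has a section.
omit [PreservesFiniteLimits F] [R.Full] [R.Faithful] in
theorem stableLLP_empty {Z : M.Ty Y}
    (hZ : ∀ {Θ : C} (σ : Θ ⟶ Y) (A : M.Ty (M.ext (M.sub σ Z))), Nonempty (M.Sec A)) {V : C}
    (T : M.Ty V) : StableLLP (K := fun k : Empty => k.elim) (M.p Z) (fun k => k.elim) (M.p T) := by
  refine StableLLP.of_sections M (fun t => ⟨_, _, _, M.isPullback t Z, fun k => k.elim,
    fun k => k.elim, fun k => k.elim, fun k => k.elim, fun A d => ?_⟩) T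
  obtain ⟨s⟩ := hZ t A
  exact ⟨s, fun k => k.elim⟩

/-- The premises of the elimination rule. -/
noncomputable def emptyFrame {Z : M.Ty Y} {χ : F.obj Γ ⟶ Y} {Z₀ : (splitCat adj M).Ty Γ}
    (hZ : Z₀ = mk Z χ) :
    Frame (K := fun k : Empty => k.elim) (M.p Z) (fun k => k.elim) F ((splitCat adj M).p Z₀)
      (K' := fun k : Empty => k.elim) (fun k => k.elim) where
  t := χ
  u := genOf hZ
  hP := cls_genOf _
  e k := k.elim
  hK k := k.elim

variable [HasFiniteLimits C] [HasPushes C]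

/-- There are no premises, so the universe is the terminal object and every name is the unique map
to it. -/
theorem strictUnit (h : M.WeakUnit) : Nonempty (splitCat adj M).StrictUnit := by
  obtain ⟨X, hX⟩ := h (⊤_ C)
  have h₁ : ∀ {Θ Γ : E} (σ : Θ ⟶ Γ), mkUnit (adj := adj) X (terminal.from (F.obj Θ))
      = (mkUnit X (terminal.from (F.obj Γ))).reindex σ := fun {Θ Γ} σ => by
    rw [mkUnit_reindex, terminal.comp_from]
  exact ⟨{
    form := fun Γ => mkUnit X (terminal.from (F.obj Γ))
    form_sub := h₁
    elim := @fun Γ X₀ hX₀ A d => elimOf (stableLLP_unit _ hX) (unitFrame _ hX₀) A (fun _ => d)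
    comp := @fun Γ X₀ hX₀ A d => elimOf_comp _ _ A (fun _ => d) ()
    elim_sub := @fun Θ Γ σ X₀ hX₀ hX' A d => by
      refine elimOf_sub (stableLLP_unit _ hX) (unitFrame _ hX₀) A (fun _ => d)
        (unitFrame _ hX') σ ((splitCat adj M).up σ X₀.ty) (fun _ => σ)
        (terminal.comp_from _) (genOf_sub (congrArg TypeCat.UnitData.ty hX₀) σ
          (congrArg TypeCat.UnitData.ty hX')) (TypeCat.up_p _ _ _)
        (fun _ => terminal.comp_from _) (fun _ => ?_) (fun _ => d.reindex _ _ _ _) (fun _ => ?_)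
      · exact ((splitCat adj M).pair_up _ _ _ _ _).symm
      · exact (splitCat adj M).pair_up _ _ _ _ _ }⟩

theorem strictZero (h : M.WeakZero) : Nonempty (splitCat adj M).StrictZero := by
  obtain ⟨Z, hZ⟩ := h (⊤_ C)
  exact ⟨{
    form := fun Γ => mk Z (terminal.from (F.obj Γ))
    form_sub := fun {Θ Γ} σ => by rw [sub_mk, terminal.comp_from]
    elim := @fun Γ Z₀ hZ₀ A => elimOf (stableLLP_empty hZ) (emptyFrame hZ₀) A (fun k => k.elim)
    elim_sub := @fun Θ Γ σ Z₀ hZ₀ hZ' A =>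
      elimOf_sub (stableLLP_empty hZ) (emptyFrame hZ₀) A (fun k => k.elim) (emptyFrame hZ') σ
        ((splitCat adj M).up σ Z₀) (fun k => k.elim) (terminal.comp_from _)
        (genOf_sub hZ₀ σ hZ') (TypeCat.up_p _ _ _) (fun k => k.elim) (fun k => k.elim)
        (fun k => k.elim) (fun k => k.elim) }⟩

end UnitEmpty

end splitCat

end Restricted

section Restricted

variable {C : Type u} [Category.{v} C] {E : Type u} [Category.{v} E] [HasPullbacks E]
  {F : E ⥤ C} {R : C ⥤ E} {adj : F ⊣ R} {M : TypeCat.{v, u, w} C}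

namespace splitCat

/-! ### Binary sums -/

section Refine

variable {Y W : C} {T : M.Ty W} {Γ : E} {A : (splitCat adj M).Ty Γ} {n : F.obj Γ ⟶ W}
  {α : F.obj ((splitCat adj M).ext A) ⟶ M.ext T} {π : Y ⟶ W} {χ : F.obj Γ ⟶ Y}

/-- The generic term of a type, relative to a factorization of its name. -/
noncomputable def Cls.refineGen (h : Cls adj A T n α) (e : χ ≫ π = n) :
    F.obj ((splitCat adj M).ext A) ⟶ M.ext (M.sub π T) :=
  M.pair π T (F.map ((splitCat adj M).p A) ≫ χ) α (by rw [Category.assoc, e, h.w])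

theorem Cls.cls_refineGen (h : Cls adj A T n α) (e : χ ≫ π = n) :
    Cls adj A (M.sub π T) χ (h.refineGen e) :=
  IsPullback.of_right (h.congr (M.pair_up _ _ _ _ _).symm rfl rfl e.symm) (M.pair_p _ _ _ _ _)
    (M.isPullback _ _)

theorem Cls.refineGen_congr {α' n' χ'} (h : Cls adj A T n α) (e : χ ≫ π = n)
    (h' : Cls adj A T n' α') (e' : χ' ≫ π = n') (e₁ : χ = χ') (e₂ : α = α') :
    h.refineGen e = h'.refineGen e' := by
  subst e₁ e₂
  rfl

theorem Cls.refineGen_sub [PreservesFiniteLimits F] (h : Cls adj A T n α) (e : χ ≫ π = n) {Θ : E}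
    (σ : Θ ⟶ Γ) (e' : (F.map σ ≫ χ) ≫ π = F.map σ ≫ n) :
    (h.sub σ).refineGen e' = F.map ((splitCat adj M).up σ A) ≫ h.refineGen e := by
  apply M.hom_ext
  · exact (M.pair_p _ _ _ _ _).trans ((h.cls_refineGen e).sub σ).w.symm
  · exact (M.pair_up _ _ _ _ _).trans
      ((congrArg (F.map _ ≫ ·) (M.pair_up _ _ _ _ _)).symm.trans (Category.assoc _ _ _).symm)

end Refine

section Sum

variable [PreservesFiniteLimits F] [R.Full] [R.Faithful] {Y : C} {a b : M.Ty Y}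
  (X : M.SumData a b) {Γ : E} {A B : (splitCat adj M).Ty Γ} {χ : F.obj Γ ⟶ Y}
  {α : F.obj ((splitCat adj M).ext A) ⟶ M.ext a} {β : F.obj ((splitCat adj M).ext B) ⟶ M.ext b}

/-- The binary sum classified by a given one. -/
noncomputable def mkSum (hA : Cls adj A a χ α) (hB : Cls adj B b χ β) :
    (splitCat adj M).SumData A B where
  ty := mk X.ty χ
  inl := mkLift _ (α ≫ X.inl.hom) (by rw [Category.assoc, X.inl.w, hA.w])
  inr := mkLift _ (β ≫ X.inr.hom) (by rw [Category.assoc, X.inr.w, hB.w])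

theorem mkSum_reindex (hA : Cls adj A a χ α) (hB : Cls adj B b χ β) {Θ : E} (σ : Θ ⟶ Γ) :
    (mkSum X hA hB).reindex σ = mkSum X (hA.sub σ) (hB.sub σ) := by
  refine TypeCat.SumData.ext rfl (heq_of_eq ?_) (heq_of_eq ?_)
  · dsimp only [TypeCat.SumData.reindex, mkSum]
    exact reindex_mkLift _ _ _ _ _ _ _ _ (Category.assoc _ _ _) _
  · dsimp only [TypeCat.SumData.reindex, mkSum]
    exact reindex_mkLift _ _ _ _ _ _ _ _ (Category.assoc _ _ _) _

theorem mkSum_congr {χ' α' β'} (hA : Cls adj A a χ α) (hB : Cls adj B b χ β)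
    (hA' : Cls adj A a χ' α') (hB' : Cls adj B b χ' β') (e₁ : χ = χ') (e₂ : α = α') (e₃ : β = β') :
    mkSum X hA hB = mkSum X hA' hB' := by
  subst e₁ e₂ e₃
  rfl

/-- The contexts of the two cases. -/
abbrev sumCtx {D : Type u} [Category.{v} D] {N : TypeCat.{v, u, w} D} {Γ : D} (A B : N.Ty Γ) :
    Bool → D
  | false => N.ext A
  | true => N.ext B

/-- The two injections. -/
abbrev sumInj {D : Type u} [Category.{v} D] {N : TypeCat.{v, u, w} D} {Γ : D} {A B : N.Ty Γ}
    (X : N.SumData A B) : ∀ k, sumCtx A B k ⟶ N.ext X.ty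
  | false => X.inl.hom
  | true => X.inr.hom

/-- The two cases. -/
abbrev sumCase {D : Type u} [Category.{v} D] {N : TypeCat.{v, u, w} D} {Γ : D} {A B : N.Ty Γ}
    (X : N.SumData A B) {T : N.Ty (N.ext X.ty)} (d : N.Lift X.inl.hom T) (e : N.Lift X.inr.hom T) :
    ∀ k, N.Lift (sumInj X k) T
  | false => d
  | true => e

theorem mkSum_isPullback_inl (hA : Cls adj A a χ α) (hB : Cls adj B b χ β)
    {X₀ : (splitCat adj M).SumData A B} (hX : X₀ = mkSum X hA hB) :
    IsPullback α (F.map X₀.inl.hom) X.inl.hom (genOf (congrArg TypeCat.SumData.ty hX)) := by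
  refine IsPullback.of_bot ?_ ?_ (cls_genOf (congrArg TypeCat.SumData.ty hX))
  · exact hA.congr rfl ((F.map_comp _ _).symm.trans (congrArg F.map X₀.inl.w)).symm
      X.inl.w.symm rfl
  · subst hX
    dsimp only [mkSum]
    exact (map_mkLift_genOf _ _ _ _).symm

theorem mkSum_isPullback_inr (hA : Cls adj A a χ α) (hB : Cls adj B b χ β)
    {X₀ : (splitCat adj M).SumData A B} (hX : X₀ = mkSum X hA hB) :
    IsPullback β (F.map X₀.inr.hom) X.inr.hom (genOf (congrArg TypeCat.SumData.ty hX)) := by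
  refine IsPullback.of_bot ?_ ?_ (cls_genOf (congrArg TypeCat.SumData.ty hX))
  · exact hB.congr rfl ((F.map_comp _ _).symm.trans (congrArg F.map X₀.inr.w)).symm
      X.inr.w.symm rfl
  · subst hX
    dsimp only [mkSum]
    exact (map_mkLift_genOf _ _ _ _).symm

/-- The premises of the elimination rule. -/
noncomputable def sumFrame (hA : Cls adj A a χ α) (hB : Cls adj B b χ β)
    {X₀ : (splitCat adj M).SumData A B} (hX : X₀ = mkSum X hA hB) :
    Frame (M.p X.ty) (sumInj X) F ((splitCat adj M).p X₀.ty) (sumInj X₀) where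
  t := χ
  u := genOf (congrArg TypeCat.SumData.ty hX)
  hP := cls_genOf _
  e
    | false => α
    | true => β
  hK
    | false => mkSum_isPullback_inl X hA hB hX
    | true => mkSum_isPullback_inr X hA hB hX

omit [PreservesFiniteLimits F] [R.Full] [R.Faithful] in
theorem stableLLP_sum (hX : ∀ {Θ : C} (σ : Θ ⟶ Y), (X.reindex σ).IsSum) {V : C} (T : M.Ty V) :
    StableLLP (M.p X.ty) (sumInj X) (M.p T) := by
  refine StableLLP.of_sections M (fun t => ⟨_, _, _, M.isPullback t X.ty, sumCtx (M.sub t a) (M.sub t b),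
    fun k => match k with
      | false => M.up t a
      | true => M.up t b, sumInj (X.reindex t), fun k => ?_, fun A d => ?_⟩) T
  · cases k
    · exact X.inl.isPullback_reindex (M.isPullback t a)
    · exact X.inr.isPullback_reindex (M.isPullback t b)
  · obtain ⟨s, hs₁, hs₂⟩ := hX t A (d false) (d true)
    refine ⟨s, fun k => ?_⟩
    cases k
    · exact hs₁
    · exact hs₂

variable [HasFiniteLimits C]

section

variable (S : ∀ {Γ : C} (A B : M.Ty Γ), M.SumData A B)

/-- The two summands may have different local universes. Pulled back to the product of these, they
become types over one base with a common name. -/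
theorem sumCls_left (A B : (splitCat adj M).Ty Γ) :
    Cls adj A (M.sub prod.fst (top A)) (prod.lift (name A) (name B))
      ((cls_gen A).refineGen (prod.lift_fst (name A) (name B))) :=
  (cls_gen A).cls_refineGen _

theorem sumCls_right (A B : (splitCat adj M).Ty Γ) :
    Cls adj B (M.sub prod.snd (top B)) (prod.lift (name A) (name B))
      ((cls_gen B).refineGen (prod.lift_snd (name A) (name B))) :=
  (cls_gen B).cls_refineGen _

/-- The chosen binary sum. -/
noncomputable def formSum {Γ : E} (A B : (splitCat adj M).Ty Γ) : (splitCat adj M).SumData A B :=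
  mkSum (S (M.sub (prod.fst : base A ⨯ base B ⟶ _) (top A)) (M.sub prod.snd (top B)))
    (sumCls_left A B) (sumCls_right A B)

omit [PreservesFiniteLimits F] [R.Full] [R.Faithful] in
theorem sumName_sub {Θ Γ : E} (σ : Θ ⟶ Γ) (A B : (splitCat adj M).Ty Γ) :
    prod.lift (F.map σ ≫ name A) (F.map σ ≫ name B) = F.map σ ≫ prod.lift (name A) (name B) :=
  (prod.comp_lift _ _ _).symm

theorem sumGen_left_sub {Θ Γ : E} (σ : Θ ⟶ Γ) (A B : (splitCat adj M).Ty Γ) :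
    (cls_gen ((splitCat adj M).sub σ A)).refineGen (prod.lift_fst (F.map σ ≫ name A)
      (F.map σ ≫ name B)) = F.map ((splitCat adj M).up σ A) ≫
        (cls_gen A).refineGen (prod.lift_fst (name A) (name B)) :=
  (Cls.refineGen_congr _ _ ((cls_gen A).sub σ)
    (by rw [Category.assoc, prod.lift_fst]) (sumName_sub σ A B) (gen_sub σ A)).trans
    ((cls_gen A).refineGen_sub _ σ _)

theorem sumGen_right_sub {Θ Γ : E} (σ : Θ ⟶ Γ) (A B : (splitCat adj M).Ty Γ) :
    (cls_gen ((splitCat adj M).sub σ B)).refineGen (prod.lift_snd (F.map σ ≫ name A)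
      (F.map σ ≫ name B)) = F.map ((splitCat adj M).up σ B) ≫
        (cls_gen B).refineGen (prod.lift_snd (name A) (name B)) :=
  (Cls.refineGen_congr _ _ ((cls_gen B).sub σ)
    (by rw [Category.assoc, prod.lift_snd]) (sumName_sub σ A B) (gen_sub σ B)).trans
    ((cls_gen B).refineGen_sub _ σ _)

theorem formSum_sub {Θ Γ : E} (σ : Θ ⟶ Γ) (A B : (splitCat adj M).Ty Γ) :
    formSum S ((splitCat adj M).sub σ A) ((splitCat adj M).sub σ B)
      = (formSum S A B).reindex σ := by
  refine Eq.trans ?_ (mkSum_reindex _ _ _ σ).symm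
  exact mkSum_congr _ _ _ _ _ (sumName_sub σ A B) (sumGen_left_sub σ A B) (sumGen_right_sub σ A B)

end

variable [HasPushes C]

theorem strictSum (h : M.WeakSum) : Nonempty (splitCat adj M).StrictSum := by
  choose S hS using @h
  exact ⟨{
    form := formSum S
    form_sub := formSum_sub S
    elim := @fun Γ A B X₀ hX T d e => elimOf (stableLLP_sum _ (hS _ _))
      (sumFrame _ (sumCls_left A B) (sumCls_right A B) hX) T (sumCase X₀ d e)
    comp_inl := @fun Γ A B X₀ hX T d e => elimOf_comp _ _ T (sumCase X₀ d e) false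
    comp_inr := @fun Γ A B X₀ hX T d e => elimOf_comp _ _ T (sumCase X₀ d e) true
    elim_sub := @fun Θ Γ σ A B X₀ hX hX' T d e => by
      refine elimOf_sub (stableLLP_sum _ (hS _ _))
        (sumFrame _ (sumCls_left A B) (sumCls_right A B) hX) T (sumCase X₀ d e)
        (sumFrame _ (sumCls_left ((splitCat adj M).sub σ A) ((splitCat adj M).sub σ B))
          (sumCls_right ((splitCat adj M).sub σ A) ((splitCat adj M).sub σ B)) hX') σ ((splitCat adj M).up σ X₀.ty)
        (fun k => match k with
          | false => (splitCat adj M).up σ A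
          | true => (splitCat adj M).up σ B)
        (sumName_sub σ A B).symm (genOf_sub (congrArg TypeCat.SumData.ty hX) σ
          (congrArg TypeCat.SumData.ty hX')) (TypeCat.up_p _ _ _)
        (fun k => ?_) (fun k => ?_) (sumCase (X₀.reindex σ) (d.reindex _ _ _ _) (e.reindex _ _ _ _))
        (fun k => ?_)
      · cases k
        · exact (sumGen_left_sub σ A B).symm
        · exact (sumGen_right_sub σ A B).symm
      · cases k
        · exact ((splitCat adj M).pair_up _ _ _ _ _).symm
        · exact ((splitCat adj M).pair_up _ _ _ _ _).symm
      · cases k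
        · exact (splitCat adj M).pair_up _ _ _ _ _
        · exact (splitCat adj M).pair_up _ _ _ _ _ }⟩

end Sum

end splitCat

end Restricted

/-! ### Dependent products -/

section Lam

variable {C : Type u} [Category.{v} C] {M : TypeCat.{v, u, w} C}

namespace TypeCat.PiData

variable {Y : C} {a : M.Ty Y} {b : M.Ty (M.ext a)}

/-- Composing with the map to `M.ext b` removes the substitutions, so that application in a
reindexed product is expressed by the original application map. -/
theorem ap_reindex_up (X : M.PiData a b) {Z : C} (t : Z ⟶ Y) (f : M.Sec (M.sub t X.ty)) :
    (PiData.ap (X.reindex t) f).hom ≫ M.up (M.up t a) b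
      = M.pair (M.p X.ty) a (M.p (M.sub t a) ≫ f.hom ≫ M.up t X.ty) (M.up t a) (by
        rw [Category.assoc, Category.assoc, M.up_p t X.ty, ← Category.assoc f.hom, f.w,
          Category.id_comp, M.up_p]) ≫ X.app.hom := by
  dsimp only [ap, reindex, Lift.reindex]
  rw [Category.assoc, M.pair_up, ← Category.assoc]
  congr 1
  apply M.hom_ext
  · simp [up₂]
  · simp [up₂]

/-- A section of `b` over a context `t : Z ⟶ Y`. -/
structure BodyProblem (b : M.Ty (M.ext a)) where
  Z : C
  t : Z ⟶ Y
  Q : C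
  a' : Q ⟶ M.ext a
  b' : Q ⟶ Z
  hQ : IsPullback a' b' (M.p a) t
  k : Q ⟶ M.ext b
  hk : k ≫ M.p b = a'

/-- The map `g` is an abstraction of the body `x` that satisfies the β-rule. -/
structure IsLam (X : M.PiData a b) (x : BodyProblem b) (g : x.Z ⟶ M.ext X.ty) : Prop where
  w : g ≫ M.p X.ty = x.t
  app_eq : ∀ l : x.Q ⟶ M.ext (M.sub (M.p X.ty) a), l ≫ M.p (M.sub (M.p X.ty) a) = x.b' ≫ g →
    l ≫ M.up (M.p X.ty) a = x.a' → l ≫ X.app.hom = x.k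

/-- Abstractions can be chosen naturally. -/
theorem exists_lam [HasPushes C] {X : M.PiData a b}
    (hX : ∀ {Z : C} (t : Z ⟶ Y), (X.reindex t).IsPi) :
    ∃ lam : ∀ x : BodyProblem b, x.Z ⟶ M.ext X.ty, (∀ x, X.IsLam x (lam x)) ∧
      ∀ (x y : BodyProblem b) (r : x.Z ⟶ y.Z) (ρ : x.Q ⟶ y.Q), r ≫ y.t = x.t → ρ ≫ y.a' = x.a' →
        ρ ≫ y.b' = x.b' ≫ r → ρ ≫ y.k = x.k → lam x = r ≫ lam y := by
  -- The pushforward of `M.p b` along `M.p a` classifies bodies, and evaluation is the universal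
  -- body. Weak stability along `π` gives the latter an abstraction `f`, of which all others are
  -- restrictions.
  obtain ⟨W, P, π, a₀, b₀, ev₀, h₀⟩ := HasPushes.exists_isPush (M.p b) (M.p a)
  obtain ⟨ev, h⟩ := h₀.of_isPullback (M.isPullback π a)
  obtain ⟨(f : M.Sec (M.sub π X.ty)), hf⟩ := hX π ⟨M.pair (M.up π a) b (𝟙 _) ev (by rw [h.ev_q, Category.id_comp]),
    M.pair_p _ _ _ _ _⟩
  have hg := (ap_reindex_up X π f).symm.trans (congrArg (fun s => s.hom ≫ M.up (M.up π a) b) hf)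
  have hg' := hg.trans (M.pair_up _ _ _ _ _)
  have hfw : f.hom ≫ M.p (M.sub π X.ty) = 𝟙 _ := f.w
  choose χ hχ hu using fun x : BodyProblem b => h.existsUnique x.hQ x.k x.hk
  refine ⟨fun x => χ x ≫ f.hom ≫ M.up π X.ty, fun x => ⟨?_, fun l h₁ h₂ => ?_⟩,
    fun x y r ρ hr h₁ h₂ h₃ => ?_⟩
  · rw [Category.assoc, Category.assoc, M.up_p, reassoc_of% hfw, (hχ x).1]
  · obtain ⟨-, l₀, e₁, e₂, e₃⟩ := hχ x
    rw [← e₃, ← hg', ← Category.assoc]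
    congr 1
    apply M.hom_ext
    · rw [h₁, Category.assoc, M.pair_p, reassoc_of% e₂]
    · rw [h₂, Category.assoc, M.pair_up, e₁]
  -- The classifying map of `y` restricted along `r` also classifies `x`.
  · obtain ⟨hy, l₀, e₁, e₂, e₃⟩ := hχ y
    dsimp only
    rw [← hu x (r ≫ χ y) ⟨by rw [Category.assoc, hy, hr], ρ ≫ l₀, by rw [Category.assoc, e₁, h₁],
      by rw [Category.assoc, e₂, reassoc_of% h₂], by rw [Category.assoc, e₃, h₃]⟩, Category.assoc]

/-- An abstraction over `t` is a section of the product reindexed along `t`, where η makes it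
unique. -/
theorem IsLam.unique {X : M.PiData a b} (hX : ∀ {Z : C} (t : Z ⟶ Y), (X.reindex t).IsPiEta)
    {x : BodyProblem b} {g g' : x.Z ⟶ M.ext X.ty} (h : X.IsLam x g) (h' : X.IsLam x g') :
    g = g' := by
  -- The application of such a section is the body transported to the chosen comprehension, whatever
  -- the abstraction `g`.
  have key : ∀ {g} (h : X.IsLam x g), ((X.reindex x.t).ap ⟨M.pair x.t X.ty (𝟙 _) g (by
      rw [h.w, Category.id_comp]), M.pair_p _ _ _ _ _⟩).hom ≫ M.up (M.up x.t a) b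
      = x.hQ.lift (M.up x.t a) (M.p (M.sub x.t a)) (M.up_p x.t a) ≫ x.k := by
    intro g h
    have e : x.b' ≫ g ≫ M.p X.ty = x.a' ≫ M.p a := by rw [h.w, x.hQ.w]
    refine (ap_reindex_up _ _ _).trans (Eq.trans (congrArg (· ≫ X.app.hom) (M.hom_ext
      (g := x.hQ.lift (M.up x.t a) (M.p (M.sub x.t a)) (M.up_p x.t a) ≫
        M.pair (M.p X.ty) a (x.b' ≫ g) x.a' (by rw [Category.assoc, e])) ?_ ?_))
      ((Category.assoc _ _ _).trans (congrArg (x.hQ.lift _ _ _ ≫ ·)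
        (h.app_eq _ (M.pair_p _ _ _ _ _) (M.pair_up _ _ _ _ _)))))
    · refine (M.pair_p _ _ _ _ _).trans ?_
      refine (congrArg (M.p _ ≫ ·) (M.pair_up _ _ _ _ _)).trans ?_
      rw [Category.assoc, M.pair_p, ← Category.assoc, x.hQ.lift_snd]
    · refine (M.pair_up _ _ _ _ _).trans ?_
      rw [Category.assoc, M.pair_up, x.hQ.lift_fst]
  have e := (hX x.t ((X.reindex x.t).ap ⟨M.pair x.t X.ty (𝟙 _) g (by
      rw [h.w, Category.id_comp]), M.pair_p _ _ _ _ _⟩)).unique rfl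
      (y₂ := ⟨M.pair x.t X.ty (𝟙 _) g' (by rw [h'.w, Category.id_comp]), M.pair_p _ _ _ _ _⟩) (by
    refine Lift.ext (M.hom_ext ?_ ((key h').trans (key h).symm))
    exact (Lift.w _).trans (Lift.w _).symm)
  have e' := congrArg (fun s : M.Sec (M.sub x.t X.ty) => s.hom ≫ M.up x.t X.ty) e
  exact (M.pair_up _ _ _ _ _).symm.trans (e'.trans (M.pair_up _ _ _ _ _))

end TypeCat.PiData

end Lam

section Restricted

variable {C : Type u} [Category.{v} C] {E : Type u} [Category.{v} E] [HasPullbacks E]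
  {F : E ⥤ C} {R : C ⥤ E} {adj : F ⊣ R} {M : TypeCat.{v, u, w} C}

namespace splitCat

section Pi

variable [PreservesFiniteLimits F] [R.Full] [R.Faithful] {Y : C} {a : M.Ty Y} {b : M.Ty (M.ext a)}
  (X : M.PiData a b) {Γ : E} {A : (splitCat adj M).Ty Γ}
  {B : (splitCat adj M).Ty ((splitCat adj M).ext A)} {χ : F.obj Γ ⟶ Y}
  {α : F.obj ((splitCat adj M).ext A) ⟶ M.ext a} {β : F.obj ((splitCat adj M).ext B) ⟶ M.ext b}

/-- The dependent product classified by a given one. -/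
noncomputable def mkPi (hA : Cls adj A a χ α) (hB : Cls adj B b α β) :
    (splitCat adj M).PiData A B where
  ty := mk X.ty χ
  app := hB.lift _ (weakGen (cls_genOf rfl) hA ≫ X.app.hom) (by
    rw [Category.assoc, X.app.w, weakGen_up])

theorem ty_mkPi {hA : Cls adj A a χ α} {hB : Cls adj B b α β} {X₀ : (splitCat adj M).PiData A B}
    (hX : X₀ = mkPi X hA hB) : X₀.ty = mk X.ty χ :=
  congrArg TypeCat.PiData.ty hX

theorem mkPi_reindex (hA : Cls adj A a χ α) (hB : Cls adj B b α β) {Θ : E} (σ : Θ ⟶ Γ) :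
    (mkPi X hA hB).reindex σ = mkPi X (hA.sub σ) (hB.sub _) := by
  refine TypeCat.PiData.ext rfl (heq_of_eq ((hB.sub ((splitCat adj M).up σ A)).lift_ext ?_))
  dsimp only [TypeCat.PiData.reindex, mkPi]
  refine (map_reindex (α := β) _ ((splitCat adj M).up σ A) _ _ _).trans ?_
  refine Eq.trans ?_ (Cls.map_lift _ _ _ _).symm
  refine (congrArg (F.map _ ≫ ·) (Cls.map_lift _ _ _ _)).trans ?_
  refine (Category.assoc _ _ _).symm.trans (congrArg (· ≫ X.app.hom) ?_)
  exact (weakGen_sub (cls_genOf rfl) hA σ).symm.trans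
    (weakGen_congr _ _ _ _ rfl (genOf_sub rfl σ rfl) rfl)

theorem mkPi_congr {χ' α' β'} (hA : Cls adj A a χ α) (hB : Cls adj B b α β)
    (hA' : Cls adj A a χ' α') (hB' : Cls adj B b α' β') (e₁ : χ = χ') (e₂ : α = α') (e₃ : β = β') :
    mkPi X hA hB = mkPi X hA' hB' := by
  subst e₁ e₂ e₃
  rfl

theorem map_app (hA : Cls adj A a χ α) (hB : Cls adj B b α β)
    {X₀ : (splitCat adj M).PiData A B} (hX : X₀ = mkPi X hA hB) :
    F.map X₀.app.hom ≫ β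
      = weakGen (cls_genOf (ty_mkPi X hX)) hA ≫ X.app.hom := by
  subst hX
  dsimp only [mkPi]
  exact Cls.map_lift _ _ _ _

/-- The body given by a section. -/
noncomputable def body (hA : Cls adj A a χ α) (hB : Cls adj B b α β) (s : (splitCat adj M).Sec B) :
    TypeCat.PiData.BodyProblem b where
  Z := F.obj Γ
  t := χ
  Q := F.obj ((splitCat adj M).ext A)
  a' := α
  b' := F.map ((splitCat adj M).p A)
  hQ := hA
  k := F.map s.hom ≫ β
  hk := by rw [Category.assoc, hB.map_w, F.map_id, Category.id_comp]

/-- The β-rule in `E` is an equation between terms of `B`, hence between their names, and the name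
of `X₀.ap f` is the application of `X` at the point `l`. No other map has the two projections of
`l`, so the quantifier in `IsLam` ranges over this point only. -/
theorem isLam_iff (hA : Cls adj A a χ α) (hB : Cls adj B b α β)
    {X₀ : (splitCat adj M).PiData A B} (hX : X₀ = mkPi X hA hB) (f : (splitCat adj M).Sec X₀.ty)
    (s : (splitCat adj M).Sec B) :
    X.IsLam (body hA hB s) (F.map f.hom ≫ genOf (ty_mkPi X hX)) ↔
      X₀.ap f = s := by
  let l := F.map ((splitCat adj M).pair ((splitCat adj M).p X₀.ty) A
      ((splitCat adj M).p A ≫ f.hom) (𝟙 _) (by simp [f.w])) ≫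
    weakGen (cls_genOf (ty_mkPi X hX)) hA
  have h₁ : l ≫ M.p (M.sub (M.p X.ty) a)
      = F.map ((splitCat adj M).p A) ≫ F.map f.hom ≫ genOf (ty_mkPi X hX) := by
    rw [Category.assoc, weakGen_p, ← Category.assoc, ← F.map_comp, TypeCat.pair_p, F.map_comp,
      Category.assoc]
  have h₂ : l ≫ M.up (M.p X.ty) a = α := by
    rw [Category.assoc, weakGen_up, ← Category.assoc, ← F.map_comp, TypeCat.pair_up, F.map_id,
      Category.id_comp]
  have h₃ : F.map (X₀.ap f).hom ≫ β = l ≫ X.app.hom := by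
    rw [Category.assoc, ← map_app X hA hB hX, ← Category.assoc, ← F.map_comp]
    rfl
  constructor
  · intro h
    exact hB.lift_ext (h₃.trans (h.app_eq l h₁ h₂))
  · rintro rfl
    refine ⟨?_, fun l' h₁' h₂' => ?_⟩
    · exact (Category.assoc _ _ _).trans (((cls_genOf (ty_mkPi X hX)).map_w f).trans (by
        rw [F.map_id, Category.id_comp]; rfl))
    · exact (congrArg (· ≫ X.app.hom) (M.hom_ext (h₁'.trans h₁.symm) (h₂'.trans h₂.symm))).trans
        h₃.symm

variable [HasPushes C]

/-- The chosen abstraction. -/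
noncomputable def lamOf (H : ∀ {Z : C} (t : Z ⟶ Y), (X.reindex t).IsPi)
    (hA : Cls adj A a χ α) (hB : Cls adj B b α β)
    {X₀ : (splitCat adj M).PiData A B} (hX : X₀ = mkPi X hA hB) (s : (splitCat adj M).Sec B) :
    (splitCat adj M).Sec X₀.ty :=
  (cls_genOf (ty_mkPi X hX)).lift (𝟙 Γ)
    ((TypeCat.PiData.exists_lam H).choose (body hA hB s)) (by
      rw [F.map_id, Category.id_comp]
      exact ((TypeCat.PiData.exists_lam H).choose_spec.1 (body hA hB s)).w)

theorem map_lamOf (H : ∀ {Z : C} (t : Z ⟶ Y), (X.reindex t).IsPi)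
    (hA : Cls adj A a χ α) (hB : Cls adj B b α β)
    {X₀ : (splitCat adj M).PiData A B} (hX : X₀ = mkPi X hA hB) (s : (splitCat adj M).Sec B) :
    F.map (lamOf X H hA hB hX s).hom ≫ genOf (ty_mkPi X hX)
      = (TypeCat.PiData.exists_lam H).choose (body hA hB s) :=
  Cls.map_lift _ _ _ _

theorem isLam_lamOf (H : ∀ {Z : C} (t : Z ⟶ Y), (X.reindex t).IsPi)
    (hA : Cls adj A a χ α) (hB : Cls adj B b α β)
    {X₀ : (splitCat adj M).PiData A B} (hX : X₀ = mkPi X hA hB) (s : (splitCat adj M).Sec B) :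
    X.IsLam (body hA hB s)
      (F.map (lamOf X H hA hB hX s).hom ≫ genOf (ty_mkPi X hX)) :=
  (congrArg (X.IsLam (body hA hB s)) (map_lamOf X H hA hB hX s)).mpr
    ((TypeCat.PiData.exists_lam H).choose_spec.1 (body hA hB s))

/-- The body of the substituted section is the restriction along `F σ` of the original body, and
abstractions were chosen naturally in restrictions. -/
theorem lamOf_sub (H : ∀ {Z : C} (t : Z ⟶ Y), (X.reindex t).IsPi)
    (hA : Cls adj A a χ α) (hB : Cls adj B b α β)
    {X₀ : (splitCat adj M).PiData A B} (hX : X₀ = mkPi X hA hB) {Θ : E} (σ : Θ ⟶ Γ) {χ' α' β'}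
    (hA' : Cls adj ((splitCat adj M).sub σ A) a χ' α')
    (hB' : Cls adj ((splitCat adj M).sub ((splitCat adj M).up σ A) B) b α' β')
    (e₁ : χ' = F.map σ ≫ χ) (e₂ : α' = F.map ((splitCat adj M).up σ A) ≫ α)
    (e₃ : β' = F.map ((splitCat adj M).up ((splitCat adj M).up σ A) B) ≫ β)
    (hX' : X₀.reindex σ = mkPi X hA' hB') (s : (splitCat adj M).Sec B) :
    lamOf X H hA' hB' hX' (s.sub ((splitCat adj M).up σ A)) = (lamOf X H hA hB hX s).sub σ := by
  refine (cls_genOf (ty_mkPi X hX')).lift_ext ?_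
  refine (map_lamOf X H hA' hB' hX' _).trans ?_
  refine Eq.trans ?_ (congrArg (F.map _ ≫ ·) (genOf_sub (ty_mkPi X hX) σ
    (ty_mkPi X hX')))
  refine Eq.trans ?_ (map_secSub _ σ).symm
  refine Eq.trans ?_ (congrArg (F.map σ ≫ ·) (map_lamOf X H hA hB hX s)).symm
  refine (TypeCat.PiData.exists_lam H).choose_spec.2 (body hA' hB' (s.sub _)) (body hA hB s)
    (F.map σ) (F.map ((splitCat adj M).up σ A)) e₁.symm e₂.symm ?_ ?_
  · exact (F.map_comp _ _).symm.trans ((congrArg F.map (TypeCat.up_p _ σ A)).trans (F.map_comp _ _))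
  · subst e₃
    exact (map_secSub s _).symm

variable [HasFiniteLimits C]

section

variable (S : ∀ {Γ : C} (A : M.Ty Γ) (B : M.Ty (M.ext A)), M.PiData A B)

/-- The chosen dependent product. -/
noncomputable def formPi {Γ : E} (A : (splitCat adj M).Ty Γ)
    (B : (splitCat adj M).Ty ((splitCat adj M).ext A)) : (splitCat adj M).PiData A B :=
  mkPi (S (famDom (top A) (base B)) (famCod (top A) (top B))) (cls_famGen A B) (cls_famGen' A B)

theorem formPi_sub {Θ Γ : E} (σ : Θ ⟶ Γ) (A : (splitCat adj M).Ty Γ)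
    (B : (splitCat adj M).Ty ((splitCat adj M).ext A)) :
    formPi S ((splitCat adj M).sub σ A) ((splitCat adj M).sub ((splitCat adj M).up σ A) B)
      = (formPi S A B).reindex σ := by
  refine Eq.trans ?_ (mkPi_reindex _ _ _ σ).symm
  exact mkPi_congr _ _ _ _ _ (famName_sub A B σ) (famGen_sub A B σ) (famGen'_sub A B σ)

/-- The chosen dependent products, with chosen abstractions. -/
noncomputable def piOf (H : ∀ {Γ : C} (A : M.Ty Γ) (B : M.Ty (M.ext A)) {Θ : C} (σ : Θ ⟶ Γ),
    ((S A B).reindex σ).IsPi) : (splitCat adj M).StrictPi where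
  form := formPi S
  form_sub := formPi_sub S
  lam _ hX s := lamOf _ (H _ _) (cls_famGen _ _) (cls_famGen' _ _) hX s
  beta _ hX s := (isLam_iff _ _ _ hX _ s).1 (isLam_lamOf _ (H _ _) _ _ hX s)
  lam_sub := @fun _ _ σ A B _ hX hX' s => lamOf_sub _ (H _ _) (cls_famGen A B) (cls_famGen' A B) hX σ
    (cls_famGen _ _) (cls_famGen' _ _) (famName_sub A B σ) (famGen_sub A B σ) (famGen'_sub A B σ) hX' s

end

theorem strictPi (h : M.WeakPi) : Nonempty (splitCat adj M).StrictPi := by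
  choose S hS using @h
  exact ⟨piOf S hS⟩

/-- Both `f` and the abstraction of its application have names that are abstractions of one body in
`C`, and those are unique. -/
theorem strictPiEta (h : M.WeakPiEta) : Nonempty (splitCat adj M).StrictPiEta := by
  choose S hS using @h
  have H : ∀ {Γ : C} (A : M.Ty Γ) (B : M.Ty (M.ext A)) {Θ : C} (σ : Θ ⟶ Γ),
    ((S A B).reindex σ).IsPi := fun A B _ σ b => (hS A B σ b).exists
  exact ⟨{
    toStrictPi := piOf S H
    eta := @fun _ A B _ hX f => (cls_genOf (ty_mkPi _ hX)).lift_ext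
      ((isLam_lamOf _ (H _ _) (cls_famGen A B) (cls_famGen' A B) hX _).unique (hS _ _)
        ((isLam_iff _ _ _ hX f _).2 rfl)) }⟩

end Pi

end splitCat

end Restricted

/-! ### W-types -/

namespace TypeCat.WData

variable {C : Type u} [Category.{v} C] {M : TypeCat.{v, u, w} C} {Y : C} {a : M.Ty Y}
  {b : M.Ty (M.ext a)}

/-- The arguments of the introduction rule. -/
structure Node (X : M.WData a b) where
  Z : C
  z : Z ⟶ M.ext a
  Q : C
  q₁ : Q ⟶ M.ext b
  q₂ : Q ⟶ Z
  hQ : IsPullback q₁ q₂ (M.p b) z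
  f : Q ⟶ M.ext X.ty
  hf : f ≫ M.p X.ty = q₂ ≫ z ≫ M.p a

namespace Node

variable {X : M.WData a b}

/-- The value of the introduction rule. -/
noncomputable def sup (x : Node X) : x.Z ⟶ M.ext X.ty :=
  (X.sup x.z ⟨x.hQ.lift (M.up x.z b) (M.p _) (M.up_p x.z b) ≫ x.f, by
    rw [Category.assoc, x.hf, ← Category.assoc, x.hQ.lift_snd]⟩).hom

theorem sup_p (x : Node X) : x.sup ≫ M.p X.ty = x.z ≫ M.p a := Lift.w _

/-- Naturality of the introduction rule, freed from the chosen comprehensions: a node may use any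
pullback of `b`, in particular the image under `F` of a comprehension in `E`. -/
theorem sup_comp {x y : Node X} (r : x.Z ⟶ y.Z) (ρ : x.Q ⟶ y.Q) (h₁ : r ≫ y.z = x.z)
    (h₂ : ρ ≫ y.q₁ = x.q₁) (h₃ : ρ ≫ y.q₂ = x.q₂ ≫ r) (h₄ : ρ ≫ y.f = x.f) :
    x.sup = r ≫ y.sup := by
  refine Eq.trans ?_ (X.sup_natural r y.z _)
  refine X.sup_congr h₁.symm _ _ ?_
  simp only [Lift.precomp]
  rw [← h₄]
  simp only [← Category.assoc]
  congr 1
  apply y.hQ.hom_ext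
  · simp only [Category.assoc, h₂, IsPullback.lift_fst, M.slide_up, cast_up]
  · simp only [Category.assoc, h₃, IsPullback.lift_snd, IsPullback.lift_snd_assoc, M.slide_p,
      cast_p_assoc]

end Node

variable (X : M.WData a b) {W : C} (π : W ⟶ Y) (T : M.Ty (M.ext (M.sub π X.ty)))

/-- The arguments of the premise of the elimination rule. -/
structure Arg where
  Z : C
  g : Z ⟶ W
  z : Z ⟶ M.ext a
  hg : z ≫ M.p a = g ≫ π
  Q : C
  q₁ : Q ⟶ M.ext b
  q₂ : Q ⟶ Z
  hQ : IsPullback q₁ q₂ (M.p b) z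
  h : Q ⟶ M.ext T
  hh : h ≫ M.p T ≫ M.p (M.sub π X.ty) = q₂ ≫ g

namespace Arg

variable {X π T}

/-- The underlying arguments of the introduction rule. -/
noncomputable abbrev node (e : Arg X π T) : Node X where
  Z := e.Z
  z := e.z
  Q := e.Q
  q₁ := e.q₁
  q₂ := e.q₂
  hQ := e.hQ
  f := e.h ≫ M.p T ≫ M.up π X.ty
  hf := by
    rw [Category.assoc, Category.assoc, M.up_p, e.hg, ← Category.assoc, ← Category.assoc,
      Category.assoc e.h, e.hh, Category.assoc]

/-- The value of the introduction rule. -/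
noncomputable def res (e : Arg X π T) : e.Z ⟶ M.ext (M.sub π X.ty) :=
  M.pair π X.ty e.g e.node.sup (by rw [e.node.sup_p, e.hg])

theorem res_p (e : Arg X π T) : e.res ≫ M.p (M.sub π X.ty) = e.g := M.pair_p _ _ _ _ _

theorem res_up (e : Arg X π T) : e.res ≫ M.up π X.ty = e.node.sup := M.pair_up _ _ _ _ _

/-- Morphisms of arguments. -/
structure Hom (e e' : Arg X π T) (w : e.Z ⟶ e'.Z) (l : e.Q ⟶ e'.Q) : Prop where
  g : w ≫ e'.g = e.g
  z : w ≫ e'.z = e.z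
  q₁ : l ≫ e'.q₁ = e.q₁
  q₂ : l ≫ e'.q₂ = e.q₂ ≫ w
  h : l ≫ e'.h = e.h

theorem Hom.trans {e e' e'' : Arg X π T} {w w' l l'} (H : Hom e e' w l) (H' : Hom e' e'' w' l') :
    Hom e e'' (w ≫ w') (l ≫ l') where
  g := by rw [Category.assoc, H'.g, H.g]
  z := by rw [Category.assoc, H'.z, H.z]
  q₁ := by rw [Category.assoc, H'.q₁, H.q₁]
  q₂ := by rw [Category.assoc, H'.q₂, reassoc_of% H.q₂]
  h := by rw [Category.assoc, H'.h, H.h]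

theorem Hom.res {e e' : Arg X π T} {w l} (H : Hom e e' w l) : e.res = w ≫ e'.res := by
  apply M.hom_ext
  · rw [Category.assoc, res_p, res_p, H.g]
  · rw [Category.assoc, res_up, res_up]
    exact Node.sup_comp (x := e.node) (y := e'.node) w l H.z H.q₁ H.q₂ (by
      dsimp only
      rw [← H.h, Category.assoc])

variable (X π T) in
/-- The arguments of the premise of the elimination rule are representable. -/
theorem exists_generic [HasFiniteLimits C] [HasPushes C] : ∃ e₀ : Arg X π T, ∀ e : Arg X π T,
    ∃! w : e.Z ⟶ e₀.Z, ∃ l : e.Q ⟶ e₀.Q, Hom e e₀ w l := by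
  let B := M.sub (M.up π a) b
  let f₁ : M.ext B ⟶ W := M.p B ≫ M.p (M.sub π a)
  let f₂ : M.ext T ⟶ W := M.p T ≫ M.p (M.sub π X.ty)
  -- Arguments are a point `(g, z)` of the comprehension of `a[π]` and a family of elements of `T`
  -- over the fibre of `b`. They are represented by the pushforward along `M.p B` of the pullback of
  -- `T` over `W`, a polynomial functor applied to `T`.
  obtain ⟨W', P, ϖ, p₁, p₂, ev, h⟩ := HasPushes.exists_isPush (pullback.fst f₁ f₂) (M.p B)
  have hB : IsPullback (M.up (M.up π a) b) (M.p B) (M.p b) (M.up π a) := M.isPullback _ _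
  refine ⟨{
    Z := W'
    g := ϖ ≫ M.p (M.sub π a)
    z := ϖ ≫ M.up π a
    hg := by rw [Category.assoc, Category.assoc, M.up_p]
    Q := P
    q₁ := p₁ ≫ M.up (M.up π a) b
    q₂ := p₂
    hQ := h.isPullback.flip.flip.paste_horiz hB
    h := ev ≫ pullback.snd f₁ f₂
    hh := by
      have e₁ : pullback.snd f₁ f₂ ≫ M.p T ≫ M.p (M.sub π X.ty) = pullback.fst f₁ f₂ ≫ f₁ :=
        pullback.condition.symm
      rw [Category.assoc, e₁, ← Category.assoc, h.ev_q, ← Category.assoc, h.isPullback.w,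
        Category.assoc] }, fun e => ?_⟩
  let ζ : e.Z ⟶ M.ext (M.sub π a) := M.pair π a e.g e.z e.hg
  have hζ₁ : ζ ≫ M.p (M.sub π a) = e.g := M.pair_p _ _ _ _ _
  have hζ₂ : ζ ≫ M.up π a = e.z := M.pair_up _ _ _ _ _
  let a' : e.Q ⟶ M.ext B := M.pair (M.up π a) b (e.q₂ ≫ ζ) e.q₁ (by
    rw [Category.assoc, hζ₂, e.hQ.w])
  have ha₁ : a' ≫ M.p B = e.q₂ ≫ ζ := M.pair_p _ _ _ _ _
  have ha₂ : a' ≫ M.up (M.up π a) b = e.q₁ := M.pair_up _ _ _ _ _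
  have sq : IsPullback a' e.q₂ (M.p B) ζ :=
    IsPullback.of_right (e.hQ.congr ha₂.symm rfl rfl hζ₂.symm) ha₁ hB
  have hk : a' ≫ f₁ = e.h ≫ f₂ := by
    rw [← Category.assoc, ha₁, Category.assoc, hζ₁]
    exact e.hh.symm
  obtain ⟨w, ⟨hw, l, hl₁, hl₂, hl₃⟩, hu⟩ :=
    h.existsUnique sq (pullback.lift a' e.h hk) (pullback.lift_fst _ _ _)
  refine ⟨w, ⟨l, ?_, ?_, ?_, hl₂, ?_⟩, ?_⟩
  · rw [reassoc_of% hw, hζ₁]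
  · rw [reassoc_of% hw, hζ₂]
  · rw [reassoc_of% hl₁, ha₂]
  · rw [reassoc_of% hl₃, pullback.lift_snd]
  · rintro w' ⟨l', H⟩
    have e₁ : w' ≫ ϖ = ζ := by
      apply M.hom_ext
      · rw [hζ₁, Category.assoc]
        exact H.g
      · rw [hζ₂, Category.assoc]
        exact H.z
    have e₂ : l' ≫ p₁ = a' := by
      apply M.hom_ext
      · have := H.q₂
        dsimp only at this
        refine (Category.assoc _ _ _).trans (Eq.trans ?_ ha₁.symm)
        refine (congrArg (l' ≫ ·) h.isPullback.w).trans ?_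
        rw [← Category.assoc, this, Category.assoc, e₁]
      · rw [ha₂, Category.assoc]
        exact H.q₁
    refine hu w' ⟨e₁, l', e₂, H.q₂, ?_⟩
    apply pullback.hom_ext
    · rw [Category.assoc, h.ev_q, pullback.lift_fst, e₂]
    · rw [Category.assoc, pullback.lift_snd]
      exact H.h

end Arg

variable {X π T}

/-- An instance of the elimination rule: the premise is given by its value `st` at the arguments
`e₀`. -/
structure StepProblem (e₀ : Arg X π T) where
  Z : C
  r : Z ⟶ W
  P : C
  ρ : P ⟶ M.ext (M.sub π X.ty)
  v : P ⟶ Z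
  hP : IsPullback ρ v (M.p (M.sub π X.ty)) r
  Z' : C
  s₁ : Z' ⟶ e₀.Z
  s₂ : Z' ⟶ Z
  hZ : IsPullback s₁ s₂ e₀.g r
  st : Z' ⟶ M.ext T
  hst : st ≫ M.p T = s₁ ≫ e₀.res

namespace StepProblem

variable {e₀ : Arg X π T}

/-- The conclusion of the elimination rule, with its computation rule. -/
def IsSolution (x : StepProblem e₀) (s : x.P ⟶ M.ext T) : Prop :=
  s ≫ M.p T = x.ρ ∧ ∀ (e : Arg X π T) (m : e.Z ⟶ x.Z') (l : e.Q ⟶ e₀.Q) (k : e.Q ⟶ x.P)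
    (j : e.Z ⟶ x.P), Arg.Hom e e₀ (m ≫ x.s₁) l → k ≫ s = e.h → k ≫ x.v = e.q₂ ≫ m ≫ x.s₂ →
    j ≫ x.ρ = e.res → j ≫ x.v = m ≫ x.s₂ → j ≫ s = m ≫ x.st

/-- Morphisms of instances of the elimination rule. -/
structure Restr (x y : StepProblem e₀) (r : x.Z ⟶ y.Z) (ρ : x.P ⟶ y.P) (ζ : x.Z' ⟶ y.Z') :
    Prop where
  hr : r ≫ y.r = x.r
  hρ : ρ ≫ y.ρ = x.ρ
  hv : ρ ≫ y.v = x.v ≫ r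
  hs₁ : ζ ≫ y.s₁ = x.s₁
  hs₂ : ζ ≫ y.s₂ = x.s₂ ≫ r
  hst : ζ ≫ y.st = x.st

theorem Restr.trans {x y z : StepProblem e₀} {r r' ρ ρ' ζ ζ'} (H : Restr x y r ρ ζ)
    (H' : Restr y z r' ρ' ζ') : Restr x z (r ≫ r') (ρ ≫ ρ') (ζ ≫ ζ') where
  hr := by rw [Category.assoc, H'.hr, H.hr]
  hρ := by rw [Category.assoc, H'.hρ, H.hρ]
  hv := by rw [Category.assoc, H'.hv, reassoc_of% H.hv]
  hs₁ := by rw [Category.assoc, H'.hs₁, H.hs₁]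
  hs₂ := by rw [Category.assoc, H'.hs₂, reassoc_of% H.hs₂]
  hst := by rw [Category.assoc, H'.hst, H.hst]

theorem Restr.isSolution {x y : StepProblem e₀} {r ρ ζ} (H : Restr x y r ρ ζ) {s : y.P ⟶ M.ext T}
    (hs : y.IsSolution s) : x.IsSolution (ρ ≫ s) := by
  refine ⟨by rw [Category.assoc, hs.1, H.hρ], fun e m l k j hl h₁ h₂ h₃ h₄ => ?_⟩
  rw [← Category.assoc, hs.2 e (m ≫ ζ) l (k ≫ ρ) (j ≫ ρ) (by rwa [Category.assoc, H.hs₁])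
    (by rw [Category.assoc, h₁]) (by rw [Category.assoc, H.hv, reassoc_of% h₂, Category.assoc, H.hs₂])
    (by rw [Category.assoc, H.hρ, h₃])
    (by rw [Category.assoc, H.hv, reassoc_of% h₄, Category.assoc, H.hs₂]), Category.assoc, H.hst]

variable (e₀) in
/-- There is a universal instance of the elimination rule. -/
theorem exists_universal [HasPushes C] : ∃ G : StepProblem e₀, ∀ x : StepProblem e₀,
    (∃ r ρ ζ, Restr x G r ρ ζ) ∧
      ∀ r r' ρ ρ' ζ ζ', Restr x G r ρ ζ → Restr x G r' ρ' ζ' → r = r' := by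
  -- A premise over `r` is a section of `T[res]` over the pullback of the generic arguments along
  -- `r`, so it is classified by a pushforward along `e₀.g`.
  obtain ⟨W₂, P₂, π₂, p₁, p₂, ev, h⟩ :=
    HasPushes.exists_isPush (M.p (M.sub e₀.res T)) e₀.g
  let G : StepProblem e₀ := {
    Z := W₂
    r := π₂
    P := M.ext (M.sub π₂ (M.sub π X.ty))
    ρ := M.up _ _
    v := M.p _
    hP := M.isPullback _ _
    Z' := P₂
    s₁ := p₁
    s₂ := p₂
    hZ := h.isPullback
    st := ev ≫ M.up _ _
    hst := by rw [Category.assoc, M.up_p, ← Category.assoc, h.ev_q] }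
  refine ⟨G, fun x => ⟨?_, ?_⟩⟩
  · obtain ⟨r, ⟨hr, l, h₁, h₂, h₃⟩, -⟩ := h.existsUnique x.hZ
      (M.pair e₀.res T x.s₁ x.st x.hst) (M.pair_p _ _ _ _ _)
    refine ⟨r, M.pair π₂ (M.sub π X.ty) (x.v ≫ r) x.ρ (by rw [Category.assoc, hr, x.hP.w]), l, hr,
      M.pair_up _ _ _ _ _, M.pair_p _ _ _ _ _, h₁, h₂, ?_⟩
    rw [reassoc_of% h₃, M.pair_up]
  · intro r r' ρ ρ' ζ ζ' H H'
    have key : ∀ {r ρ} {ζ : x.Z' ⟶ P₂} (H : Restr x G r ρ ζ), ζ ≫ ev = M.pair e₀.res T x.s₁ x.st x.hst := by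
      intro r ρ ζ H
      apply M.hom_ext
      · rw [M.pair_p, Category.assoc, h.ev_q]
        exact H.hs₁
      · rw [M.pair_up, Category.assoc]
        exact H.hst
    exact (h.existsUnique x.hZ _ (M.pair_p _ _ _ _ _)).unique ⟨H.hr, ζ, H.hs₁, H.hs₂, key H⟩
      ⟨H'.hr, ζ', H'.hs₁, H'.hs₂, key H'⟩

theorem isPullback_base (x : StepProblem e₀) :
    IsPullback (x.ρ ≫ M.up π X.ty) x.v (M.p X.ty) (x.r ≫ π) :=
  x.hP.paste_horiz (M.isPullback π X.ty)

/-- The comparison of the comprehension of the W-type with the given pullback. -/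
noncomputable def φ (x : StepProblem e₀) : M.ext (M.sub (x.r ≫ π) X.ty) ≅ x.P :=
  (M.isPullback (x.r ≫ π) X.ty).isoIsPullback _ _ x.isPullback_base

theorem φ_up (x : StepProblem e₀) : x.φ.hom ≫ x.ρ ≫ M.up π X.ty = M.up (x.r ≫ π) X.ty :=
  (M.isPullback (x.r ≫ π) X.ty).isoIsPullback_hom_fst _ _ x.isPullback_base

theorem φ_v (x : StepProblem e₀) : x.φ.hom ≫ x.v = M.p (M.sub (x.r ≫ π) X.ty) :=
  (M.isPullback (x.r ≫ π) X.ty).isoIsPullback_hom_snd _ _ x.isPullback_base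

/-- The motive of an instance of the elimination rule. -/
noncomputable abbrev motive (x : StepProblem e₀) : M.Ty (M.ext (M.sub (x.r ≫ π) X.ty)) :=
  M.sub (x.φ.hom ≫ x.ρ) T

section Args

variable (x : StepProblem e₀) {Θ : C} (z : Θ ⟶ M.ext (M.sub (x.r ≫ π) a))
  (f : M.Lift (M.p (M.sub z (M.sub (M.up (x.r ≫ π) a) b)) ≫ z ≫ M.p (M.sub (x.r ≫ π) a))
    (M.sub (x.r ≫ π) X.ty)) (h : M.Lift f.hom x.motive)

/-- The introduction rule for the reindexed W-type. -/
noncomputable def sup : M.Lift (z ≫ M.p (M.sub (x.r ≫ π) a)) (M.sub (x.r ≫ π) X.ty) :=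
  (X.reindex (x.r ≫ π)).sup z f

theorem sup_up : (x.sup z f).hom ≫ M.up (x.r ≫ π) X.ty
    = (X.sup (z ≫ M.up (x.r ≫ π) a) (WData.arg (x.r ≫ π) z f)).hom :=
  (M.pair_up _ _ _ _ _).trans (Category.id_comp _)

theorem motive_p : h.hom ≫ M.up (x.φ.hom ≫ x.ρ) T ≫ M.p T = f.hom ≫ x.φ.hom ≫ x.ρ := by
  rw [M.up_p, ← Category.assoc, h.w]

/-- The arguments of the premise of the elimination rule for the reindexed W-type. -/
noncomputable abbrev arg : Arg X π T where
  Z := Θ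
  g := z ≫ M.p _ ≫ x.r
  z := z ≫ M.up _ _
  hg := by rw [Category.assoc, M.up_p, Category.assoc, Category.assoc]
  Q := _
  q₁ := M.up z _ ≫ M.up (M.up (x.r ≫ π) a) b
  q₂ := M.p _
  hQ := (M.isPullback _ _).paste_horiz (M.isPullback _ _)
  h := h.hom ≫ M.up _ _
  hh := by
    rw [Category.assoc, ← Category.assoc (M.up _ T), ← Category.assoc h.hom, motive_p,
      Category.assoc, Category.assoc, x.hP.w, ← Category.assoc x.φ.hom, φ_v, ← Category.assoc, f.w,
      Category.assoc, Category.assoc]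

/-- Over `W` both have the same base point. In the W-type over `Y` both are introductions from the
same arguments; only the pullback of `b` on which these are written differs. -/
theorem arg_res : (x.arg z f h).res = (x.sup z f).hom ≫ x.φ.hom ≫ x.ρ := by
  apply M.hom_ext
  · rw [Arg.res_p, Category.assoc, Category.assoc, x.hP.w, ← Category.assoc x.φ.hom, φ_v,
      ← Category.assoc, Lift.w, Category.assoc]
  · rw [Arg.res_up, Category.assoc, Category.assoc, φ_up, sup_up]
    refine X.sup_congr rfl _ _ ?_
    refine Eq.trans ?_ (Category.id_comp _).symm
    have e : (h.hom ≫ M.up (x.φ.hom ≫ x.ρ) T) ≫ M.p T ≫ M.up π X.ty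
        = f.hom ≫ M.up (x.r ≫ π) X.ty := by
      rw [Category.assoc, ← Category.assoc (M.up _ T), ← Category.assoc h.hom, motive_p,
        Category.assoc, Category.assoc, φ_up]
    refine (congrArg (IsPullback.lift _ _ _ _ ≫ ·) e).trans (congrArg (· ≫ _) ?_)
    apply (x.arg z f h).hQ.hom_ext
    · refine (IsPullback.lift_fst _ _ _ _).trans ?_
      refine Eq.trans ?_ (Category.assoc _ _ _)
      refine Eq.trans ?_ (congrArg (· ≫ _) (M.pair_up _ _ _ _ _)).symm
      exact (M.pair_up _ _ _ _ _).symm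
    · exact (IsPullback.lift_snd _ _ _ _).trans (resub_p _ _).symm

variable (he₀ : ∀ e : Arg X π T, ∃! w : e.Z ⟶ e₀.Z, ∃ l : e.Q ⟶ e₀.Q, Arg.Hom e e₀ w l)

-- The arguments `z`, `f`, `h` are classified by a map to `e₀.Z`. Together with the map to the
-- context this is a point of the pullback `Z'`, where `st` can be evaluated.
include he₀ in
theorem existsUnique_point : ∃! m : Θ ⟶ x.Z', m ≫ x.s₂ = z ≫ M.p _ ∧
    ∃ l : (x.arg z f h).Q ⟶ e₀.Q, Arg.Hom (x.arg z f h) e₀ (m ≫ x.s₁) l := by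
  obtain ⟨w, ⟨l, hl⟩, hw⟩ := he₀ (x.arg z f h)
  have e : w ≫ e₀.g = (z ≫ M.p _) ≫ x.r := hl.g.trans (Category.assoc _ _ _).symm
  refine ⟨x.hZ.lift w (z ≫ M.p _) e, ⟨x.hZ.lift_snd _ _ e, l, ?_⟩, ?_⟩
  · rwa [x.hZ.lift_fst]
  · rintro m ⟨h₁, l', h₂⟩
    apply x.hZ.hom_ext
    · rw [x.hZ.lift_fst]
      exact hw _ ⟨l', h₂⟩
    · rw [x.hZ.lift_snd, h₁]

/-- The point that corresponds to the arguments. -/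
noncomputable def point : Θ ⟶ x.Z' := (x.existsUnique_point z f h he₀).choose

theorem point_s₂ : x.point z f h he₀ ≫ x.s₂ = z ≫ M.p _ :=
  (x.existsUnique_point z f h he₀).choose_spec.1.1

theorem exists_point_hom : ∃ l : (x.arg z f h).Q ⟶ e₀.Q,
    Arg.Hom (x.arg z f h) e₀ (x.point z f h he₀ ≫ x.s₁) l :=
  (x.existsUnique_point z f h he₀).choose_spec.1.2

theorem point_unique {m : Θ ⟶ x.Z'} (hm : m ≫ x.s₂ = z ≫ M.p _)
    (l : (x.arg z f h).Q ⟶ e₀.Q) (hl : Arg.Hom (x.arg z f h) e₀ (m ≫ x.s₁) l) :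
    m = x.point z f h he₀ :=
  (x.existsUnique_point z f h he₀).choose_spec.2 _ ⟨hm, l, hl⟩

theorem point_st : x.point z f h he₀ ≫ x.st ≫ M.p T = (x.sup z f).hom ≫ x.φ.hom ≫ x.ρ := by
  obtain ⟨l, hl⟩ := x.exists_point_hom z f h he₀
  rw [x.hst, ← arg_res, hl.res, Category.assoc]

/-- The restricted point classifies the restricted arguments, so uniqueness applies. This makes the
operation built from `st` natural. -/
theorem point_comp {Ξ : C} (t : Ξ ⟶ Θ) :
    x.point (t ≫ z) (f.precomp (M.slide t z _) _ (by simp)) (h.precomp (M.slide t z _) _ rfl) he₀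
      = t ≫ x.point z f h he₀ := by
  obtain ⟨l, hl⟩ := x.exists_point_hom z f h he₀
  refine (x.point_unique (t ≫ z) (f.precomp (M.slide t z _) _ (by simp))
    (h.precomp (M.slide t z _) _ rfl) he₀ ?_ (M.slide t z _ ≫ l) ?_).symm
  · rw [Category.assoc, point_s₂, Category.assoc]
  · refine (congrArg (fun w => Arg.Hom _ e₀ w _) (Category.assoc _ _ _)).mpr
      (Arg.Hom.trans (e' := x.arg z f h) ⟨?_, ?_, ?_, ?_, ?_⟩ hl)
    · exact (Category.assoc _ _ _).symm
    · exact (Category.assoc _ _ _).symm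
    · exact (Category.assoc _ _ _).symm.trans (congrArg (· ≫ _) (M.slide_up _ _ _))
    · exact M.slide_p _ _ _
    · exact (Category.assoc _ _ _).symm

/-- The premise of the elimination rule for the reindexed W-type. -/
noncomputable def step : (X.reindex (x.r ≫ π)).Step x.motive where
  op z f h := ⟨M.pair (x.φ.hom ≫ x.ρ) T (x.sup z f).hom (x.point z f h he₀ ≫ x.st)
    ((Category.assoc _ _ _).trans (x.point_st z f h he₀)), M.pair_p _ _ _ _ _⟩
  natural t z f h := by
    apply M.hom_ext
    · refine (M.pair_p _ _ _ _ _).trans (Eq.trans ?_ (Category.assoc _ _ _).symm)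
      exact ((X.reindex (x.r ≫ π)).sup_natural t z f).trans
        (congrArg (t ≫ ·) (M.pair_p _ _ _ _ _)).symm
    · refine (M.pair_up _ _ _ _ _).trans (Eq.trans ?_ (Category.assoc _ _ _).symm)
      refine Eq.trans ?_ (congrArg (t ≫ ·) (M.pair_up _ _ _ _ _)).symm
      exact (congrArg (· ≫ x.st) (x.point_comp z f h he₀ t)).trans (Category.assoc _ _ _)

theorem isSolution_of_computes (s : M.Sec x.motive)
    (comp : ∀ {Θ : C} (z : Θ ⟶ M.ext (M.sub (x.r ≫ π) a))
      (f : M.Lift (M.p (M.sub z (M.sub (M.up (x.r ≫ π) a) b)) ≫ z ≫ M.p (M.sub (x.r ≫ π) a))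
        (M.sub (x.r ≫ π) X.ty)), (x.sup z f).hom ≫ s.hom
      = ((x.step he₀).op z f (s.precomp f.hom _ (Category.comp_id _))).hom) :
    x.IsSolution (x.φ.inv ≫ s.hom ≫ M.up _ T) := by
  have hs₀ : s.hom ≫ M.p x.motive = 𝟙 _ := s.w
  have hs₁ : (x.φ.inv ≫ s.hom ≫ M.up _ T) ≫ M.p T = x.ρ := by
    rw [Category.assoc, Category.assoc, M.up_p, ← Category.assoc s.hom, hs₀, Category.id_comp,
      Iso.inv_hom_id_assoc]
  refine ⟨hs₁, fun e m l k j hl h₁ h₂ h₃ h₄ => ?_⟩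
  have hg : e.g = m ≫ x.s₂ ≫ x.r := by rw [← x.hZ.w, ← Category.assoc, hl.g]
  let z : e.Z ⟶ M.ext (M.sub (x.r ≫ π) a) := M.pair (x.r ≫ π) a (m ≫ x.s₂) e.z (by
    rw [e.hg, hg, Category.assoc, Category.assoc, Category.assoc])
  have hz₁ : z ≫ M.p _ = m ≫ x.s₂ := M.pair_p _ _ _ _ _
  have hz₂ : z ≫ M.up _ _ = e.z := M.pair_up _ _ _ _ _
  have sq : IsPullback (M.up z (M.sub (M.up (x.r ≫ π) a) b) ≫ M.up (M.up (x.r ≫ π) a) b) (M.p _)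
      (M.p b) e.z := ((M.isPullback _ _).paste_horiz (M.isPullback _ _)).congr rfl rfl rfl hz₂
  -- The solution property is tested on arbitrary arguments `e`, whereas the computation rule
  -- concerns chosen comprehensions; `ψ` compares the pullbacks of `b`.
  let ψ := e.hQ.lift _ _ sq.w
  have hψ₁ : ψ ≫ e.q₁ = M.up z _ ≫ M.up (M.up (x.r ≫ π) a) b := e.hQ.lift_fst _ _ _
  have hψ₂ : ψ ≫ e.q₂ = M.p _ := e.hQ.lift_snd _ _ _
  let f : M.Lift (M.p (M.sub z (M.sub (M.up (x.r ≫ π) a) b)) ≫ z ≫ M.p (M.sub (x.r ≫ π) a))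
      (M.sub (x.r ≫ π) X.ty) := ⟨ψ ≫ k ≫ x.φ.inv, by
    rw [Category.assoc, Category.assoc, ← φ_v, Iso.inv_hom_id_assoc, h₂, ← Category.assoc, hψ₂,
      hz₁]⟩
  let h : M.Lift f.hom x.motive := s.precomp f.hom _ (Category.comp_id _)
  have key : Arg.Hom (x.arg z f h) e (𝟙 _) ψ := by
    refine ⟨?_, ?_, hψ₁, ?_, ?_⟩
    · refine (Category.id_comp _).trans ?_
      rw [hg, ← Category.assoc, ← hz₁, Category.assoc]
    · exact (Category.id_comp _).trans hz₂.symm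
    · exact hψ₂.trans (Category.comp_id _).symm
    · rw [← h₁]
      dsimp only [h, f, Lift.precomp]
      simp only [Category.assoc]
  -- The same arguments in two presentations have the same classifying point.
  have hm : m = x.point z f h he₀ := by
    refine x.point_unique z f h he₀ hz₁.symm (ψ ≫ l) ?_
    exact (congrArg (fun w => Arg.Hom _ e₀ w _) (Category.id_comp _)).mp (key.trans hl)
  have hj : j = (x.sup z f).hom ≫ x.φ.hom := by
    apply x.hP.hom_ext
    · rw [h₃, Category.assoc, ← arg_res _ _ _ h, key.res, Category.id_comp]
    · rw [h₄, Category.assoc, φ_v, Lift.w, hz₁]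
  rw [hj, Category.assoc, Iso.hom_inv_id_assoc, ← Category.assoc, comp, hm]
  exact M.pair_up _ _ _ _ _

include he₀ in
theorem exists_isSolution (hX : (X.reindex (x.r ≫ π)).IsW) : ∃ s, x.IsSolution s := by
  obtain ⟨s, hs⟩ := hX x.motive (x.step he₀)
  exact ⟨_, x.isSolution_of_computes he₀ s hs⟩

end Args

/-- Solutions can be chosen naturally. -/
theorem exists_natural_solution [HasPushes C] (hX : ∀ {Θ : C} (σ : Θ ⟶ Y), (X.reindex σ).IsW)
    (he₀ : ∀ e : Arg X π T, ∃! w : e.Z ⟶ e₀.Z, ∃ l : e.Q ⟶ e₀.Q, Arg.Hom e e₀ w l) :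
    ∃ sol : ∀ x : StepProblem e₀, x.P ⟶ M.ext T,
      (∀ x : StepProblem e₀, x.IsSolution (sol x)) ∧
      ∀ (x y : StepProblem e₀) r ρ ζ, Restr x y r ρ ζ → sol x = ρ ≫ sol y := by
  -- As for lifting problems, the universal instance is solved once and its solution is restricted.
  obtain ⟨G, hG⟩ := exists_universal e₀
  obtain ⟨s, hs⟩ := G.exists_isSolution he₀ (hX _)
  choose r ρ ζ h using fun x => (hG x).1
  refine ⟨fun x => ρ x ≫ s, fun x => (h x).isSolution hs, fun x y r' ρ' ζ' H => ?_⟩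
  dsimp only
  rw [← Category.assoc]
  congr 1
  apply G.hP.hom_ext
  · rw [(h x).hρ, Category.assoc, (h y).hρ, H.hρ]
  · rw [(h x).hv, Category.assoc, (h y).hv, reassoc_of% H.hv,
      (hG x).2 _ _ _ _ _ _ (h x) (H.trans (h y))]

end StepProblem

end TypeCat.WData

/-! ### Formation and introduction of W-types in the restricted splitting -/

section Restricted

variable {C : Type u} [Category.{v} C] {E : Type u} [Category.{v} E] [HasPullbacks E]
  {F : E ⥤ C} {R : C ⥤ E} {adj : F ⊣ R} {M : TypeCat.{v, u, w} C}

/-- Pullbacks along maps from the image of a localization are in the image. -/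
theorem exists_isLocalMap_isPullback [HasPullbacks C] [PreservesFiniteLimits F] [R.Full]
    [R.Faithful] (adj : F ⊣ R) {Γ : E} {Z W : C} (g : Z ⟶ W) (r : F.obj Γ ⟶ W) :
    ∃ (Θ : E) (m : Θ ⟶ Γ) (s : F.obj Θ ⟶ Z), IsLocalMap adj m ∧ IsPullback s (F.map m) g r := by
  let p₀ := pullback.snd g r
  have sq₁ := (IsPullback.of_hasPullback (R.map p₀) (adj.unit.app Γ)).map F
  have sq₂ : IsPullback (adj.counit.app _) (F.map (R.map p₀)) p₀ (adj.counit.app _) :=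
    IsPullback.of_horiz_isIso ⟨by simp⟩
  have sq₃ := (sq₁.paste_horiz sq₂).paste_horiz (IsPullback.of_hasPullback g r)
  have e₁ : (F.map (adj.unit.app Γ) ≫ adj.counit.app (F.obj Γ)) ≫ r = r :=
    (congrArg (· ≫ r) (adj.left_triangle_components Γ)).trans (Category.id_comp _)
  exact ⟨_, _, _, IsPullbackOfImage.isLocalMap adj ⟨_, _, p₀, _, _, IsPullback.of_hasPullback _ _⟩,
    sq₃.congr rfl rfl rfl e₁⟩

namespace splitCat

section W

open TypeCat.WData (Node Arg StepProblem)

variable [PreservesFiniteLimits F] [R.Full] [R.Faithful] {Y : C} {a : M.Ty Y} {b : M.Ty (M.ext a)}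
  (X : M.WData a b) {Γ : E} {A : (splitCat adj M).Ty Γ}
  {B : (splitCat adj M).Ty ((splitCat adj M).ext A)} {χ : F.obj Γ ⟶ Y}
  {α : F.obj ((splitCat adj M).ext A) ⟶ M.ext a} {β : F.obj ((splitCat adj M).ext B) ⟶ M.ext b}

/-- The names of arguments of the introduction rule. -/
noncomputable abbrev node (hA : Cls adj A a χ α) (hB : Cls adj B b α β)
    {T : (splitCat adj M).Ty Γ} (hT : T = mk X.ty χ) {Θ : E} (z : Θ ⟶ (splitCat adj M).ext A)
    (f : (splitCat adj M).Lift
      ((splitCat adj M).p ((splitCat adj M).sub z B) ≫ z ≫ (splitCat adj M).p A) T) : Node X where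
  Z := F.obj Θ
  z := F.map z ≫ α
  Q := F.obj ((splitCat adj M).ext ((splitCat adj M).sub z B))
  q₁ := F.map ((splitCat adj M).up z B) ≫ β
  q₂ := F.map ((splitCat adj M).p _)
  hQ := hB.sub z
  f := F.map f.hom ≫ genOf hT
  hf := by
    refine (Category.assoc _ _ _).trans (((cls_genOf hT).map_w f).trans ?_)
    rw [F.map_comp, F.map_comp, Category.assoc, Category.assoc, Category.assoc, hA.w]

theorem node_sup_p (hA : Cls adj A a χ α) (hB : Cls adj B b α β)
    {T : (splitCat adj M).Ty Γ} (hT : T = mk X.ty χ) {Θ : E} (z : Θ ⟶ (splitCat adj M).ext A)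
    (f : (splitCat adj M).Lift
      ((splitCat adj M).p ((splitCat adj M).sub z B) ≫ z ≫ (splitCat adj M).p A) T) :
    (node X hA hB hT z f).sup ≫ M.p X.ty = F.map (z ≫ (splitCat adj M).p A) ≫ χ := by
  rw [Node.sup_p, F.map_comp, Category.assoc, Category.assoc, hA.w]

/-- The W-type classified by a given one. -/
noncomputable def mkW (hA : Cls adj A a χ α) (hB : Cls adj B b α β) :
    (splitCat adj M).WData A B where
  ty := mk X.ty χ
  sup z f := mkLift (z ≫ (splitCat adj M).p A) (node X hA hB rfl z f).sup
    (node_sup_p X hA hB rfl z f)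
  sup_natural t z f := by
    let s : (splitCat adj M).Lift (z ≫ (splitCat adj M).p A) (mk X.ty χ) :=
      mkLift (z ≫ (splitCat adj M).p A) (node X hA hB rfl z f).sup (node_sup_p X hA hB rfl z f)
    refine congrArg TypeCat.Lift.hom ((cls_genOf (T := X.ty) (χ := χ) rfl).lift_ext
      (d' := s.precomp t _ (Category.assoc _ _ _).symm) ?_)
    refine (map_mkLift _ _ _).trans ?_
    refine Eq.trans ?_ ((congrArg (· ≫ genOf rfl) (F.map_comp t s.hom)).trans
      (Category.assoc _ _ _)).symm
    refine Eq.trans ?_ (congrArg (F.map t ≫ ·) (map_mkLift _ _ (node_sup_p X hA hB rfl z f))).symm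
    refine Node.sup_comp (x := node X hA hB rfl (t ≫ z) (f.precomp _ _ (by simp)))
      (y := node X hA hB rfl z f) (F.map t) (F.map ((splitCat adj M).slide t z B)) ?_ ?_ ?_ ?_
    · exact (Category.assoc _ _ _).symm.trans (congrArg (· ≫ α) (F.map_comp _ _).symm)
    · exact (Category.assoc _ _ _).symm.trans (congrArg (· ≫ β) ((F.map_comp _ _).symm.trans
        (congrArg F.map (TypeCat.slide_up _ _ _ _))))
    · exact (F.map_comp _ _).symm.trans ((congrArg F.map (TypeCat.slide_p _ _ _ _)).trans
        (F.map_comp _ _))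
    · exact (Category.assoc _ _ _).symm.trans (congrArg (· ≫ genOf rfl) (F.map_comp _ _).symm)

theorem ty_mkW {hA : Cls adj A a χ α} {hB : Cls adj B b α β} {X₀ : (splitCat adj M).WData A B}
    (hX : X₀ = mkW X hA hB) : X₀.ty = mk X.ty χ :=
  congrArg TypeCat.WData.ty hX

theorem map_sup {hA : Cls adj A a χ α} {hB : Cls adj B b α β} {X₀ : (splitCat adj M).WData A B}
    (hX : X₀ = mkW X hA hB) {Θ : E} (z : Θ ⟶ (splitCat adj M).ext A)
    (f : (splitCat adj M).Lift
      ((splitCat adj M).p ((splitCat adj M).sub z B) ≫ z ≫ (splitCat adj M).p A) X₀.ty) :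
    F.map (X₀.sup z f).hom ≫ genOf (ty_mkW X hX) = (node X hA hB (ty_mkW X hX) z f).sup := by
  subst hX
  exact map_mkLift _ _ (node_sup_p X hA hB rfl z f)

/-- The introduction terms are compared by names. The two nodes have the same point of `a` and
differ only in the pullback of `b`, substituted in one or in two stages; `resub` is the comparison.
-/
theorem mkW_reindex (hA : Cls adj A a χ α) (hB : Cls adj B b α β) {Θ : E} (σ : Θ ⟶ Γ) :
    (mkW X hA hB).reindex σ = mkW X (hA.sub σ) (hB.sub _) := by
  refine TypeCat.WData.ext rfl (heq_of_eq ?_)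
  funext Ξ z f
  refine ((cls_genOf (T := X.ty) (χ := χ) rfl).sub σ).lift_ext ?_
  dsimp only [TypeCat.WData.reindex]
  refine (map_reindex (α := genOf rfl) _ σ (𝟙 _) _ _).trans ?_
  refine (congrArg (F.map _ ≫ ·) (map_sup X rfl _ _)).trans ?_
  refine Eq.trans ?_ (congrArg (F.map _ ≫ ·) (genOf_sub rfl σ rfl)).symm
  refine Eq.trans ?_ (map_sup X (hA := hA.sub σ) (hB := hB.sub _) rfl z f).symm
  refine (congrArg (· ≫ _) (F.map_id _)).trans ((Category.id_comp _).trans ?_)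
  refine (Node.sup_comp (x := node X hA hB rfl (z ≫ (splitCat adj M).up σ A)
    (TypeCat.WData.arg σ z f)) (y := node X (hA.sub σ) (hB.sub _) (sub_mk σ X.ty χ) z f) (𝟙 _)
    (F.map (TypeCat.WData.resub σ z)) ?_ ?_ ?_ ?_).trans (Category.id_comp _)
  · refine (Category.id_comp _).trans ((Category.assoc _ _ _).symm.trans ?_)
    exact congrArg (· ≫ α) (F.map_comp _ _).symm
  · refine (Category.assoc _ _ _).symm.trans ((Category.assoc _ _ _).symm.trans ?_)
    refine congrArg (· ≫ β) ?_
    rw [← F.map_comp, ← F.map_comp]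
    congr 1
    simp [TypeCat.WData.resub]
  · refine (F.map_comp _ _).symm.trans ((congrArg F.map (TypeCat.WData.resub_p _ _)).trans ?_)
    exact (Category.comp_id _).symm
  · refine (congrArg (F.map _ ≫ F.map _ ≫ ·) (genOf_sub rfl σ rfl).symm).trans ?_
    simp only [← Category.assoc, ← F.map_comp]
    exact congrArg (F.map · ≫ genOf rfl) (Category.assoc _ _ _)

theorem mkW_congr {χ' α' β'} (hA : Cls adj A a χ α) (hB : Cls adj B b α β)
    (hA' : Cls adj A a χ' α') (hB' : Cls adj B b α' β') (e₁ : χ = χ') (e₂ : α = α') (e₃ : β = β') :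
    mkW X hA hB = mkW X hA' hB' := by
  subst e₁ e₂ e₃
  rfl

end W

end splitCat

end Restricted

/-! ### Elimination of W-types in the restricted splitting -/

section Restricted

variable {C : Type u} [Category.{v} C] {E : Type u} [Category.{v} E] [HasPullbacks E]
  {F : E ⥤ C} {R : C ⥤ E} {adj : F ⊣ R} {M : TypeCat.{v, u, w} C}

namespace splitCat

section W

open TypeCat.WData (Node Arg StepProblem)

variable {Y : C} {a : M.Ty Y} {b : M.Ty (M.ext a)} {X : M.WData a b} {W : C} {π : W ⟶ Y}
  {T : M.Ty (M.ext (M.sub π X.ty))} {Γ : E} {A : (splitCat adj M).Ty Γ}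
  {B : (splitCat adj M).Ty ((splitCat adj M).ext A)} {X₀ : (splitCat adj M).WData A B}

variable [PreservesFiniteLimits F] [R.Full] [R.Faithful]

/-- The names of a W-type and of a motive over it. -/
structure Motive (T : M.Ty (M.ext (M.sub π X.ty))) (X₀ : (splitCat adj M).WData A B)
    (A' : (splitCat adj M).Ty ((splitCat adj M).ext X₀.ty)) where
  χ : F.obj Γ ⟶ Y
  α : F.obj ((splitCat adj M).ext A) ⟶ M.ext a
  β : F.obj ((splitCat adj M).ext B) ⟶ M.ext b
  hA : Cls adj A a χ α
  hB : Cls adj B b α β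
  hX : X₀ = mkW X hA hB
  r : F.obj Γ ⟶ W
  ρ : F.obj ((splitCat adj M).ext X₀.ty) ⟶ M.ext (M.sub π X.ty)
  γ : F.obj ((splitCat adj M).ext A') ⟶ M.ext T
  hr : r ≫ π = χ
  hρ : ρ ≫ M.up π X.ty = genOf (ty_mkW X hX)
  hW : Cls adj X₀.ty (M.sub π X.ty) r ρ
  hT : Cls adj A' T ρ γ

namespace Motive

variable {A' : (splitCat adj M).Ty ((splitCat adj M).ext X₀.ty)} (x : Motive T X₀ A')

section

variable {Ξ : E} (z : Ξ ⟶ (splitCat adj M).ext A)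
  (f : (splitCat adj M).Lift
    ((splitCat adj M).p ((splitCat adj M).sub z B) ≫ z ≫ (splitCat adj M).p A) X₀.ty)
  (h : (splitCat adj M).Lift f.hom A')

/-- The names of arguments of the premise of the elimination rule. -/
noncomputable abbrev arg : Arg X π T where
  Z := F.obj Ξ
  g := F.map (z ≫ (splitCat adj M).p A) ≫ x.r
  z := F.map z ≫ x.α
  hg := by rw [Category.assoc, x.hA.w, Category.assoc, x.hr, F.map_comp, Category.assoc]
  Q := F.obj ((splitCat adj M).ext ((splitCat adj M).sub z B))
  q₁ := F.map ((splitCat adj M).up z B) ≫ x.β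
  q₂ := F.map ((splitCat adj M).p _)
  hQ := x.hB.sub z
  h := F.map h.hom ≫ x.γ
  hh := by
    rw [Category.assoc, reassoc_of% x.hT.w, ← Category.assoc, ← F.map_comp, h.w, x.hW.w,
      ← Category.assoc, ← F.map_comp, f.w, F.map_comp, Category.assoc]

theorem arg_res : (x.arg z f h).res = F.map (X₀.sup z f).hom ≫ x.ρ := by
  apply M.hom_ext
  · rw [Arg.res_p, Category.assoc, x.hW.w, ← Category.assoc, ← F.map_comp, TypeCat.Lift.w]
  · rw [Arg.res_up, Category.assoc, x.hρ, map_sup X x.hX]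
    refine (Node.sup_comp (x := (x.arg z f h).node)
      (y := node X x.hA x.hB (ty_mkW X x.hX) z f) (𝟙 _) (𝟙 _) (Category.id_comp _)
      (Category.id_comp _) ((Category.id_comp _).trans (Category.comp_id _).symm) ?_).trans
      (Category.id_comp _)
    refine (Category.id_comp _).trans ?_
    dsimp only
    rw [Category.assoc, reassoc_of% x.hT.w, x.hρ]
    refine Eq.trans ?_ (Category.assoc _ _ _)
    exact congrArg (· ≫ genOf _) ((congrArg F.map h.w).symm.trans (F.map_comp _ _))

end

/-- Generic arguments of the premise of the elimination rule. -/
structure Generic (e₀ : Arg X π T) where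
  Θ : E
  z : Θ ⟶ (splitCat adj M).ext A
  f : (splitCat adj M).Lift
    ((splitCat adj M).p ((splitCat adj M).sub z B) ≫ z ≫ (splitCat adj M).p A) X₀.ty
  h : (splitCat adj M).Lift f.hom A'
  s : F.obj Θ ⟶ e₀.Z
  hs : IsPullback s (F.map (z ≫ (splitCat adj M).p A)) e₀.g x.r
  isLocalMap : IsLocalMap adj (z ≫ (splitCat adj M).p A)
  l : F.obj ((splitCat adj M).ext ((splitCat adj M).sub z B)) ⟶ e₀.Q
  hom : Arg.Hom (x.arg z f h) e₀ s l

/-- A premise in `E` can be evaluated only at objects of `E`. The pullback of `e₀.Z` along `r` is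
therefore realised as `F Θ` with `Θ` local over `Γ`, and the arguments over `Θ` are the terms with
the prescribed names. -/
theorem nonempty_generic [HasPullbacks C] (e₀ : Arg X π T) : Nonempty (x.Generic e₀) := by
  obtain ⟨Θ, m, s, hm, hs⟩ := exists_isLocalMap_isPullback adj e₀.g x.r
  obtain ⟨⟨z, rfl⟩, hz⟩ := x.hA.exists_lift m (s ≫ e₀.z) (by
    rw [Category.assoc, e₀.hg, reassoc_of% hs.w, x.hr])
  dsimp only at hz
  have hB := (x.hB.sub z).congr rfl rfl rfl hz
  have hl : (F.map ((splitCat adj M).up z B) ≫ x.β) ≫ M.p b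
      = (F.map ((splitCat adj M).p ((splitCat adj M).sub z B)) ≫ s) ≫ e₀.z :=
    hB.w.trans (Category.assoc _ _ _).symm
  let l := e₀.hQ.lift _ _ hl
  have l₁ : l ≫ e₀.q₁ = _ := e₀.hQ.lift_fst _ _ hl
  have l₂ : l ≫ e₀.q₂ = _ := e₀.hQ.lift_snd _ _ hl
  obtain ⟨f, hf⟩ := x.hW.exists_lift
    ((splitCat adj M).p ((splitCat adj M).sub z B) ≫ z ≫ (splitCat adj M).p A)
    (l ≫ e₀.h ≫ M.p T) (by
      rw [Category.assoc, Category.assoc, e₀.hh, reassoc_of% l₂, hs.w, ← Category.assoc,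
        ← F.map_comp])
  obtain ⟨h, hh⟩ := x.hT.exists_lift f.hom (l ≫ e₀.h) (by rw [hf, Category.assoc])
  exact ⟨⟨Θ, z, f, h, s, hs, hm, l, hs.w, hz.symm, l₁, l₂, hh.symm⟩⟩

namespace Generic

variable {x} {e₀ : Arg X π T} (G : x.Generic e₀)

/-- Since `Θ` is local over `Γ`, points of the pullback in `C` come from maps in `E`. -/
theorem exists_hom {Ξ : E} (k : Ξ ⟶ Γ) (w : F.obj Ξ ⟶ e₀.Z) (hw : w ≫ e₀.g = F.map k ≫ x.r) :
    ∃ m : Ξ ⟶ G.Θ, m ≫ G.z ≫ (splitCat adj M).p A = k ∧ F.map m ≫ G.s = w := by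
  obtain ⟨m, hm, hm'⟩ := G.isLocalMap.exists_map k (G.hs.lift w (F.map k) hw) (G.hs.lift_snd _ _ _)
  exact ⟨m, hm, by rw [hm', G.hs.lift_fst]⟩

/-- A Yoneda argument: terms in `E` are determined by their names, so arguments whose names factor
through the generic ones are restrictions of these in `E`. Naturality of `d` then determines its
value, and `d` is encoded by its value at `G`. -/
theorem op_eq (d : X₀.Step A') {Ξ : E} (z : Ξ ⟶ (splitCat adj M).ext A)
    (f : (splitCat adj M).Lift
      ((splitCat adj M).p ((splitCat adj M).sub z B) ≫ z ≫ (splitCat adj M).p A) X₀.ty)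
    (h : (splitCat adj M).Lift f.hom A') (m : Ξ ⟶ G.Θ)
    (hm : m ≫ G.z ≫ (splitCat adj M).p A = z ≫ (splitCat adj M).p A)
    (l : F.obj ((splitCat adj M).ext ((splitCat adj M).sub z B)) ⟶ e₀.Q)
    (H : Arg.Hom (x.arg z f h) e₀ (F.map m ≫ G.s) l) :
    (d.op z f h).hom = m ≫ (d.op G.z G.f G.h).hom := by
  have hz : z = m ≫ G.z := by
    let s₁ : (splitCat adj M).Lift (z ≫ (splitCat adj M).p A) A := ⟨z, rfl⟩
    let s₂ : (splitCat adj M).Lift (z ≫ (splitCat adj M).p A) A :=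
      ⟨m ≫ G.z, (Category.assoc _ _ _).trans hm⟩
    refine congrArg TypeCat.Lift.hom (x.hA.lift_ext (d := s₁) (d' := s₂) ?_)
    refine H.z.symm.trans ?_
    rw [Category.assoc, G.hom.z, F.map_comp, Category.assoc]
  subst hz
  have hl : l = F.map ((splitCat adj M).slide m G.z B) ≫ G.l := by
    apply e₀.hQ.hom_ext
    · rw [Category.assoc, G.hom.q₁, H.q₁, ← Category.assoc, ← F.map_comp, TypeCat.slide_up]
    · rw [Category.assoc, G.hom.q₂, H.q₂, ← Category.assoc, ← Category.assoc, ← F.map_comp,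
        ← F.map_comp, TypeCat.slide_p]
  have hh : F.map h.hom ≫ x.γ = F.map ((splitCat adj M).slide m G.z B ≫ G.h.hom) ≫ x.γ := by
    refine H.h.symm.trans ?_
    rw [hl, Category.assoc, G.hom.h, F.map_comp, Category.assoc]
  have hf : f.hom = (splitCat adj M).slide m G.z B ≫ G.f.hom := by
    refine congrArg TypeCat.Lift.hom (x.hW.lift_ext (d' := G.f.precomp
      ((splitCat adj M).slide m G.z B) _ (by simp)) ?_)
    -- The name of `f` is recovered from that of `h` by projecting the motive to the W-type.
    have e : ∀ {Q : E} {f' : Q ⟶ (splitCat adj M).ext X₀.ty} (h' : (splitCat adj M).Lift f' A'),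
        (F.map h'.hom ≫ x.γ) ≫ M.p T = F.map f' ≫ x.ρ := fun h' =>
      (Category.assoc _ _ _).trans (x.hT.map_w h')
    exact (e h).symm.trans ((congrArg (· ≫ M.p T) hh).trans
      (e (G.h.precomp ((splitCat adj M).slide m G.z B) _ rfl)))
  have hh' : h.hom = (splitCat adj M).slide m G.z B ≫ G.h.hom :=
    congrArg TypeCat.Lift.hom (x.hT.lift_ext (d' := G.h.precomp
      ((splitCat adj M).slide m G.z B) _ hf.symm) hh)
  refine Eq.trans ?_ (d.natural m G.z G.f G.h)
  exact d.op_congr rfl _ _ (hf.trans (Category.id_comp _).symm) _ _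
    (hh'.trans (Category.id_comp _).symm)

variable (d : X₀.Step A')

/-- The instance of the elimination rule given by its premise. -/
noncomputable def problem : StepProblem e₀ where
  Z := F.obj Γ
  r := x.r
  P := F.obj ((splitCat adj M).ext X₀.ty)
  ρ := x.ρ
  v := F.map ((splitCat adj M).p X₀.ty)
  hP := x.hW
  Z' := F.obj G.Θ
  s₁ := G.s
  s₂ := F.map (G.z ≫ (splitCat adj M).p A)
  hZ := G.hs
  st := F.map (d.op G.z G.f G.h).hom ≫ x.γ
  hst := by
    rw [Category.assoc, x.hT.map_w, ← x.arg_res _ _ G.h]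
    exact G.hom.res

/-- Arguments with the recursive values of `s` are classified by a map to `e₀.Z`, which comes from a
map `m` in `E`. The solution property at this point, with `op_eq` on the right, is the computation
rule for names. -/
theorem computes (he₀ : ∀ e : Arg X π T, ∃! w : e.Z ⟶ e₀.Z, ∃ l : e.Q ⟶ e₀.Q, Arg.Hom e e₀ w l)
    (s : (splitCat adj M).Sec A') (hs : (G.problem d).IsSolution (F.map s.hom ≫ x.γ)) :
    X₀.Computes d s := by
  intro Ξ z f
  let h : (splitCat adj M).Lift f.hom A' := s.precomp f.hom _ (Category.comp_id _)
  let t : (splitCat adj M).Lift (X₀.sup z f).hom A' :=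
    s.precomp (X₀.sup z f).hom _ (Category.comp_id _)
  refine congrArg TypeCat.Lift.hom (x.hT.lift_ext (d := t) (d' := d.op z f h) ?_)
  obtain ⟨w, ⟨l, hl⟩, -⟩ := he₀ (x.arg z f h)
  obtain ⟨m, hm, rfl⟩ := G.exists_hom (z ≫ (splitCat adj M).p A) w hl.g
  have e₁ : F.map (z ≫ (splitCat adj M).p A) = F.map m ≫ F.map (G.z ≫ (splitCat adj M).p A) := by
    rw [← F.map_comp, hm]
  refine ((congrArg (· ≫ x.γ) (F.map_comp _ _)).trans (Category.assoc _ _ _)).trans ?_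
  refine (hs.2 (x.arg z f h) (F.map m) l (F.map f.hom) (F.map (X₀.sup z f).hom) hl ?_ ?_
    (x.arg_res z f h).symm ?_).trans ?_
  · exact ((congrArg (· ≫ x.γ) (F.map_comp _ _)).trans (Category.assoc _ _ _)).symm
  · refine (F.map_comp _ _).symm.trans ((congrArg F.map f.w).trans ((F.map_comp _ _).trans ?_))
    exact congrArg (F.map _ ≫ ·) e₁
  · exact (F.map_comp _ _).symm.trans ((congrArg F.map (X₀.sup z f).w).trans e₁)
  · rw [G.op_eq d z f h m hm l hl, F.map_comp, Category.assoc]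
    rfl

/-- The generic arguments over `Γ` and over `Ψ` are chosen independently. Those over `Ψ`, transposed
along `σ`, are classified by the ones over `Γ`, and `op_eq` identifies the values of the premise
there. -/
theorem restr_problem {Ψ : E} (σ : Ψ ⟶ Γ) (x' : Motive T (X₀.reindex σ)
      ((splitCat adj M).sub ((splitCat adj M).up σ X₀.ty) A'))
    (hα : F.map ((splitCat adj M).up σ A) ≫ x.α = x'.α)
    (hβ : F.map ((splitCat adj M).up ((splitCat adj M).up σ A) B) ≫ x.β = x'.β)
    (hr : F.map σ ≫ x.r = x'.r)
    (hρ : F.map ((splitCat adj M).up σ X₀.ty) ≫ x.ρ = x'.ρ)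
    (hγ : F.map ((splitCat adj M).up ((splitCat adj M).up σ X₀.ty) A') ≫ x.γ = x'.γ)
    (G' : x'.Generic e₀) :
    ∃ ζ, StepProblem.Restr (G'.problem (d.reindex σ)) (G.problem d) (F.map σ)
      (F.map ((splitCat adj M).up σ X₀.ty)) ζ := by
  have hg : G'.s ≫ e₀.g
      = F.map (G'.z ≫ (splitCat adj M).p ((splitCat adj M).sub σ A) ≫ σ) ≫ x.r := by
    rw [G'.hs.w, ← hr]
    simp only [F.map_comp, Category.assoc]
  obtain ⟨ζ, hζ, hζ'⟩ := G.exists_hom _ G'.s hg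
  have hz : G'.z ≫ (splitCat adj M).p ((splitCat adj M).sub σ A) ≫ σ
      = G'.z ≫ (splitCat adj M).up σ A ≫ (splitCat adj M).p A :=
    congrArg (G'.z ≫ ·) (TypeCat.up_p _ σ A).symm
  refine ⟨F.map ζ, hr, hρ, ?_, hζ', ?_, ?_⟩
  · exact (F.map_comp _ _).symm.trans ((congrArg F.map (TypeCat.up_p _ σ X₀.ty)).trans
      (F.map_comp _ _))
  · refine (F.map_comp _ _).symm.trans ((congrArg F.map hζ).trans ?_)
    exact (congrArg F.map (Category.assoc _ _ _)).symm.trans (F.map_comp _ _)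
  · have H : Arg.Hom (x.arg (G'.z ≫ (splitCat adj M).up σ A) (TypeCat.WData.arg σ G'.z G'.f)
        (TypeCat.WData.argStep σ G'.z G'.f G'.h)) (x'.arg G'.z G'.f G'.h) (𝟙 _)
        (F.map (TypeCat.WData.resub σ G'.z)) := by
      refine ⟨?_, ?_, ?_, ?_, ?_⟩
      · refine (Category.id_comp _).trans ?_
        refine Eq.trans ?_ (congrArg (F.map · ≫ x.r) (hz.trans (Category.assoc _ _ _).symm))
        refine (congrArg (F.map _ ≫ ·) hr.symm).trans ?_
        rw [← Category.assoc, ← F.map_comp, Category.assoc]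
      · refine (Category.id_comp _).trans ((congrArg (F.map _ ≫ ·) hα.symm).trans ?_)
        rw [← Category.assoc, ← F.map_comp]
      · refine (congrArg (F.map _ ≫ F.map _ ≫ ·) hβ.symm).trans ?_
        simp only [← Category.assoc, ← F.map_comp]
        refine congrArg (F.map · ≫ x.β) ?_
        simp [TypeCat.WData.resub]
      · exact (F.map_comp _ _).symm.trans ((congrArg F.map (TypeCat.WData.resub_p _ _)).trans
          (Category.comp_id _).symm)
      · refine (congrArg (F.map _ ≫ F.map _ ≫ ·) hγ.symm).trans ?_
        refine (congrArg (F.map _ ≫ ·) (F.map_comp_assoc _ _ _).symm).trans ?_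
        exact (F.map_comp_assoc _ _ _).symm
    have e := G.op_eq d _ _ _ ζ (hζ.trans (hz.trans (Category.assoc _ _ _).symm)) _
      ((congrArg (fun w => Arg.Hom _ e₀ w _) ((Category.id_comp _).trans hζ'.symm)).mp
        (H.trans G'.hom))
    refine (Category.assoc _ _ _).symm.trans ((congrArg (· ≫ x.γ) (F.map_comp _ _).symm).trans ?_)
    refine (congrArg (F.map · ≫ x.γ) e.symm).trans (Eq.trans ?_ (congrArg (F.map _ ≫ ·) hγ))
    refine Eq.trans ?_ (F.map_comp_assoc _ _ _)
    refine congrArg (F.map · ≫ x.γ) (Eq.trans ?_ (TypeCat.pair_up _ _ _ _ _ _).symm)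
    exact (Category.id_comp _).symm

end Generic

section Elim

variable [HasPushes C] [HasPullbacks C] (H : ∀ {Θ : C} (σ : Θ ⟶ Y), (X.reindex σ).IsW)
  {e₀ : Arg X π T} (he₀ : ∀ e : Arg X π T, ∃! w : e.Z ⟶ e₀.Z, ∃ l : e.Q ⟶ e₀.Q, Arg.Hom e e₀ w l)
  (d : X₀.Step A')

/-- The chosen eliminator. -/
noncomputable def elim : (splitCat adj M).Sec A' :=
  x.hT.lift (𝟙 _) ((StepProblem.exists_natural_solution H he₀).choose
    ((x.nonempty_generic e₀).some.problem d)) (by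
      refine ((StepProblem.exists_natural_solution H he₀).choose_spec.1 _).1.trans ?_
      rw [F.map_id, Category.id_comp]
      rfl)

theorem map_elim : F.map (x.elim H he₀ d).hom ≫ x.γ
    = (StepProblem.exists_natural_solution H he₀).choose
      ((x.nonempty_generic e₀).some.problem d) :=
  Cls.map_lift _ _ _ _

theorem elim_computes : X₀.Computes d (x.elim H he₀ d) :=
  (x.nonempty_generic e₀).some.computes d he₀ _
    ((congrArg ((x.nonempty_generic e₀).some.problem d).IsSolution (x.map_elim H he₀ d)).mpr
      ((StepProblem.exists_natural_solution H he₀).choose_spec.1 _))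

theorem elim_sub {Ψ : E} (σ : Ψ ⟶ Γ) (x' : Motive T (X₀.reindex σ)
      ((splitCat adj M).sub ((splitCat adj M).up σ X₀.ty) A'))
    (hα : F.map ((splitCat adj M).up σ A) ≫ x.α = x'.α)
    (hβ : F.map ((splitCat adj M).up ((splitCat adj M).up σ A) B) ≫ x.β = x'.β)
    (hr : F.map σ ≫ x.r = x'.r)
    (hρ : F.map ((splitCat adj M).up σ X₀.ty) ≫ x.ρ = x'.ρ)
    (hγ : F.map ((splitCat adj M).up ((splitCat adj M).up σ X₀.ty) A') ≫ x.γ = x'.γ) :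
    x'.elim H he₀ (d.reindex σ) = (x.elim H he₀ d).sub ((splitCat adj M).up σ X₀.ty) := by
  refine x'.hT.lift_ext ((x'.map_elim H he₀ (d.reindex σ)).trans ?_)
  obtain ⟨ζ, h⟩ := (x.nonempty_generic e₀).some.restr_problem d σ x' hα hβ hr hρ hγ
    (x'.nonempty_generic e₀).some
  refine ((StepProblem.exists_natural_solution H he₀).choose_spec.2 _ _ _ _ _ h).trans ?_
  refine Eq.trans ?_ (congrArg (F.map _ ≫ ·) hγ)
  refine Eq.trans ?_ (map_secSub _ _).symm
  exact congrArg (F.map _ ≫ ·) (x.map_elim H he₀ d).symm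

end Elim

end Motive

section Named

variable [HasFiniteLimits C] [HasPushes C] {χ : F.obj Γ ⟶ Y}
  {α : F.obj ((splitCat adj M).ext A) ⟶ M.ext a} {β : F.obj ((splitCat adj M).ext B) ⟶ M.ext b}
  {hA : Cls adj A a χ α} {hB : Cls adj B b α β} (hX : X₀ = mkW X hA hB)
  (A' : (splitCat adj M).Ty ((splitCat adj M).ext X₀.ty))

/-- The names of a W-type with a given name and of a motive over it. -/
noncomputable def motiveOf : Motive (famCod X.ty (top A')) X₀ A' where
  χ := χ
  α := α
  β := β
  hA := hA
  hB := hB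
  hX := hX
  -- The motive is a family over the W-type, so it is named through the universe of families over
  -- `X.ty`. Its generic version then depends only on the local universes of the W-type and of the
  -- motive.
  r := ((famU X.ty (base A')).existsUnique (cls_genOf (ty_mkW X hX)) (name A')).choose
  ρ := ((famU X.ty (base A')).existsUnique (cls_genOf (ty_mkW X hX))
    (name A')).choose_spec.1.2.choose
  γ := M.pair (famU X.ty (base A')).ev (top A') (F.map ((splitCat adj M).p A') ≫
    ((famU X.ty (base A')).existsUnique (cls_genOf (ty_mkW X hX))
      (name A')).choose_spec.1.2.choose) (gen A') (by
    rw [Category.assoc, ((famU X.ty (base A')).existsUnique (cls_genOf (ty_mkW X hX))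
      (name A')).choose_spec.1.2.choose_spec.2.2]
    exact (cls_gen A').w)
  hr := ((famU X.ty (base A')).existsUnique (cls_genOf (ty_mkW X hX)) (name A')).choose_spec.1.1
  hρ := ((famU X.ty (base A')).existsUnique (cls_genOf (ty_mkW X hX))
    (name A')).choose_spec.1.2.choose_spec.1
  hW := by
    refine IsPullback.of_right ?_ ((famU X.ty (base A')).existsUnique (cls_genOf (ty_mkW X hX))
      (name A')).choose_spec.1.2.choose_spec.2.1 (M.isPullback _ _)
    exact (cls_genOf (ty_mkW X hX)).congr ((famU X.ty (base A')).existsUnique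
      (cls_genOf (ty_mkW X hX)) (name A')).choose_spec.1.2.choose_spec.1.symm rfl rfl
      ((famU X.ty (base A')).existsUnique (cls_genOf (ty_mkW X hX))
        (name A')).choose_spec.1.1.symm
  hT := by
    refine IsPullback.of_right ?_ (M.pair_p _ _ _ _ _) (M.isPullback _ _)
    exact (cls_gen A').congr (M.pair_up _ _ _ _ _).symm rfl rfl
      ((famU X.ty (base A')).existsUnique (cls_genOf (ty_mkW X hX))
        (name A')).choose_spec.1.2.choose_spec.2.2.symm

theorem motiveOf_ev : (motiveOf hX A').ρ ≫ (famU X.ty (base A')).ev = name A' :=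
  ((famU X.ty (base A')).existsUnique (cls_genOf (ty_mkW X hX))
    (name A')).choose_spec.1.2.choose_spec.2.2

theorem motiveOf_up : (motiveOf hX A').γ ≫ M.up (famU X.ty (base A')).ev (top A') = gen A' :=
  M.pair_up _ _ _ _ _

variable {Ψ : E} (σ : Ψ ⟶ Γ) {χ' : F.obj Ψ ⟶ Y}
  {α' : F.obj ((splitCat adj M).ext ((splitCat adj M).sub σ A)) ⟶ M.ext a}
  {β' : F.obj ((splitCat adj M).ext
    ((splitCat adj M).sub ((splitCat adj M).up σ A) B)) ⟶ M.ext b}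
  {hA' : Cls adj ((splitCat adj M).sub σ A) a χ' α'}
  {hB' : Cls adj ((splitCat adj M).sub ((splitCat adj M).up σ A) B) b α' β'}
  (e : χ' = F.map σ ≫ χ) (hX' : X₀.reindex σ = mkW X hA' hB')

-- Both sides classify the substituted motive as a family over the reindexed W-type, in a universe
-- that substitution does not change.
include e in
theorem motiveOf_r_sub : F.map σ ≫ (motiveOf hX A').r
    = (motiveOf hX' ((splitCat adj M).sub ((splitCat adj M).up σ X₀.ty) A')).r := by
  let A'' := (splitCat adj M).sub ((splitCat adj M).up σ X₀.ty) A'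
  refine ((famU X.ty (base A')).existsUnique (cls_genOf (ty_mkW X hX')) (name A'')).unique
    ⟨?_, F.map ((splitCat adj M).up σ X₀.ty) ≫ (motiveOf hX A').ρ, ?_, ?_, ?_⟩
    ⟨(motiveOf hX' A'').hr, _, (motiveOf hX' A'').hρ, (motiveOf hX' A'').hW.w, motiveOf_ev hX' A''⟩
  · rw [Category.assoc, (motiveOf hX A').hr]
    exact e.symm
  · refine (Category.assoc _ _ _).trans ((congrArg (F.map _ ≫ ·) (motiveOf hX A').hρ).trans ?_)
    exact genOf_sub _ σ _
  · exact ((motiveOf hX A').hW.sub σ).w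
  · exact (Category.assoc _ _ _).trans (congrArg (F.map _ ≫ ·) (motiveOf_ev hX A'))

include e in
theorem motiveOf_ρ_sub : F.map ((splitCat adj M).up σ X₀.ty) ≫ (motiveOf hX A').ρ
    = (motiveOf hX' ((splitCat adj M).sub ((splitCat adj M).up σ X₀.ty) A')).ρ := by
  apply M.hom_ext
  · refine ((motiveOf hX A').hW.sub σ).w.trans ?_
    rw [motiveOf_r_sub hX A' σ e hX']
    exact (motiveOf hX' _).hW.w.symm
  · refine (Category.assoc _ _ _).trans ((congrArg (F.map _ ≫ ·) (motiveOf hX A').hρ).trans ?_)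
    exact (genOf_sub _ σ _).trans (motiveOf hX' _).hρ.symm

include e in
theorem motiveOf_γ_sub :
    F.map ((splitCat adj M).up ((splitCat adj M).up σ X₀.ty) A') ≫ (motiveOf hX A').γ
      = (motiveOf hX' ((splitCat adj M).sub ((splitCat adj M).up σ X₀.ty) A')).γ := by
  apply M.hom_ext
  · refine ((motiveOf hX A').hT.sub ((splitCat adj M).up σ X₀.ty)).w.trans ?_
    refine (congrArg (F.map _ ≫ ·) (motiveOf_ρ_sub hX A' σ e hX')).trans ?_
    exact (motiveOf hX' _).hT.w.symm
  · refine (Category.assoc _ _ _).trans ((congrArg (F.map _ ≫ ·) (motiveOf_up hX A')).trans ?_)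
    exact (gen_sub ((splitCat adj M).up σ X₀.ty) A').symm.trans (motiveOf_up hX' _).symm

variable (H : ∀ {Θ : C} (σ : Θ ⟶ Y), (X.reindex σ).IsW) (d : X₀.Step A')

/-- The chosen eliminator. -/
noncomputable def elimW : (splitCat adj M).Sec A' :=
  (motiveOf hX A').elim H (Arg.exists_generic X _ _).choose_spec d

theorem elimW_computes : X₀.Computes d (elimW hX A' H d) :=
  (motiveOf hX A').elim_computes H (Arg.exists_generic X _ _).choose_spec d

include e in
theorem elimW_sub (e₂ : α' = F.map ((splitCat adj M).up σ A) ≫ α)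
    (e₃ : β' = F.map ((splitCat adj M).up ((splitCat adj M).up σ A) B) ≫ β) :
    elimW hX' ((splitCat adj M).sub ((splitCat adj M).up σ X₀.ty) A') H (d.reindex σ)
      = (elimW hX A' H d).sub ((splitCat adj M).up σ X₀.ty) :=
  (motiveOf hX A').elim_sub H (Arg.exists_generic X _ _).choose_spec d σ
    (motiveOf hX' ((splitCat adj M).sub ((splitCat adj M).up σ X₀.ty) A')) e₂.symm
    e₃.symm (motiveOf_r_sub hX A' σ e hX') (motiveOf_ρ_sub hX A' σ e hX')
    (motiveOf_γ_sub hX A' σ e hX')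

end Named

section

variable [HasFiniteLimits C] [HasPushes C]
  (S : ∀ {Γ : C} (A : M.Ty Γ) (B : M.Ty (M.ext A)), M.WData A B)

/-- The chosen W-type. -/
noncomputable def formW {Γ : E} (A : (splitCat adj M).Ty Γ)
    (B : (splitCat adj M).Ty ((splitCat adj M).ext A)) : (splitCat adj M).WData A B :=
  mkW (S (famDom (top A) (base B)) (famCod (top A) (top B))) (cls_famGen A B) (cls_famGen' A B)

theorem formW_sub {Θ Γ : E} (σ : Θ ⟶ Γ) (A : (splitCat adj M).Ty Γ)
    (B : (splitCat adj M).Ty ((splitCat adj M).ext A)) :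
    formW S ((splitCat adj M).sub σ A) ((splitCat adj M).sub ((splitCat adj M).up σ A) B)
      = (formW S A B).reindex σ := by
  refine Eq.trans ?_ (mkW_reindex _ _ _ σ).symm
  exact mkW_congr _ _ _ _ _ (famName_sub A B σ) (famGen_sub A B σ) (famGen'_sub A B σ)

end

theorem strictW [HasFiniteLimits C] [HasPushes C] (h : M.WeakW) :
    Nonempty (splitCat adj M).StrictW := by
  choose S hS using @h
  exact ⟨{
    form := formW S
    form_sub := formW_sub S
    elim := @fun _ A B _ hX A' d => elimW (hA := cls_famGen A B) (hB := cls_famGen' A B) hX A'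
      (hS _ _) d
    comp := @fun _ A B _ hX A' d => elimW_computes (hA := cls_famGen A B)
      (hB := cls_famGen' A B) hX A' (hS _ _) d
    elim_sub := @fun _ _ σ A B _ hX hX' A' d => elimW_sub (hA := cls_famGen A B)
      (hB := cls_famGen' A B) hX A' σ (hA' := cls_famGen _ _) (hB' := cls_famGen' _ _)
      (famName_sub A B σ) hX' (hS _ _) d (famGen_sub A B σ) (famGen'_sub A B σ) }⟩

end W

end splitCat

end Restricted

/-- Weakly stable structure gives strictly stable structure on the restriction of the left adjoint
splitting along a left exact localization. -/
theorem splitCat.hasStrictlyStable {C : Type u} [Category.{v} C] {E : Type u} [Category.{v} E]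
    [LocallyCartesianClosed E] [HasTerminal E] {F : E ⥤ C} {R : C ⥤ E} [PreservesFiniteLimits F]
    [R.Full] [R.Faithful] (adj : F ⊣ R) (M : TypeCat.{v, u, w} C) (c : TypeConstructor)
    (h : M.HasWeaklyStable c) : (splitCat adj M).HasStrictlyStable c := by
  have : HasFiniteLimits E := hasFiniteLimits_of_hasTerminal_and_pullbacks
  have : Reflective R := { L := F, adj := adj }
  -- Finite limits pass to the reflective subcategory. Together with pushforwards they are all that
  -- the universes and universal problems need in `C`.
  have : HasFiniteLimits C := ⟨fun J _ _ => hasLimitsOfShape_of_reflective R⟩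
  have : HasPushes C := hasPushes_of_localization adj
  cases c with
  | pi => exact strictPi h
  | piEta => exact strictPiEta h
  | sigma => exact strictSigma h
  | sigmaEta => exact strictSigmaEta h
  | id => exact strictId h
  | idExt => exact strictIdExt h
  | zero => exact strictZero h
  | unit => exact strictUnit h
  | sum => exact strictSum h
  | w => exact strictW h

end MATT

theorem mainTheorem10 {L : Type u₁} [Bicategory.{w₁, v₁} L] [Bicategory.Strict L]
    (S : ∀ ⦃p q : L⦄, (p ⟶ q) → Prop)
    (M : MATT.AdjointModalPreModel.{w₁, v₁, u₁, v, u, v₃, u₃} S) :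
    (∀ p : L, MATT.IsLocalExponentialIdeal (M.R p)) ∧
    ∀ (c : MATT.TypeConstructor) (p : L),
      (M.τ p).typeCat.HasWeaklyStable c → (M.splitModel p).typeCat.HasStrictlyStable c := by
  refine ⟨fun p X Y g P a f hf => ?_, fun c p h => ?_⟩
  · let E := M.Chat.functor.obj ⟨⟨p⟩⟩
    let F : E ⥤ M.C.obj ⟨p⟩ := (M.reflect.app p).toFunctor
    let adj : F ⊣ M.R p := M.adj p
    have : PreservesFiniteLimits F := M.preservesFiniteLimits p
    have := M.full p
    have := M.faithful p
    -- Being a pullback of a map in the image of the right adjoint is locality, which pushforward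
    -- preserves.
    have h : MATT.IsLocalMap adj f.hom := hf.isLocalMap adj
    exact (MATT.IsLocalMap.pushforward (adj := adj) g P a f h).isPullbackOfImage
  · exact @MATT.splitCat.hasStrictlyStable _ _ (M.Chat.functor.obj ⟨⟨p⟩⟩) _ (M.lcc _)
      (M.Chat.hasTerminal _) _ (M.R p) (M.preservesFiniteLimits p) (M.full p) (M.faithful p)
      (M.adj p) (M.τ p).typeCat c h
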